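/- Consider the spherical pendulum in units in which mass, length and gravitational acceleration equal $1$, with Hamiltonian $H=\tfrac12|\mathbf L|^2+z-1$ on $T^*S^2$, so that the unstable upper equilibrium (a focus-focus point) has energy $h=0$ and vertical angular momentum $j_2=0$. For $(h,j_2)$ near $(0,0)$ with $j_2\neq0$ put $P(\zeta)=2(1-\zeta^2)(h+1-\zeta)-j_2^2$, let $\zeta_0<\zeta_1$ be the two roots of $P$ in $(-1,1)$, and let $$W(h,j_2)=\frac1{2\pi}\oint_\beta\frac{j_2}{(1-\zeta^2)\,w}\,d\zeta=\frac1\pi\int_{\zeta_0}^{\zeta_1}\frac{j_2}{(1-\zeta^2)\sqrt{P(\zeta)}}\,d\zeta ,\qquad w^2=P(\zeta),$$ be the rotation number, i.e. the advance of the azimuthal angle during one period of the inclination, divided by $2\pi$. Put $\varrho=\sqrt{h^2+j_2^2}$ and let $\operatorname{Arg}$ be the principal argument. Then $2\pi W$ has, to all orders, the asymptotic expansion $$2\pi W\sim 2\pi\operatorname{sgn}j_2-\operatorname{Arg}(h+ij_2)+\frac38\,j_2\Big(\sum_{n\ge0}c_n(h,j_2)\Big)\ln\frac{32}{\varrho}+\sum_{n\ge1}\frac{p_n(h,j_2)}{\varrho^{2n}}$$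 as $(h,j_2)\to(0,0)$ with $j_2\ne0$, where $c_n$ and $p_n$ are real homogeneous polynomials of degrees $n$ and $3n$ respectively, with $$c_0=1,\quad c_1=-\tfrac5{16}h,\quad c_2=\tfrac{35}{256}(h^2+j_2^2),$$ $$p_1=-\tfrac{j_2}{8}(5h^2+6j_2^2),\quad p_2=\tfrac{j_2h}{256}(77h^4+174j_2^2h^2+93j_2^4).$$ Precisely: there are such polynomials such that for every $N\ge0$ $$2\pi W-\Big[2\pi\operatorname{sgn}j_2-\operatorname{Arg}(h+ij_2)+\frac38\,j_2\Big(\sum_{n=0}^{N-1}c_n\Big)\ln\frac{32}{\varrho}+\sum_{n=1}^{N}\frac{p_n}{\varrho^{2n}}\Big]=O\Big(\varrho^{N+1}\ln\frac{32}{\varrho}\Big).$$ In particular (from the case $N=3$), $$2\pi W=2\pi\operatorname{sgn}j_2-\operatorname{Arg}(h+ij_2)+\frac38j_2\Big(1-\frac5{16}h+\frac{35}{256}(h^2+j_2^2)\Big)\ln\frac{32}{\varrho}-\frac{j_2}{8}\,\frac{5h^2+6j_2^2}{\varrho^2}+\frac{j_2h}{256}\,\frac{77h^4+174j_2^2h^2+93j_2^4}{\varrho^4}+O(\varrho^3).$$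 -/

import Mathlib

namespace SphericalPendulum

noncomputable section

/-- The polynomial `P(ζ) = 2(1-ζ²)(h+1-ζ) - j²` of the elliptic curve `w² = P(ζ)`, where
`ζ = cos θ` is the height of the (non-dimensionalised) pendulum, `h` its energy relative to the
upper equilibrium and `j` its angular momentum about the vertical axis. Along the motion,
`(dζ/dt)² = P(ζ)`. -/
def curvePoly (h j ζ : ℝ) : ℝ := 2 * (1 - ζ ^ 2) * (h + 1 - ζ) - j ^ 2

/-- The classically allowed heights `{ζ ∈ [-1,1] | P(ζ) > 0}`. For `j ≠ 0` this is the open interval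
`(ζ₀, ζ₁)` between the two roots of `P` in `(-1,1)`, the interval encircled by the `β`-cycle. -/
def allowedHeights (h j : ℝ) : Set ℝ := {ζ | ζ ∈ Set.Icc (-1) 1 ∧ 0 < curvePoly h j ζ}

/-- The rotation number `W(h,j) = (1/2π) ∮_β j / ((1-ζ²) w) dζ`, with `w² = P(ζ)`: as
`dφ/dt = j/(1-ζ²)` and `dt = dζ/w`, it is the advance of the azimuthal angle `φ` during one
period of the inclination, divided by `2π`. The `β`-cycle runs from `ζ₀` to `ζ₁` with `w = √P`
and back with `w = -√P`, so that `∮_β` is twice the real integral. -/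
def rotationNumber (h j : ℝ) : ℝ :=
  1 / (2 * Real.pi) *
    (2 * ∫ ζ in allowedHeights h j, j / ((1 - ζ ^ 2) * Real.sqrt (curvePoly h j ζ)))

/-- The distance `ϱ = √(h² + j²)` of `(h, j)` from the focus-focus value `(0,0)`. -/
def rho (h j : ℝ) : ℝ := Real.sqrt (h ^ 2 + j ^ 2)

/-- The value at `(h, j)` of a polynomial in two variables (`X 0` stands for `h`, `X 1` for `j`). -/
def evalHJ (p : MvPolynomial (Fin 2) ℝ) (h j : ℝ) : ℝ := MvPolynomial.eval ![h, j] p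

/-- The expansion of `2πW` up to total degree `N` in `(h, j)`, for the
coefficients `c n` (a homogeneous polynomial of degree `n`) of the series multiplying
`(3/8) j ln (32/ϱ)` and the numerators `p n` (a homogeneous polynomial of degree `3n`) of the
rational terms `p n / ϱ^(2n)`, which are homogeneous of degree `n`. -/
def partialExpansion (c p : ℕ → MvPolynomial (Fin 2) ℝ) (N : ℕ) (h j : ℝ) : ℝ :=
  2 * Real.pi * Real.sign j - Complex.arg ((h : ℂ) + Complex.I * (j : ℂ))
    + 3 / 8 * j * (∑ n ∈ Finset.range N, evalHJ (c n) h j) * Real.log (32 / rho h j)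
    + ∑ n ∈ Finset.Icc 1 N, evalHJ (p n) h j / rho h j ^ (2 * n)

end

end SphericalPendulum

namespace SphericalPendulum

open Filter Asymptotics Topology Finset

/-! ### Asymptotic expansions near the focus-focus value -/

/-! Put `x = 1 - ζ`. As `(h, j) → 0`, two roots of the cubic collide at `x = 0` while the third
stays near `x = 2`. An affine change `x = m(v - p₁)` sends the third root to `v = 1` and the
colliding pair to `v = ±r`, so that `P = 2m³(1 - v)(v² - r²)`, where `r²` is given by convergent
series in `(h, j)` and `r² ∼ ϱ²/16`.

The form `j dζ / ((1 - ζ²) w)` has poles over `ζ = 1` and `ζ = -1`. Since `w² + j² = 2(1 - ζ)(1 +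
ζ)(h + 1 - ζ)`, the function `arctan(w/j)` is singular exactly over `ζ = 1, -1, 1 + h`, and it
vanishes at both ends of the interval of integration. Its differential therefore trades the pole at
`ζ = -1` for those at `ζ = 1` and `ζ = 1 + h`. This yields `2πW = 2 I(p₁) + I(p₂)` for `j > 0`
(`two_pi_mul_rotationNumber`), both poles `p₁ ≈ h/4`, `p₂ ≈ -h/4` now being close to the collision;
negative `j` follows by oddness.

The identity `√(1-p) / ((v-p)√(1-v)) = 1/(v-p) + 1/(√(1-v)(√(1-p) + √(1-v)))` splits each `I(p)`
into an elementary integral, which is the argument of a complex number, and `√(r² - p²)` times an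
integral without pole (`thirdKind_integral`). To leading order the arguments add up to `2(π - Arg) +
Arg = 2π - Arg`; the corrections are arctangents of small quotients with denominator `ϱ²`
(`argShift_eq`). As `√(r² - p²)` is `j` times a power series, the rest is `j` times a combination of
integrals `∫ g(v)/√(v² - r²) dv` over `(r, 1)`. These expand as `∑ r^(2l) (a_l ln(1/r) + b_l)`
(`HasTaylorOn.exists_isLogSum`).

So the logarithm has polynomial coefficients, and powers of `ϱ⁻²` enter only through the arctangents
and through `ln(r²/ϱ²)`. One has `ln(1/r) = ln(32/ϱ) - 3 ln 2 + …`, and the number `32` is the one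
for which the terms `ln 2` cancel against the constants of the integrals. The bookkeeping uses
formal series whose `n`-th coefficient is a function in `polyForms n` or `ratForms n`; both families
are closed under products, and carrying the first coefficients along every operation produces the
explicit `c n` and `p n`. -/

/-- The filter of values `(h, j)` near `(0, 0)` with `j ≠ 0`. -/
def nearZero : Filter (ℝ × ℝ) := nhdsWithin (0 : ℝ × ℝ) {x | x.2 ≠ 0}

/-- The distance `ϱ` as a function of the pair `(h, j)`. -/
noncomputable def rhoFun (x : ℝ × ℝ) : ℝ := rho x.1 x.2

/-- The logarithm `ln (32 / ϱ)` as a function of the pair `(h, j)`. -/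
noncomputable def logFun (x : ℝ × ℝ) : ℝ := Real.log (32 / rho x.1 x.2)

theorem rhoFun_nonneg (x : ℝ × ℝ) : 0 ≤ rhoFun x := Real.sqrt_nonneg _

theorem rhoFun_sq (x : ℝ × ℝ) : rhoFun x ^ 2 = x.1 ^ 2 + x.2 ^ 2 :=
  Real.sq_sqrt (by positivity)

theorem rhoFun_pos {x : ℝ × ℝ} (hx : x.2 ≠ 0) : 0 < rhoFun x :=
  Real.sqrt_pos.2 (by positivity)

theorem abs_fst_le_rhoFun (x : ℝ × ℝ) : |x.1| ≤ rhoFun x :=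
  Real.abs_le_sqrt (by nlinarith [sq_nonneg x.2])

theorem abs_snd_le_rhoFun (x : ℝ × ℝ) : |x.2| ≤ rhoFun x :=
  Real.abs_le_sqrt (by nlinarith [sq_nonneg x.1])

theorem eventually_snd_ne : ∀ᶠ x in nearZero, x.2 ≠ 0 :=
  eventually_mem_nhdsWithin

theorem tendsto_rhoFun : Tendsto rhoFun nearZero (𝓝 0) := by
  have : Continuous rhoFun := by unfold rhoFun rho; fun_prop
  have h := this.tendsto 0
  have h0 : rhoFun 0 = 0 := by simp [rhoFun, rho]
  rw [h0] at h
  exact h.mono_left nhdsWithin_le_nhds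

theorem eventually_rhoFun_lt {ε : ℝ} (hε : 0 < ε) : ∀ᶠ x in nearZero, rhoFun x < ε :=
  tendsto_rhoFun.eventually (gt_mem_nhds hε)

theorem eventually_one_le_logFun : ∀ᶠ x in nearZero, 1 ≤ logFun x := by
  filter_upwards [eventually_snd_ne, eventually_rhoFun_lt one_pos] with x hx h1
  have hp := rhoFun_pos hx
  unfold rhoFun at h1 hp
  unfold logFun
  rw [Real.le_log_iff_exp_le (by positivity), le_div_iff₀ hp]
  nlinarith [Real.exp_one_lt_d9, Real.exp_pos 1]

theorem rhoFun_pow_isBigO {m n : ℕ} (hmn : m ≤ n) :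
    (fun x => rhoFun x ^ n) =O[nearZero] fun x => rhoFun x ^ m := by
  refine IsBigO.of_bound 1 ?_
  filter_upwards [eventually_rhoFun_lt one_pos] with x h1
  have h0 := rhoFun_nonneg x
  rw [Real.norm_of_nonneg (by positivity), Real.norm_of_nonneg (by positivity), one_mul]
  exact pow_le_pow_of_le_one h0 h1.le hmn

theorem logFun_pow_isBigO {m n : ℕ} (hmn : m ≤ n) :
    (fun x => logFun x ^ m) =O[nearZero] fun x => logFun x ^ n := by
  refine IsBigO.of_bound 1 ?_
  filter_upwards [eventually_one_le_logFun] with x h1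
  have h0 : 0 ≤ logFun x := by linarith
  rw [Real.norm_of_nonneg (by positivity), Real.norm_of_nonneg (by positivity), one_mul]
  exact pow_le_pow_right₀ h1 hmn

/-- The real-valued functions on the plane, used as coefficient ring of formal expansions. -/
abbrev PlaneFun := ℝ × ℝ → ℝ

/-- `f` has the asymptotic expansion given by the coefficients of the formal series `a`, the `N`-th
remainder being `O(ϱ^N ln(32/ϱ)^m)`. -/
def IsExp (m : ℕ) (f : PlaneFun) (a : PowerSeries PlaneFun) : Prop :=
  ∀ N : ℕ, (fun x => f x - ∑ n ∈ range N, PowerSeries.coeff n a x)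
    =O[nearZero] fun x => rhoFun x ^ N * logFun x ^ m

namespace IsExp

variable {m m' : ℕ} {f g : PlaneFun} {a b : PowerSeries PlaneFun}

theorem congr (hf : IsExp m f a) (h : f =ᶠ[nearZero] g) : IsExp m g a := fun N =>
  (hf N).congr' (h.mono fun x hx => by simp only [hx]) EventuallyEq.rfl

theorem weaken (hf : IsExp m f a) (h : m ≤ m') : IsExp m' f a := fun N =>
  (hf N).trans ((isBigO_refl _ _).mul (logFun_pow_isBigO h))

theorem isBigO (hf : IsExp m f a) : f =O[nearZero] fun x => logFun x ^ m := by
  simpa using hf 0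

/-- A coefficient is the difference of two consecutive remainders. -/
theorem isBigO_coeff (hf : IsExp m f a) (n : ℕ) :
    (PowerSeries.coeff n a) =O[nearZero] fun x => rhoFun x ^ n * logFun x ^ m := by
  have h := (hf n).sub ((hf (n + 1)).trans
    ((rhoFun_pow_isBigO n.le_succ).mul (isBigO_refl (fun x => logFun x ^ m) _)))
  refine h.congr_left fun x => ?_
  rw [sum_range_succ]; ring

theorem add (hf : IsExp m f a) (hg : IsExp m g b) : IsExp m (f + g) (a + b) := fun N => by
  refine ((hf N).add (hg N)).congr_left fun x => ?_
  simp only [map_add, Pi.add_apply, sum_add_distrib]; ring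

theorem const_mul (c : ℝ) (hf : IsExp m f a) : IsExp m (c • f) (c • a) := fun N => by
  refine ((hf N).const_mul_left c).congr_left fun x => ?_
  simp [mul_sub, mul_sum]

theorem mul (hf : IsExp m f a) (hg : IsExp m' g b) : IsExp (m + m') (f * g) (a * b) := fun N => by
  -- Against the `i`-th coefficient of `a`, the factor `g` is truncated at order `N - i`, so that
  -- every error term has total order `N`.
  have key : ∀ x, (f * g) x - ∑ n ∈ range N, PowerSeries.coeff n (a * b) x
      = ∑ i ∈ range N, PowerSeries.coeff i a x *
          (g x - ∑ k ∈ range (N - i), PowerSeries.coeff k b x)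
        + (f x - ∑ n ∈ range N, PowerSeries.coeff n a x) * g x := by
    intro x
    have h1 : ∑ n ∈ range N, PowerSeries.coeff n (a * b) x
        = ∑ i ∈ range N, ∑ k ∈ range (N - i),
          PowerSeries.coeff i a x * PowerSeries.coeff k b x := by
      simp only [PowerSeries.coeff_mul, Finset.sum_apply, Pi.mul_apply]
      rw [Finset.sum_sigma', Finset.sum_sigma']
      refine Finset.sum_bij' (fun p _ => ⟨p.2.1, p.2.2⟩) (fun p _ => ⟨p.1 + p.2, (p.1, p.2)⟩)
        ?_ ?_ ?_ ?_ ?_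
      · rintro ⟨n, i, k⟩ h
        simp only [mem_sigma, mem_range, HasAntidiagonal.mem_antidiagonal] at h ⊢
        omega
      · rintro ⟨i, k⟩ h
        simp only [mem_sigma, mem_range, HasAntidiagonal.mem_antidiagonal, and_true] at h ⊢
        omega
      · rintro ⟨n, i, k⟩ h
        simp only [mem_sigma, mem_range, HasAntidiagonal.mem_antidiagonal] at h
        obtain ⟨_, rfl⟩ := h
        rfl
      · rintro ⟨i, k⟩ h
        rfl
      · rintro ⟨n, i, k⟩ h
        rfl
    rw [h1]
    simp only [mul_sub, sum_sub_distrib, sub_mul, ← mul_sum, ← sum_mul, Pi.mul_apply]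
    ring
  refine IsBigO.congr_left ?_ fun x => (key x).symm
  refine IsBigO.add (IsBigO.fun_sum fun i hi => ?_) ?_
  · refine ((hf.isBigO_coeff i).mul (hg (N - i))).congr_right fun x => ?_
    have : rhoFun x ^ N = rhoFun x ^ i * rhoFun x ^ (N - i) := by
      rw [← pow_add, Nat.add_sub_cancel' (mem_range.1 hi).le]
    rw [this, pow_add]; ring
  · refine ((hf N).mul hg.isBigO).congr_right fun x => ?_
    rw [pow_add]; ring

/-- A function which is asymptotically a sum of functions `f k`, the expansion of `f k` starting at
order `k`, has the expansion which is the sum of those of the `f k`. -/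
theorem of_sum {F : ℕ → PlaneFun} {A : ℕ → PowerSeries PlaneFun} (hF : ∀ k, IsExp m (F k) (A k))
    (hA : ∀ k n, n < k → PowerSeries.coeff n (A k) = 0)
    (hf : ∀ K, (fun x => f x - ∑ k ∈ range K, F k x)
      =O[nearZero] fun x => rhoFun x ^ K * logFun x ^ m) :
    IsExp m f (PowerSeries.mk fun n => ∑ k ∈ range (n + 1), PowerSeries.coeff n (A k)) := fun N =>
        by
  refine ((hf N).add (IsBigO.fun_sum fun k (_ : k ∈ range N) => hF k N)).congr_left fun x => ?_
  have : ∑ n ∈ range N, (PowerSeries.coeff n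
      (PowerSeries.mk fun n => ∑ k ∈ range (n + 1), PowerSeries.coeff n (A k))) x
      = ∑ k ∈ range N, ∑ n ∈ range N, PowerSeries.coeff n (A k) x := by
    rw [sum_comm]
    refine sum_congr rfl fun n hn => ?_
    rw [PowerSeries.coeff_mk, Finset.sum_apply]
    refine sum_subset (range_subset_range.2 (mem_range.1 hn)) fun k _ hk => ?_
    rw [hA k n (by simpa using hk)]; rfl
  rw [this, sum_sub_distrib]
  ring

theorem one : IsExp 0 1 1 := fun N => by
  rcases N with _ | N
  · simpa using isBigO_refl (fun _ : ℝ × ℝ => (1 : ℝ)) nearZero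
  · refine IsBigO.congr_left (isBigO_zero _ _) fun x => ?_
    rw [sum_eq_single 0]
    · simp
    · intro n _ hn; simp [PowerSeries.coeff_one, hn]
    · simp

theorem pow (hf : IsExp 0 f a) (k : ℕ) : IsExp 0 (f ^ k) (a ^ k) := by
  induction k with
  | zero => simpa using one
  | succ k ih => simpa [pow_succ] using ih.mul hf

theorem isBigO_of_coeff_zero (hf : IsExp m f a) (h : PowerSeries.coeff 0 a = 0) :
    f =O[nearZero] fun x => rhoFun x * logFun x ^ m := by
  simpa [h] using hf 1

theorem monomial {f : PlaneFun} {n : ℕ} (hf : f =O[nearZero] fun x => rhoFun x ^ n) :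
    IsExp 0 f (PowerSeries.monomial n f) := fun N => by
  by_cases hN : n < N
  · refine IsBigO.congr_left (isBigO_zero _ _) fun x => ?_
    rw [sum_eq_single n]
    · simp
    · intro k _ hk; simp [PowerSeries.coeff_monomial, hk]
    · simp [hN]
  · refine (hf.trans (rhoFun_pow_isBigO (not_lt.1 hN))).congr (fun x => ?_) fun x => by simp
    rw [sum_eq_zero, sub_zero]
    intro k hk
    have : k ≠ n := by have := mem_range.1 hk; omega
    simp [PowerSeries.coeff_monomial, this]

end IsExp

theorem coeff_pow_eq_zero {a : PowerSeries PlaneFun} (ha : PowerSeries.coeff 0 a = 0) {k n : ℕ}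
    (h : n < k) : PowerSeries.coeff n (a ^ k) = 0 := by
  have : PowerSeries.X ∣ a := PowerSeries.X_dvd_iff.2 (by simpa using ha)
  obtain ⟨b, rfl⟩ := this
  rw [mul_pow, PowerSeries.coeff_X_pow_mul', if_neg (not_le.2 h)]

end SphericalPendulum

/-! ### Homogeneous polynomial and rational coefficients -/

namespace SphericalPendulum

open Filter Asymptotics Topology Finset

/-- The homogeneous polynomial functions of degree `n` on the plane. -/
def polyForms (n : ℕ) : Submodule ℝ PlaneFun where
  carrier := {f | ∃ q : MvPolynomial (Fin 2) ℝ, q.IsHomogeneous n ∧ ∀ x, f x = evalHJ q x.1 x.2}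
  add_mem' := by
    rintro f g ⟨p, hp, hf⟩ ⟨q, hq, hg⟩
    exact ⟨p + q, hp.add hq, fun x => by simp [hf, hg, evalHJ]⟩
  zero_mem' := ⟨0, MvPolynomial.isHomogeneous_zero _ _ _, fun x => by simp [evalHJ]⟩
  smul_mem' := by
    rintro c f ⟨p, hp, hf⟩
    refine ⟨MvPolynomial.C c * p, ?_, fun x => by simp [hf, evalHJ]⟩
    simpa using (MvPolynomial.isHomogeneous_C (Fin 2) c).mul hp

/-- The functions on the plane which are a homogeneous polynomial of degree `3n` divided by
`ϱ^(2n)`. -/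
def ratForms (n : ℕ) : Submodule ℝ PlaneFun where
  carrier := {f | ∃ q : MvPolynomial (Fin 2) ℝ, q.IsHomogeneous (3 * n) ∧
    ∀ x, f x = evalHJ q x.1 x.2 / rhoFun x ^ (2 * n)}
  add_mem' := by
    rintro f g ⟨p, hp, hf⟩ ⟨q, hq, hg⟩
    exact ⟨p + q, hp.add hq, fun x => by simp [hf, hg, evalHJ, add_div]⟩
  zero_mem' := ⟨0, MvPolynomial.isHomogeneous_zero _ _ _, fun x => by simp [evalHJ]⟩
  smul_mem' := by
    rintro c f ⟨p, hp, hf⟩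
    refine ⟨MvPolynomial.C c * p, ?_, fun x => by simp [hf, evalHJ, mul_div_assoc]⟩
    simpa using (MvPolynomial.isHomogeneous_C (Fin 2) c).mul hp

instance : SetLike.GradedMonoid polyForms where
  one_mem := ⟨1, MvPolynomial.isHomogeneous_one _ _, fun x => by simp [evalHJ]⟩
  mul_mem := by
    rintro m n f g ⟨p, hp, hf⟩ ⟨q, hq, hg⟩
    exact ⟨p * q, hp.mul hq, fun x => by simp [hf, hg, evalHJ]⟩

instance : SetLike.GradedMonoid ratForms where
  one_mem := ⟨1, MvPolynomial.isHomogeneous_one _ _, fun x => by simp [evalHJ]⟩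
  mul_mem := by
    rintro m n f g ⟨p, hp, hf⟩ ⟨q, hq, hg⟩
    refine ⟨p * q, by simpa [mul_add] using hp.mul hq, fun x => ?_⟩
    rw [Pi.mul_apply, hf, hg, div_mul_div_comm, mul_add, pow_add]
    simp [evalHJ]

theorem evalHJ_isBigO {q : MvPolynomial (Fin 2) ℝ} {n : ℕ} (hq : q.IsHomogeneous n) :
    (fun x : ℝ × ℝ => evalHJ q x.1 x.2) =O[nearZero] fun x => rhoFun x ^ n := by
  simp only [evalHJ, MvPolynomial.eval_eq', Fin.prod_univ_two]
  refine IsBigO.fun_sum fun d hd => ?_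
  have hd' : d 0 + d 1 = n := by
    have h := hq (MvPolynomial.mem_support_iff.1 hd)
    simpa [Finsupp.weight_apply, Finsupp.sum_fintype] using h
  refine IsBigO.const_mul_left (IsBigO.of_bound 1 (Eventually.of_forall fun x => ?_)) _
  have h0 := rhoFun_nonneg x
  rw [Real.norm_of_nonneg (by positivity : 0 ≤ rhoFun x ^ n), one_mul, ← hd', pow_add, norm_mul,
    norm_pow, norm_pow]
  exact mul_le_mul (pow_le_pow_left₀ (norm_nonneg _) (abs_fst_le_rhoFun x) _)
    (pow_le_pow_left₀ (norm_nonneg _) (abs_snd_le_rhoFun x) _) (by positivity) (by positivity)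

theorem isBigO_of_mem_polyForms {f : PlaneFun} {n : ℕ} (hf : f ∈ polyForms n) :
    f =O[nearZero] fun x => rhoFun x ^ n := by
  obtain ⟨q, hq, h⟩ := hf
  exact (evalHJ_isBigO hq).congr_left fun x => (h x).symm

theorem evalHJ_zero_of_pos {q : MvPolynomial (Fin 2) ℝ} {n : ℕ} (hq : q.IsHomogeneous n)
    (hn : n ≠ 0) : evalHJ q 0 0 = 0 := by
  have h : (![0, 0] : Fin 2 → ℝ) = 0 := by ext i; fin_cases i <;> rfl
  rw [evalHJ, h, MvPolynomial.eval_zero]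
  by_contra h0
  have := hq h0
  simp at this
  omega

theorem rhoFun_eq_zero {x : ℝ × ℝ} : rhoFun x = 0 ↔ x = 0 := by
  refine ⟨fun h => ?_, fun h => by simp [h, rhoFun, rho]⟩
  have h2 := rhoFun_sq x
  rw [h] at h2
  ext
  · simp; nlinarith [sq_nonneg x.1, sq_nonneg x.2]
  · simp; nlinarith [sq_nonneg x.1, sq_nonneg x.2]

/-- The polynomial `ϱ² = h² + j²`. -/
noncomputable def rhoSqPoly : MvPolynomial (Fin 2) ℝ :=
  MvPolynomial.X 0 ^ 2 + MvPolynomial.X 1 ^ 2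

theorem rhoSqPoly_isHomogeneous : rhoSqPoly.IsHomogeneous 2 :=
  ((MvPolynomial.isHomogeneous_X _ _).pow 2).add ((MvPolynomial.isHomogeneous_X _ _).pow 2)

theorem evalHJ_rhoSqPoly (x : ℝ × ℝ) : evalHJ rhoSqPoly x.1 x.2 = rhoFun x ^ 2 := by
  simp [rhoFun_sq, evalHJ, rhoSqPoly]

theorem polyForms_le_ratForms (n : ℕ) : polyForms n ≤ ratForms n := by
  rintro f ⟨q, hq, hf⟩
  refine ⟨q * rhoSqPoly ^ n, ?_, fun x => ?_⟩
  · have := hq.mul (rhoSqPoly_isHomogeneous.pow n)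
    convert this using 1; ring
  · have h : evalHJ (q * rhoSqPoly ^ n) x.1 x.2 = evalHJ q x.1 x.2 * rhoFun x ^ (2 * n) := by
      rw [pow_mul, ← evalHJ_rhoSqPoly]; simp [evalHJ]
    rw [h, hf]
    -- Membership is a pointwise identity, the origin included, where division by zero gives `0`; a
    -- form of positive degree vanishes there as well.
    rcases eq_or_ne n 0 with rfl | hn
    · simp
    rcases eq_or_ne (rhoFun x) 0 with h0 | h0
    · rw [rhoFun_eq_zero] at h0
      subst h0
      simp [evalHJ_zero_of_pos hq hn]
    · field_simp

/-- A form of degree `n + 1` may be written with denominator `ϱ^(2n)`, which leaves exactly one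
factor `ϱ²` free for the denominator. In degree `0` there is no such room, hence the shift. -/
theorem div_rhoFun_sq_mul_mem {q f : PlaneFun} {n : ℕ} (hq : q ∈ polyForms 2)
    (hf : f ∈ polyForms (n + 1)) : (fun x => q x / rhoFun x ^ 2 * f x) ∈ ratForms (n + 1) := by
  obtain ⟨p, hp, hq⟩ := hq
  obtain ⟨r, hr, hf⟩ := hf
  refine ⟨p * r * rhoSqPoly ^ n, ?_, fun x => ?_⟩
  · have := (hp.mul hr).mul (rhoSqPoly_isHomogeneous.pow n)
    convert this using 1; ring
  · have h : evalHJ (p * r * rhoSqPoly ^ n) x.1 x.2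
        = evalHJ p x.1 x.2 * evalHJ r x.1 x.2 * rhoFun x ^ (2 * n) := by
      rw [pow_mul, ← evalHJ_rhoSqPoly]; simp [evalHJ]
    simp only [h, hf, hq]
    rcases eq_or_ne (rhoFun x) 0 with h0 | h0
    · simp [h0]
    · field_simp
      ring

/-- `f` has an asymptotic expansion to all orders whose term of order `n` lies in `S n`, the first
three terms being `f₀`, `f₁` and `f₂`. -/
def HasExp (S : ℕ → Submodule ℝ PlaneFun) (f f₀ f₁ f₂ : PlaneFun) : Prop :=
  ∃ a : PowerSeries PlaneFun, (∀ n, PowerSeries.coeff n a ∈ S n) ∧ PowerSeries.coeff 0 a = f₀ ∧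
    PowerSeries.coeff 1 a = f₁ ∧ PowerSeries.coeff 2 a = f₂ ∧ IsExp 0 f a

/-- `f` is `O(y^N)`-approximated by the partial sums of the power series with coefficients `c`. -/
def HasTaylor (φ : ℝ → ℝ) (c : ℕ → ℝ) : Prop :=
  ∀ N : ℕ, (fun y => φ y - ∑ k ∈ range N, c k * y ^ k) =O[𝓝 0] fun y => y ^ N

/-! ### Algebra of expansions with graded coefficients -/

section Graded

variable {S : ℕ → Submodule ℝ PlaneFun}

theorem coeff_mul_mem [SetLike.GradedMonoid S] {a b : PowerSeries PlaneFun} (ha : ∀ n,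
    PowerSeries.coeff n a ∈ S n)
    (hb : ∀ n, PowerSeries.coeff n b ∈ S n) (n : ℕ) : PowerSeries.coeff n (a * b) ∈ S n := by
  rw [PowerSeries.coeff_mul]
  refine Submodule.sum_mem _ fun p hp => ?_
  rw [← HasAntidiagonal.mem_antidiagonal.1 hp]
  exact SetLike.GradedMul.mul_mem (ha _) (hb _)

theorem coeff_one_mem [SetLike.GradedMonoid S] (n : ℕ) : PowerSeries.coeff n (1 : PowerSeries
    PlaneFun) ∈ S n := by
  rw [PowerSeries.coeff_one]
  split_ifs with h
  · rw [h]; exact SetLike.GradedOne.one_mem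
  · exact Submodule.zero_mem _

theorem coeff_pow_mem [SetLike.GradedMonoid S] {a : PowerSeries PlaneFun} (ha : ∀ n,
    PowerSeries.coeff n a ∈ S n)
    (k n : ℕ) : PowerSeries.coeff n (a ^ k) ∈ S n := by
  induction k generalizing n with
  | zero => simpa using coeff_one_mem n
  | succ k ih => rw [pow_succ]; exact coeff_mul_mem ih ha n

theorem coeff_zero_mul' (a b : PowerSeries PlaneFun) : PowerSeries.coeff 0 (a * b)
    = PowerSeries.coeff 0 a * PowerSeries.coeff 0 b := by
  simp [PowerSeries.coeff_mul]

theorem coeff_one_mul' (a b : PowerSeries PlaneFun) : PowerSeries.coeff 1 (a * b)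
    = PowerSeries.coeff 0 a * PowerSeries.coeff 1 b
      + PowerSeries.coeff 1 a * PowerSeries.coeff 0 b := by
  rw [PowerSeries.coeff_mul, Finset.Nat.sum_antidiagonal_eq_sum_range_succ_mk]
  simp [sum_range_succ]

theorem coeff_two_mul' (a b : PowerSeries PlaneFun) : PowerSeries.coeff 2 (a * b)
    = PowerSeries.coeff 0 a * PowerSeries.coeff 2 b
      + PowerSeries.coeff 1 a * PowerSeries.coeff 1 b
      + PowerSeries.coeff 2 a * PowerSeries.coeff 0 b := by
  rw [PowerSeries.coeff_mul, Finset.Nat.sum_antidiagonal_eq_sum_range_succ_mk]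
  simp [sum_range_succ]

namespace HasExp

variable {f f₀ f₁ f₂ g g₀ g₁ g₂ : PlaneFun}

theorem congr {f' f₀' f₁' f₂' : PlaneFun} (h : HasExp S f f₀ f₁ f₂) (hf : f =ᶠ[nearZero] f')
    (h₀ : ∀ x, f₀ x = f₀' x) (h₁ : ∀ x, f₁ x = f₁' x) (h₂ : ∀ x, f₂ x = f₂' x) :
    HasExp S f' f₀' f₁' f₂' := by
  obtain rfl : f₀ = f₀' := funext h₀
  obtain rfl : f₁ = f₁' := funext h₁
  obtain rfl : f₂ = f₂' := funext h₂
  obtain ⟨a, ha, h0, h1, h2, h⟩ := h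
  exact ⟨a, ha, h0, h1, h2, h.congr hf⟩

theorem congr_coeff {f₀' f₁' f₂' : PlaneFun} (h : HasExp S f f₀ f₁ f₂)
    (h₀ : ∀ x, f₀ x = f₀' x) (h₁ : ∀ x, f₁ x = f₁' x) (h₂ : ∀ x, f₂ x = f₂' x) :
    HasExp S f f₀' f₁' f₂' := h.congr EventuallyEq.rfl h₀ h₁ h₂

theorem isBigO_rho (h : HasExp S f (fun _ => 0) f₁ f₂) : f =O[nearZero] rhoFun := by
  obtain ⟨a, -, h0, -, -, h⟩ := h
  simpa using h.isBigO_of_coeff_zero h0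

theorem isBigO_rho_sq (h : HasExp S f (fun _ => 0) (fun _ => 0) f₂) :
    f =O[nearZero] fun x => rhoFun x ^ 2 := by
  obtain ⟨a, -, h0, h1, -, h⟩ := h
  simpa [sum_range_succ, -PowerSeries.coeff_zero_eq_constantCoeff, h0, h1] using h 2

theorem tendsto {c : ℝ} (h : HasExp S f (fun _ => c) f₁ f₂) : Tendsto f nearZero (𝓝 c) := by
  obtain ⟨a, -, h0, -, -, h⟩ := h
  have h1 : (fun x => f x - c) =O[nearZero] rhoFun := by
    simpa [-PowerSeries.coeff_zero_eq_constantCoeff, h0] using h 1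
  simpa using (h1.trans_tendsto tendsto_rhoFun).add_const c

theorem add (hf : HasExp S f f₀ f₁ f₂) (hg : HasExp S g g₀ g₁ g₂) :
    HasExp S (fun x => f x + g x) (fun x => f₀ x + g₀ x) (fun x => f₁ x + g₁ x)
      (fun x => f₂ x + g₂ x) := by
  obtain ⟨a, ha, rfl, rfl, rfl, hf⟩ := hf
  obtain ⟨b, hb, rfl, rfl, rfl, hg⟩ := hg
  refine ⟨a + b, fun n => ?_, ?_, ?_, ?_, hf.add hg⟩
  · rw [map_add]; exact Submodule.add_mem _ (ha n) (hb n)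
  all_goals rw [map_add]; rfl

theorem const_mul (c : ℝ) (hf : HasExp S f f₀ f₁ f₂) :
    HasExp S (fun x => c * f x) (fun x => c * f₀ x) (fun x => c * f₁ x) (fun x => c * f₂ x) := by
  obtain ⟨a, ha, rfl, rfl, rfl, hf⟩ := hf
  refine ⟨c • a, fun n => ?_, ?_, ?_, ?_, hf.const_mul c⟩
  · exact Submodule.smul_mem _ c (ha n)
  all_goals rfl

theorem sub (hf : HasExp S f f₀ f₁ f₂) (hg : HasExp S g g₀ g₁ g₂) :
    HasExp S (fun x => f x - g x) (fun x => f₀ x - g₀ x) (fun x => f₁ x - g₁ x)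
      (fun x => f₂ x - g₂ x) :=
  (hf.add (hg.const_mul (-1))).congr (Eventually.of_forall fun x => by ring) (fun x => by ring)
    (fun x => by ring) (fun x => by ring)

theorem mul [SetLike.GradedMonoid S] (hf : HasExp S f f₀ f₁ f₂) (hg : HasExp S g g₀ g₁ g₂) :
    HasExp S (fun x => f x * g x) (fun x => f₀ x * g₀ x) (fun x => f₀ x * g₁ x + f₁ x * g₀ x)
      (fun x => f₀ x * g₂ x + f₁ x * g₁ x + f₂ x * g₀ x) := by
  obtain ⟨a, ha, rfl, rfl, rfl, hf⟩ := hf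
  obtain ⟨b, hb, rfl, rfl, rfl, hg⟩ := hg
  refine ⟨a * b, coeff_mul_mem ha hb, ?_, ?_, ?_, hf.mul hg⟩
  · rw [coeff_zero_mul']; rfl
  · rw [coeff_one_mul']; rfl
  · rw [coeff_two_mul']; rfl

theorem const [SetLike.GradedMonoid S] (c : ℝ) : HasExp S (fun _ => c) (fun _ => c) (fun _ => 0)
    (fun _ => 0) := by
  have : HasExp S 1 1 0 0 :=
    ⟨1, coeff_one_mem, by simp, by simp [PowerSeries.coeff_one], by simp [PowerSeries.coeff_one],
      IsExp.one⟩
  exact (this.const_mul c).congr (Eventually.of_forall fun x => by simp) (fun x => by simp)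
    (fun x => by simp) (fun x => by simp)

/-- Composition of an expansion without constant term with a function of one variable. -/
theorem comp [SetLike.GradedMonoid S] {φ : ℝ → ℝ} {c : ℕ → ℝ} (hφ : HasTaylor φ c) (hf : HasExp S
    f (fun _ => 0) f₁ f₂) :
    HasExp S (fun x => φ (f x)) (fun _ => c 0) (fun x => c 1 * f₁ x)
      (fun x => c 1 * f₂ x + c 2 * f₁ x ^ 2) := by
  have hρ := hf.isBigO_rho
  have ht := hf.tendsto
  obtain ⟨a, ha, h0, h1, h2, hf⟩ := hf
  -- Since `f = O(ϱ)`, the Taylor remainder of `φ` at order `K` becomes `O(ϱ^K)`, and `f ^ k`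
  -- contributes only from order `k` on.
  have hs : IsExp 0 (fun x => φ (f x)) _ :=
    IsExp.of_sum (F := fun k => c k • f ^ k) (A := fun k => c k • a ^ k)
    (fun k => (hf.pow k).const_mul _)
    (fun k n hn => by
      have := coeff_pow_eq_zero (a := a) h0 hn
      rw [PowerSeries.coeff_smul, this, smul_zero])
    (fun K => by
      refine (((hφ K).comp_tendsto ht).trans (hρ.pow K)).congr (fun x => ?_) fun x => by simp
      simp)
  refine ⟨_, fun n => ?_, ?_, ?_, ?_, hs⟩
  · rw [PowerSeries.coeff_mk]
    exact Submodule.sum_mem _ fun k _ => Submodule.smul_mem _ _ (coeff_pow_mem ha k n)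
  · rw [PowerSeries.coeff_mk]; funext x; simp
  · rw [PowerSeries.coeff_mk]; funext x
    simp [sum_range_succ, h1, PowerSeries.coeff_one]
  · rw [PowerSeries.coeff_mk]; funext x
    simp [sum_range_succ, h1, h2, PowerSeries.coeff_one, pow_two a, coeff_two_mul',
      -PowerSeries.coeff_zero_eq_constantCoeff, h0]
    ring_nf
    simp

theorem mono {S' : ℕ → Submodule ℝ PlaneFun} (h : HasExp S f f₀ f₁ f₂) (hS : ∀ n, S n ≤ S' n) :
    HasExp S' f f₀ f₁ f₂ := by
  obtain ⟨a, ha, h⟩ := h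
  exact ⟨a, fun n => hS n (ha n), h⟩

end HasExp

end Graded

end SphericalPendulum

/-! ### Taylor expansions of the elementary functions -/

namespace SphericalPendulum

open Filter Asymptotics Topology Finset

theorem hasDerivAt_congr {f g : ℝ → ℝ} {f' g' x : ℝ} (h : HasDerivAt f f' x) (hf : ∀ y, f y = g y)
    (hf' : f' = g') : HasDerivAt g g' x := by
  obtain rfl : f = g := funext hf
  exact hf' ▸ h

theorem hasTaylor_of_analyticAt {φ φ' : ℝ → ℝ} {d : ℝ} (h : AnalyticAt ℝ φ 0)
    (h₁ : ∀ᶠ y in 𝓝 0, HasDerivAt φ (φ' y) y) (h₂ : HasDerivAt φ' d 0) :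
    ∃ c, HasTaylor φ c ∧ c 0 = φ 0 ∧ c 1 = φ' 0 ∧ c 2 = d / 2 := by
  refine ⟨fun n => iteratedDeriv n φ 0 / n.factorial, fun N => ?_, by simp, ?_, ?_⟩
  · have := h.hasFPowerSeriesAt.isBigO_sub_partialSum_pow N
    simp only [zero_add] at this
    refine (this.congr_left fun y => ?_).trans (IsBigO.of_bound 1 (by simp))
    simp [FormalMultilinearSeries.partialSum, FormalMultilinearSeries.ofScalars]
  · simp [h₁.self_of_nhds.deriv]
  · have : deriv φ =ᶠ[𝓝 0] φ' := h₁.mono fun y hy => hy.deriv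
    simp [iteratedDeriv_succ, this.deriv_eq, h₂.deriv]

theorem hasTaylor_inv_one_add : ∃ c, HasTaylor (fun y => (1 + y)⁻¹) c ∧ c 0 = 1 ∧ c 1 = -1 ∧
    c 2 = 1 := by
  have h := hasTaylor_of_analyticAt (φ := fun y => (1 + y)⁻¹) (φ' := fun y => -1 / (1 + y) ^ 2)
    (d := 2) (by fun_prop (disch := norm_num)) ?_ ?_
  · simpa using h
  · filter_upwards [lt_mem_nhds (show (-1 : ℝ) < 0 by norm_num)] with y hy
    exact ((hasDerivAt_id y).const_add 1).inv (by simp; linarith)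
  · have := (((hasDerivAt_id (0 : ℝ)).const_add 1).pow 2).inv (by simp)
    exact hasDerivAt_congr (this.const_mul (-1)) (fun y => by simp [neg_div]) (by norm_num)

theorem hasTaylor_sqrt_one_add : ∃ c, HasTaylor (fun y => √(1 + y)) c ∧ c 0 = 1 ∧ c 1 = 1 / 2 ∧
    c 2 = -1 / 8 := by
  have h := hasTaylor_of_analyticAt (φ := fun y => √(1 + y)) (φ' := fun y => 1 / (2 * √(1 + y)))
    (d := -1 / 4) ?_ ?_ ?_
  · obtain ⟨c, h, h0, h1, h2⟩ := h
    exact ⟨c, h, by simpa using h0, by simpa using h1, by rw [h2]; norm_num⟩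
  · have h1 : ContDiffAt ℝ ⊤ (fun y : ℝ => √(1 + y)) 0 :=
      (Real.contDiffAt_sqrt (x := 1 + 0) (by simp)).comp (0 : ℝ) (by fun_prop)
    exact h1.analyticAt
  · filter_upwards [lt_mem_nhds (show (-1 : ℝ) < 0 by norm_num)] with y hy
    exact ((hasDerivAt_id y).const_add 1).sqrt (by simp; linarith)
  · have := ((((hasDerivAt_id (0 : ℝ)).const_add 1).sqrt (by simp)).const_mul 2).inv (by simp)
    exact hasDerivAt_congr this (fun y => by simp) (by norm_num)

theorem hasTaylor_log_one_add : ∃ c, HasTaylor (fun y => Real.log (1 + y)) c ∧ c 0 = 0 ∧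
    c 1 = 1 ∧ c 2 = -1 / 2 := by
  have h := hasTaylor_of_analyticAt (φ := fun y => Real.log (1 + y)) (φ' := fun y => 1 / (1 + y))
    (d := -1) ?_ ?_ ?_
  · simpa using h
  · exact (by fun_prop : AnalyticAt ℝ (fun y : ℝ => 1 + y) 0).log (by simp)
  · filter_upwards [lt_mem_nhds (show (-1 : ℝ) < 0 by norm_num)] with y hy
    exact ((hasDerivAt_id y).const_add 1).log (by simp; linarith)
  · have := ((hasDerivAt_id (0 : ℝ)).const_add 1).inv (by simp)
    exact hasDerivAt_congr this (fun y => by simp) (by norm_num)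

theorem hasTaylor_arctan : ∃ c, HasTaylor Real.arctan c ∧ c 0 = 0 ∧ c 1 = 1 ∧ c 2 = 0 := by
  have h := hasTaylor_of_analyticAt (φ := Real.arctan) (φ' := fun y => 1 / (1 + y ^ 2))
    (d := 0) ?_ ?_ ?_
  · simpa using h
  · exact Real.contDiff_arctan.contDiffAt.analyticAt
  · exact Eventually.of_forall fun y => Real.hasDerivAt_arctan y
  · have := (((hasDerivAt_id (0 : ℝ)).pow 2).const_add 1).inv (by simp)
    exact hasDerivAt_congr this (fun y => by simp) (by norm_num)

namespace HasExp

variable {S : ℕ → Submodule ℝ PlaneFun} {f f₀ f₁ f₂ : PlaneFun}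

theorem inv_one_add [SetLike.GradedMonoid S] (hf : HasExp S f (fun _ => 0) f₁ f₂) :
    HasExp S (fun x => (1 + f x)⁻¹) (fun _ => 1) (fun x => -f₁ x) (fun x => f₁ x ^ 2 - f₂ x) := by
  obtain ⟨c, hc, h0, h1, h2⟩ := hasTaylor_inv_one_add
  exact (hf.comp hc).congr_coeff (fun x => h0) (fun x => by rw [h1]; ring)
    (fun x => by rw [h1, h2]; ring)

theorem sqrt_one_add [SetLike.GradedMonoid S] (hf : HasExp S f (fun _ => 0) f₁ f₂) :
    HasExp S (fun x => √(1 + f x)) (fun _ => 1) (fun x => f₁ x / 2)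
      (fun x => f₂ x / 2 - f₁ x ^ 2 / 8) := by
  obtain ⟨c, hc, h0, h1, h2⟩ := hasTaylor_sqrt_one_add
  exact (hf.comp hc).congr_coeff (fun x => h0) (fun x => by rw [h1]; ring)
    (fun x => by rw [h1, h2]; ring)

theorem log_one_add [SetLike.GradedMonoid S] (hf : HasExp S f (fun _ => 0) f₁ f₂) :
    HasExp S (fun x => Real.log (1 + f x)) (fun _ => 0) f₁ (fun x => f₂ x - f₁ x ^ 2 / 2) := by
  obtain ⟨c, hc, h0, h1, h2⟩ := hasTaylor_log_one_add
  exact (hf.comp hc).congr_coeff (fun x => h0) (fun x => by rw [h1]; ring)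
    (fun x => by rw [h1, h2]; ring)

theorem arctan [SetLike.GradedMonoid S] (hf : HasExp S f (fun _ => 0) f₁ f₂) :
    HasExp S (fun x => Real.arctan (f x)) (fun _ => 0) f₁ f₂ := by
  obtain ⟨c, hc, h0, h1, h2⟩ := hasTaylor_arctan
  exact (hf.comp hc).congr_coeff (fun x => h0) (fun x => by rw [h1]; ring)
    (fun x => by rw [h1, h2]; ring)

theorem fst : HasExp polyForms (fun x => x.1) (fun _ => 0) (fun x => x.1) (fun _ => 0) := by
  have hm : (fun x : ℝ × ℝ => x.1) ∈ polyForms 1 :=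
    ⟨MvPolynomial.X 0, MvPolynomial.isHomogeneous_X _ _, fun x => by simp [evalHJ]⟩
  refine ⟨_, fun n => ?_, ?_, ?_, ?_, IsExp.monomial (isBigO_of_mem_polyForms hm)⟩
  · rw [PowerSeries.coeff_monomial]
    split_ifs with h
    · rw [h]; exact hm
    · exact Submodule.zero_mem _
  all_goals simp [PowerSeries.coeff_monomial, -PowerSeries.coeff_zero_eq_constantCoeff]
  all_goals rfl

theorem snd : HasExp polyForms (fun x => x.2) (fun _ => 0) (fun x => x.2) (fun _ => 0) := by
  have hm : (fun x : ℝ × ℝ => x.2) ∈ polyForms 1 :=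
    ⟨MvPolynomial.X 1, MvPolynomial.isHomogeneous_X _ _, fun x => by simp [evalHJ]⟩
  refine ⟨_, fun n => ?_, ?_, ?_, ?_, IsExp.monomial (isBigO_of_mem_polyForms hm)⟩
  · rw [PowerSeries.coeff_monomial]
    split_ifs with h
    · rw [h]; exact hm
    · exact Submodule.zero_mem _
  all_goals simp [PowerSeries.coeff_monomial, -PowerSeries.coeff_zero_eq_constantCoeff]
  all_goals rfl

theorem toRat (h : HasExp polyForms f f₀ f₁ f₂) : HasExp ratForms f f₀ f₁ f₂ :=
  h.mono polyForms_le_ratForms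

/-- Multiplication of a series of polynomials without constant term by a quadratic form divided by
`ϱ²`. -/
theorem div_rhoFun_sq_mul {q : PlaneFun} (hq : q ∈ polyForms 2)
    (hf : HasExp polyForms f (fun _ => 0) f₁ f₂) :
    HasExp ratForms (fun x => q x / rhoFun x ^ 2 * f x) (fun _ => 0)
      (fun x => q x / rhoFun x ^ 2 * f₁ x) (fun x => q x / rhoFun x ^ 2 * f₂ x) := by
  obtain ⟨a, ha, h0, h1, h2, h⟩ := hf
  set u : PlaneFun := fun x => q x / rhoFun x ^ 2 with hu
  have hub : u =O[nearZero] fun _ => (1 : ℝ) := by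
    have h3 := (isBigO_of_mem_polyForms hq).mul
      (isBigO_refl (fun x => (rhoFun x ^ 2)⁻¹) nearZero)
    refine (h3.congr_left fun x => (div_eq_mul_inv _ _).symm).trans ?_
    refine IsBigO.of_bound 1 ?_
    filter_upwards [eventually_snd_ne] with x hx
    have := (rhoFun_pos hx).ne'
    rw [mul_inv_cancel₀ (by positivity)]
    simp
  have hc : ∀ n, PowerSeries.coeff n (PowerSeries.C u * a) = fun x => u x * PowerSeries.coeff n a
      x :=
    fun n => by rw [PowerSeries.coeff_C_mul]; rfl
  refine ⟨PowerSeries.C u * a, fun n => ?_, ?_, ?_, ?_, fun N => ?_⟩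
  · rw [hc]
    rcases n with _ | n
    · rw [h0]
      simp only [mul_zero]
      exact Submodule.zero_mem _
    · exact div_rhoFun_sq_mul_mem hq (ha _)
  · rw [hc, h0]; simp
  · rw [hc, h1]
  · rw [hc, h2]
  · refine (hub.mul (h N)).congr (fun x => ?_) fun x => by simp
    simp only [hc, mul_sub, mul_sum]
    rfl

end HasExp

/-! ### Expansions with a logarithm -/

/-- `f` has an asymptotic expansion `f ∼ A ln(32/ϱ) + B` to all orders, `A` a series of homogeneous
polynomials and `B` one of homogeneous rational functions; `a₀, a₁, a₂` and `b₀, b₁` are their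
first terms. -/
def HasLogExp (f a₀ a₁ a₂ b₀ b₁ : PlaneFun) : Prop :=
  ∃ A B : PowerSeries PlaneFun, (∀ n, PowerSeries.coeff n A ∈ polyForms n) ∧
    (∀ n, PowerSeries.coeff n B ∈ ratForms n) ∧
    PowerSeries.coeff 0 A = a₀ ∧ PowerSeries.coeff 1 A = a₁ ∧ PowerSeries.coeff 2 A = a₂ ∧
    PowerSeries.coeff 0 B = b₀ ∧ PowerSeries.coeff 1 B = b₁ ∧
    IsExp 1 f (A * PowerSeries.C logFun + B)

theorem HasExp.toLog {f f₀ f₁ f₂ : PlaneFun} (h : HasExp ratForms f f₀ f₁ f₂) :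
    HasLogExp f (fun _ => 0) (fun _ => 0) (fun _ => 0) f₀ f₁ := by
  obtain ⟨b, hb, h0, h1, h2, h⟩ := h
  refine ⟨0, b, fun n => by simp, hb, by simp; rfl, by simp; rfl, by simp; rfl, h0, h1, ?_⟩
  simpa using h.weaken zero_le_one

namespace HasLogExp

variable {f a₀ a₁ a₂ b₀ b₁ g a₀' a₁' a₂' b₀' b₁' : PlaneFun}

theorem congr {f' : PlaneFun} (h : HasLogExp f a₀ a₁ a₂ b₀ b₁) (hf : f =ᶠ[nearZero] f')
    (h₀ : ∀ x, a₀ x = a₀' x) (h₁ : ∀ x, a₁ x = a₁' x) (h₂ : ∀ x, a₂ x = a₂' x)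
    (h₃ : ∀ x, b₀ x = b₀' x) (h₄ : ∀ x, b₁ x = b₁' x) : HasLogExp f' a₀' a₁' a₂' b₀' b₁' := by
  obtain rfl : a₀ = a₀' := funext h₀
  obtain rfl : a₁ = a₁' := funext h₁
  obtain rfl : a₂ = a₂' := funext h₂
  obtain rfl : b₀ = b₀' := funext h₃
  obtain rfl : b₁ = b₁' := funext h₄
  obtain ⟨A, B, hA, hB, k0, k1, k2, k3, k4, h⟩ := h
  exact ⟨A, B, hA, hB, k0, k1, k2, k3, k4, h.congr hf⟩

theorem congr_coeff (h : HasLogExp f a₀ a₁ a₂ b₀ b₁)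
    (h₀ : ∀ x, a₀ x = a₀' x) (h₁ : ∀ x, a₁ x = a₁' x) (h₂ : ∀ x, a₂ x = a₂' x)
    (h₃ : ∀ x, b₀ x = b₀' x) (h₄ : ∀ x, b₁ x = b₁' x) : HasLogExp f a₀' a₁' a₂' b₀' b₁' :=
  h.congr EventuallyEq.rfl h₀ h₁ h₂ h₃ h₄

theorem isBigO (h : HasLogExp f a₀ a₁ a₂ b₀ b₁) : f =O[nearZero] logFun := by
  obtain ⟨A, B, -, -, -, -, -, -, -, h⟩ := h
  simpa using h.isBigO

theorem log : HasLogExp logFun (fun _ => 1) (fun _ => 0) (fun _ => 0) (fun _ => 0)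
    (fun _ => 0) := by
  refine ⟨1, 0, coeff_one_mem, fun n => by simp, by simp; rfl,
    by simp [PowerSeries.coeff_one]; rfl, by simp [PowerSeries.coeff_one]; rfl, by simp; rfl,
    by simp; rfl, fun N => ?_⟩
  rcases N with _ | N
  · simpa using isBigO_refl logFun nearZero
  · refine IsBigO.congr_left (isBigO_zero _ _) fun x => ?_
    rw [sum_eq_single 0]
    · simp
    · intro n _ hn; simp [PowerSeries.coeff_C, hn]
    · simp

theorem add (hf : HasLogExp f a₀ a₁ a₂ b₀ b₁) (hg : HasLogExp g a₀' a₁' a₂' b₀' b₁') :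
    HasLogExp (fun x => f x + g x) (fun x => a₀ x + a₀' x) (fun x => a₁ x + a₁' x)
      (fun x => a₂ x + a₂' x) (fun x => b₀ x + b₀' x) (fun x => b₁ x + b₁' x) := by
  obtain ⟨A, B, hA, hB, rfl, rfl, rfl, rfl, rfl, hf⟩ := hf
  obtain ⟨A', B', hA', hB', rfl, rfl, rfl, rfl, rfl, hg⟩ := hg
  refine ⟨A + A', B + B', fun n => ?_, fun n => ?_, ?_, ?_, ?_, ?_, ?_, ?_⟩
  · rw [map_add]; exact Submodule.add_mem _ (hA n) (hA' n)
  · rw [map_add]; exact Submodule.add_mem _ (hB n) (hB' n)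
  iterate 5 rw [map_add]; rfl
  have := hf.add hg
  rwa [show A * PowerSeries.C logFun + B + (A' * PowerSeries.C logFun + B')
    = (A + A') * PowerSeries.C logFun + (B + B') by ring] at this

theorem mul {y y₀ y₁ y₂ : PlaneFun} (hy : HasExp polyForms y y₀ y₁ y₂)
    (hf : HasLogExp f a₀ a₁ a₂ b₀ b₁) :
    HasLogExp (fun x => y x * f x) (fun x => y₀ x * a₀ x) (fun x => y₀ x * a₁ x + y₁ x * a₀ x)
      (fun x => y₀ x * a₂ x + y₁ x * a₁ x + y₂ x * a₀ x) (fun x => y₀ x * b₀ x)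
      (fun x => y₀ x * b₁ x + y₁ x * b₀ x) := by
  obtain ⟨Y, hY, rfl, rfl, rfl, hy⟩ := hy
  obtain ⟨A, B, hA, hB, rfl, rfl, rfl, rfl, rfl, hf⟩ := hf
  refine ⟨Y * A, Y * B, coeff_mul_mem hY hA,
    coeff_mul_mem (fun n => polyForms_le_ratForms n (hY n)) hB, ?_, ?_, ?_, ?_, ?_, ?_⟩
  · rw [coeff_zero_mul']; rfl
  · rw [coeff_one_mul']; rfl
  · rw [coeff_two_mul']; rfl
  · rw [coeff_zero_mul']; rfl
  · rw [coeff_one_mul']; rfl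
  · have := hy.mul hf
    rwa [show Y * (A * PowerSeries.C logFun + B) = Y * A * PowerSeries.C logFun + Y * B by ring,
      zero_add] at this

theorem const_mul (c : ℝ) (hf : HasLogExp f a₀ a₁ a₂ b₀ b₁) :
    HasLogExp (fun x => c * f x) (fun x => c * a₀ x) (fun x => c * a₁ x) (fun x => c * a₂ x)
      (fun x => c * b₀ x) (fun x => c * b₁ x) :=
  (mul (HasExp.const c) hf).congr_coeff (fun x => rfl) (fun x => by ring) (fun x => by ring)
    (fun x => rfl) (fun x => by ring)

/-- A power series in `y`, a function without constant term, whose coefficients are functions with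
logarithmic expansions. -/
theorem of_sum {y y₁ y₂ : PlaneFun} (hy : HasExp polyForms y (fun _ => 0) y₁ y₂)
    {F a₀ a₁ a₂ b₀ b₁ : ℕ → PlaneFun}
    (hF : ∀ k, HasLogExp (F k) (a₀ k) (a₁ k) (a₂ k) (b₀ k) (b₁ k))
    (hf : ∀ K, (fun x => f x - ∑ k ∈ range K, y x ^ k * F k x)
      =O[nearZero] fun x => rhoFun x ^ K * logFun x) :
    HasLogExp f (a₀ 0) (fun x => a₁ 0 x + y₁ x * a₀ 1 x)
      (fun x => a₂ 0 x + y₁ x * a₁ 1 x + y₂ x * a₀ 1 x + y₁ x ^ 2 * a₀ 2 x) (b₀ 0)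
      (fun x => b₁ 0 x + y₁ x * b₀ 1 x) := by
  choose A B hA hB h0 h1 h2 h3 h4 hF using hF
  obtain ⟨Y, hY, k0, k1, k2, hy⟩ := hy
  have hY' : ∀ n, PowerSeries.coeff n Y ∈ ratForms n := fun n => polyForms_le_ratForms n (hY n)
  have hv : ∀ (D : ℕ → PowerSeries PlaneFun) k n, n < k → PowerSeries.coeff n (Y ^ k * D k) = 0 :=
      by
    intro D k n hn
    rw [PowerSeries.coeff_mul]
    refine sum_eq_zero fun p hp => ?_
    have := HasAntidiagonal.mem_antidiagonal.1 hp
    rw [coeff_pow_eq_zero k0 (by omega : p.1 < k), zero_mul]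
  have hs : IsExp 1 f _ := IsExp.of_sum (F := fun k => y ^ k * F k)
    (A := fun k => Y ^ k * (A k * PowerSeries.C logFun + B k))
    (fun k => by simpa using (hy.pow k).mul (hF k))
    (hv fun k => A k * PowerSeries.C logFun + B k)
    (fun K => by simpa using hf K)
  refine ⟨PowerSeries.mk fun n => ∑ k ∈ range (n + 1), PowerSeries.coeff n (Y ^ k * A k),
    PowerSeries.mk fun n => ∑ k ∈ range (n + 1), PowerSeries.coeff n (Y ^ k * B k),
    fun n => ?_, fun n => ?_, ?_, ?_, ?_, ?_, ?_, ?_⟩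
  · rw [PowerSeries.coeff_mk]
    exact Submodule.sum_mem _ fun k _ => coeff_mul_mem (coeff_pow_mem hY k) (hA k) n
  · rw [PowerSeries.coeff_mk]
    exact Submodule.sum_mem _ fun k _ => coeff_mul_mem (coeff_pow_mem hY' k) (hB k) n
  · rw [PowerSeries.coeff_mk]
    simp [← h0]
  · rw [PowerSeries.coeff_mk]; funext x
    simp only [sum_range_succ, range_zero, sum_empty, pow_zero, pow_one, zero_add,
        PowerSeries.coeff_one, if_true, one_ne_zero, if_false,
      Pi.one_apply, Pi.zero_apply,
      coeff_one_mul', k0, k1, h0, h1, Pi.add_apply, Pi.mul_apply]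
    ring
  · rw [PowerSeries.coeff_mk]; funext x
    simp only [sum_range_succ, range_zero, sum_empty, pow_zero, pow_one, zero_add,
        PowerSeries.coeff_one, if_true, one_ne_zero, two_ne_zero, if_false,
      Pi.one_apply, Pi.zero_apply, pow_two,
      coeff_two_mul', coeff_one_mul', coeff_zero_mul', k0, k1, k2, h0, h1, h2, Pi.add_apply,
      Pi.mul_apply]
    ring
  · rw [PowerSeries.coeff_mk]
    simp [← h3]
  · rw [PowerSeries.coeff_mk]; funext x
    simp only [sum_range_succ, range_zero, sum_empty, pow_zero, pow_one, zero_add,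
        PowerSeries.coeff_one, if_true, one_ne_zero, if_false,
      Pi.one_apply, Pi.zero_apply,
      coeff_one_mul', k0, k1, h3, h4, Pi.add_apply, Pi.mul_apply]
    ring
  · convert hs using 1
    ext1 n
    simp only [map_add, PowerSeries.coeff_mul_C, PowerSeries.coeff_mk, mul_add, ← mul_assoc,
      sum_add_distrib, sum_mul]

end HasLogExp

end SphericalPendulum

namespace SphericalPendulum

open Filter Asymptotics Topology Finset MeasureTheory

/-! ### Integrals with the kernel `1 / √(v² - r²)` -/

theorem setIntegral_Ioo_of_hasDerivAt {F f : ℝ → ℝ} {a b : ℝ} (hab : a ≤ b)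
    (hc : ContinuousOn F (Set.Icc a b)) (hd : ∀ x ∈ Set.Ioo a b, HasDerivAt F (f x) x)
    (hi : IntegrableOn f (Set.Ioo a b)) : ∫ x in Set.Ioo a b, f x = F b - F a := by
  rw [← integral_Ioc_eq_integral_Ioo, ← intervalIntegral.integral_of_le hab]
  exact intervalIntegral.integral_eq_sub_of_hasDerivAt_of_le hab hc hd
    ((intervalIntegrable_iff_integrableOn_Ioo_of_le hab).2 hi)

/-- Integrability at the endpoint singularities comes for free from a continuous antiderivative when
the integrand has constant sign. -/
theorem integrableOn_Ioo_of_hasDerivAt_of_nonneg {F f : ℝ → ℝ} {a b : ℝ}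
    (hc : ContinuousOn F (Set.Icc a b)) (hd : ∀ x ∈ Set.Ioo a b, HasDerivAt F (f x) x)
    (h0 : ∀ x ∈ Set.Ioo a b, 0 ≤ f x) : IntegrableOn f (Set.Ioo a b) :=
  (intervalIntegral.integrableOn_deriv_of_nonneg hc hd h0).mono_set Set.Ioo_subset_Ioc_self

theorem hasDerivAt_sqrt_one_sub {v : ℝ} (hv : v < 1) :
    HasDerivAt (fun v => √(1 - v)) (-1 / (2 * √(1 - v))) v :=
  ((hasDerivAt_id v).const_sub 1).sqrt (by simp; linarith)

theorem hasDerivAt_sqrt_sq_sub {r v : ℝ} (hv : 0 < v ^ 2 - r ^ 2) :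
    HasDerivAt (fun v => √(v ^ 2 - r ^ 2)) (v / √(v ^ 2 - r ^ 2)) v := by
  have := (((hasDerivAt_id v).pow 2).sub_const (r ^ 2)).sqrt (by simpa using hv.ne')
  refine hasDerivAt_congr this (fun y => by simp) ?_
  have : √(v ^ 2 - r ^ 2) ≠ 0 := (Real.sqrt_pos.2 hv).ne'
  simp
  field_simp

theorem sq_sub_sq_pos {r v : ℝ} (hr : 0 ≤ r) (hv : r < v) : 0 < v ^ 2 - r ^ 2 := by nlinarith

theorem integrableOn_one_div_sqrt_one_sub (r : ℝ) :
    IntegrableOn (fun v => 1 / √(1 - v)) (Set.Ioo r 1) := by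
  refine integrableOn_Ioo_of_hasDerivAt_of_nonneg (F := fun v => -2 * √(1 - v)) (by fun_prop)
    (fun v hv => ?_) fun v _ => by positivity
  refine ((hasDerivAt_sqrt_one_sub hv.2).const_mul (-2)).congr_deriv ?_
  have : √(1 - v) ≠ 0 := (Real.sqrt_pos.2 (by linarith [hv.2])).ne'
  field_simp

theorem integral_one_div_sqrt_one_sub {r : ℝ} (hr : r ≤ 1) :
    ∫ v in Set.Ioo r 1, 1 / √(1 - v) = 2 * √(1 - r) := by
  rw [setIntegral_Ioo_of_hasDerivAt (F := fun v => -2 * √(1 - v)) hr (by fun_prop)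
    (fun v hv => ?_) (integrableOn_one_div_sqrt_one_sub r)]
  · simp
  refine ((hasDerivAt_sqrt_one_sub hv.2).const_mul (-2)).congr_deriv ?_
  have : √(1 - v) ≠ 0 := (Real.sqrt_pos.2 (by linarith [hv.2])).ne'
  field_simp

/-- The integral of `g` over `(r, 1)` against the kernel `1 / √(v² - r²)`. -/
noncomputable def kernelIntegral (g : ℝ → ℝ) (r : ℝ) : ℝ :=
  ∫ v in Set.Ioo r 1, g v / √(v ^ 2 - r ^ 2)

theorem hasDerivAt_log_add_sqrt {r v : ℝ} (hr : 0 < r) (hv : r < v) :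
    HasDerivAt (fun v => Real.log (v + √(v ^ 2 - r ^ 2))) (1 / √(v ^ 2 - r ^ 2)) v := by
  have h0 := sq_sub_sq_pos hr.le hv
  have hs := Real.sqrt_pos.2 h0
  refine (((hasDerivAt_id v).add (hasDerivAt_sqrt_sq_sub h0)).log (by simp; linarith)).congr_deriv
      ?_
  have : v + √(v ^ 2 - r ^ 2) ≠ 0 := by linarith
  simp
  field_simp
  ring

theorem continuousOn_log_add_sqrt {r : ℝ} (hr : 0 < r) :
    ContinuousOn (fun v => Real.log (v + √(v ^ 2 - r ^ 2))) (Set.Icc r 1) := by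
  refine ContinuousOn.log (by fun_prop) fun v hv => ?_
  have := Real.sqrt_nonneg (v ^ 2 - r ^ 2)
  linarith [hv.1]

theorem integrableOn_one_div_sqrt_sq_sub {r : ℝ} (hr : 0 < r) :
    IntegrableOn (fun v => 1 / √(v ^ 2 - r ^ 2)) (Set.Ioo r 1) :=
  integrableOn_Ioo_of_hasDerivAt_of_nonneg (continuousOn_log_add_sqrt hr)
    (fun _ hv => hasDerivAt_log_add_sqrt hr hv.1) fun v _ => by positivity

theorem integral_one_div_sqrt_sq_sub {r : ℝ} (hr : 0 < r) (hr1 : r ≤ 1) :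
    ∫ v in Set.Ioo r 1, 1 / √(v ^ 2 - r ^ 2)
      = Real.log (1 / r) + Real.log (1 + √(1 - r ^ 2)) := by
  rw [setIntegral_Ioo_of_hasDerivAt hr1 (continuousOn_log_add_sqrt hr)
    (fun _ hv => hasDerivAt_log_add_sqrt hr hv.1) (integrableOn_one_div_sqrt_sq_sub hr)]
  simp
  ring

/-- The two singularities are apart: for `v ≤ 3/4` the factor `1/√(1-v)` is at most `2`, and for `v
≥ 3/4`, as `r ≤ 1/2`, the other factor is. -/
theorem kernel_le {r v : ℝ} (hr : 0 < r) (hr2 : r ≤ 1 / 2) (hv : v ∈ Set.Ioo r 1) :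
    1 / √(1 - v) / √(v ^ 2 - r ^ 2) ≤ 2 * (1 / √(v ^ 2 - r ^ 2)) + 2 * (1 / √(1 - v)) := by
  have h0 := Real.sqrt_pos.2 (sq_sub_sq_pos hr.le hv.1)
  have h1 : 0 < √(1 - v) := Real.sqrt_pos.2 (by linarith [hv.2])
  set A := 1 / √(1 - v) with hA
  set B := 1 / √(v ^ 2 - r ^ 2) with hB
  have hA0 : 0 < A := by positivity
  have hB0 : 0 < B := by positivity
  rw [show A / √(v ^ 2 - r ^ 2) = A * B by rw [hB]; ring]
  rcases le_total v (3 / 4) with h | h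
  · have : 1 / 2 ≤ √(1 - v) := Real.le_sqrt_of_sq_le (by linarith)
    have : A ≤ 2 := by rw [hA, div_le_iff₀ h1]; linarith
    nlinarith
  · have : 1 / 2 ≤ √(v ^ 2 - r ^ 2) := Real.le_sqrt_of_sq_le (by nlinarith)
    have : B ≤ 2 := by rw [hB, div_le_iff₀ h0]; linarith
    nlinarith

theorem log_two_le_log_one_div {r : ℝ} (hr : 0 < r) (hr2 : r ≤ 1 / 2) :
    Real.log 2 ≤ Real.log (1 / r) := by
  refine Real.log_le_log two_pos ?_
  rw [le_div_iff₀ hr]; linarith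

theorem integrableOn_kernel {g : ℝ → ℝ} {C r : ℝ} (hg : Measurable g) (hr : 0 < r)
    (hr2 : r ≤ 1 / 2) (hgC : ∀ v ∈ Set.Ioo r 1, |g v| ≤ C / √(1 - v)) :
    IntegrableOn (fun v => g v / √(v ^ 2 - r ^ 2)) (Set.Ioo r 1) := by
  refine Integrable.mono' ((((integrableOn_one_div_sqrt_sq_sub hr).const_mul 2).add
    ((integrableOn_one_div_sqrt_one_sub r).const_mul 2)).const_mul C) ?_ ?_
  · exact (hg.div (by fun_prop)).aestronglyMeasurable
  · refine (ae_restrict_iff' measurableSet_Ioo).2 (Eventually.of_forall fun v hv => ?_)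
    have h1 : 0 < √(1 - v) := Real.sqrt_pos.2 (by linarith [hv.2])
    have hC : 0 ≤ C := by
      have := (abs_nonneg _).trans (hgC v hv)
      by_contra h
      have := div_neg_of_neg_of_pos (not_le.1 h) h1
      linarith
    rw [norm_div, Real.norm_eq_abs, Real.norm_of_nonneg (Real.sqrt_nonneg _)]
    calc |g v| / √(v ^ 2 - r ^ 2) ≤ C / √(1 - v) / √(v ^ 2 - r ^ 2) := by
          gcongr; exact hgC v hv
      _ = C * (1 / √(1 - v) / √(v ^ 2 - r ^ 2)) := by ring
      _ ≤ _ := mul_le_mul_of_nonneg_left (kernel_le hr hr2 hv) hC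

/-- Integrating `kernel_le` gives at most `C (2 ln(1/r) + 2 ln 2 + 4)`; since `ln(1/r) ≥ ln 2`, the
constant `12` absorbs everything into the logarithm. -/
theorem abs_kernelIntegral_le {g : ℝ → ℝ} {C r : ℝ} (hg : Measurable g) (hr : 0 < r)
    (hr2 : r ≤ 1 / 2) (hC : 0 ≤ C) (hgC : ∀ v ∈ Set.Ioo r 1, |g v| ≤ C / √(1 - v)) :
    |kernelIntegral g r| ≤ 12 * C * Real.log (1 / r) := by
  have hi := integrableOn_kernel hg hr hr2 hgC
  have hi1 : IntegrableOn (fun v => 2 * (1 / √(v ^ 2 - r ^ 2))) (Set.Ioo r 1) :=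
    (integrableOn_one_div_sqrt_sq_sub hr).const_mul 2
  have hi2 : IntegrableOn (fun v => 2 * (1 / √(1 - v))) (Set.Ioo r 1) :=
    (integrableOn_one_div_sqrt_one_sub r).const_mul 2
  have h1 : |kernelIntegral g r| ≤ ∫ v in Set.Ioo r 1,
      C * (2 * (1 / √(v ^ 2 - r ^ 2)) + 2 * (1 / √(1 - v))) := by
    rw [kernelIntegral, ← Real.norm_eq_abs]
    refine norm_integral_le_of_norm_le (Integrable.const_mul (hi1.add hi2) C) ?_
    refine (ae_restrict_iff' measurableSet_Ioo).2 (Eventually.of_forall fun v hv => ?_)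
    rw [norm_div, Real.norm_eq_abs, Real.norm_of_nonneg (Real.sqrt_nonneg _)]
    calc |g v| / √(v ^ 2 - r ^ 2) ≤ C / √(1 - v) / √(v ^ 2 - r ^ 2) := by
          gcongr; exact hgC v hv
      _ = C * (1 / √(1 - v) / √(v ^ 2 - r ^ 2)) := by ring
      _ ≤ _ := mul_le_mul_of_nonneg_left (kernel_le hr hr2 hv) hC
  refine h1.trans ?_
  rw [integral_const_mul, integral_add hi1 hi2, integral_const_mul, integral_const_mul,
    integral_one_div_sqrt_sq_sub hr (by linarith), integral_one_div_sqrt_one_sub (by linarith)]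
  have hl := log_two_le_log_one_div hr hr2
  have hs1 : √(1 - r ^ 2) ≤ 1 := Real.sqrt_le_one.2 (by nlinarith)
  have hs2 : √(1 - r) ≤ 1 := Real.sqrt_le_one.2 (by linarith)
  have hl2 : Real.log (1 + √(1 - r ^ 2)) ≤ Real.log 2 :=
    Real.log_le_log (by positivity) (by linarith)
  have := Real.log_two_gt_d9
  rw [show 12 * C * Real.log (1 / r) = C * (12 * Real.log (1 / r)) by ring]
  gcongr
  linarith

/-! ### Expansions in powers of `r²` and a logarithm -/

/-- `f(r) = ∑_{l<N} r^(2l) (a_l ln(1/r) + b_l) + O(r^(2N) ln(1/r))` as `r → 0+`. -/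
def IsLogSum (N : ℕ) (f : ℝ → ℝ) (a b : ℕ → ℝ) : Prop :=
  (fun r => f r - ∑ l ∈ range N, r ^ (2 * l) * (a l * Real.log (1 / r) + b l))
    =O[𝓝[>] 0] fun r => r ^ (2 * N) * Real.log (1 / r)

theorem eventually_small {ε : ℝ} (hε : 0 < ε) : ∀ᶠ r in 𝓝[>] (0 : ℝ), 0 < r ∧ r ≤ ε := by
  filter_upwards [Ioc_mem_nhdsGT hε] with r hr using hr

theorem tendsto_log_one_div : Tendsto (fun r : ℝ => Real.log (1 / r)) (𝓝[>] 0) atTop := by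
  simp only [one_div]
  exact Real.tendsto_log_atTop.comp tendsto_inv_nhdsGT_zero

theorem one_isBigO_log : (fun _ : ℝ => (1 : ℝ)) =O[𝓝[>] 0] fun r => Real.log (1 / r) := by
  refine IsBigO.of_bound 1 ?_
  filter_upwards [tendsto_log_one_div.eventually_ge_atTop 1] with r hr
  rw [norm_one, one_mul, Real.norm_of_nonneg (by linarith)]
  exact hr

theorem pow_isBigO_pow_log {m n : ℕ} (h : n ≤ m) :
    (fun r : ℝ => r ^ m) =O[𝓝[>] 0] fun r => r ^ n := by
  refine IsBigO.of_bound 1 ?_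
  filter_upwards [eventually_small one_pos] with r hr
  have := hr.1
  rw [one_mul, Real.norm_of_nonneg (by positivity), Real.norm_of_nonneg (by positivity)]
  exact pow_le_pow_of_le_one hr.1.le hr.2 h

theorem log_term_isBigO (α β : ℝ) (l : ℕ) :
    (fun r : ℝ => r ^ (2 * l) * (α * Real.log (1 / r) + β))
      =O[𝓝[>] 0] fun r => r ^ (2 * l) * Real.log (1 / r) :=
  (isBigO_refl _ _).mul (((isBigO_refl _ _).const_mul_left α).add
    ((isBigO_const_const β one_ne_zero _).trans one_isBigO_log))

namespace IsLogSum

variable {N M : ℕ} {f g : ℝ → ℝ} {a b a' b' : ℕ → ℝ}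

theorem of_succ (h : IsLogSum (N + 1) f a b) : IsLogSum N f a b := by
  refine ((h.trans ((pow_isBigO_pow_log (by omega : 2 * N ≤ 2 * (N + 1))).mul
    (isBigO_refl _ _))).add (log_term_isBigO (a N) (b N) N)).congr_left fun r => ?_
  rw [sum_range_succ]; ring

theorem mono (h : IsLogSum N f a b) (hMN : M ≤ N) : IsLogSum M f a b := by
  induction hMN with
  | refl => exact h
  | step _ ih => exact ih h.of_succ

theorem add (hf : IsLogSum N f a b) (hg : IsLogSum N g a' b') :
    IsLogSum N (fun r => f r + g r) (fun l => a l + a' l) (fun l => b l + b' l) := by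
  refine (IsBigO.add hf hg).congr_left fun r => ?_
  have : ∀ l, r ^ (2 * l) * ((a l + a' l) * Real.log (1 / r) + (b l + b' l))
      = r ^ (2 * l) * (a l * Real.log (1 / r) + b l)
        + r ^ (2 * l) * (a' l * Real.log (1 / r) + b' l) := fun l => by ring
  simp only [this, sum_add_distrib]
  ring

theorem const_mul (c : ℝ) (hf : IsLogSum N f a b) :
    IsLogSum N (fun r => c * f r) (fun l => c * a l) (fun l => c * b l) := by
  refine (IsBigO.const_mul_left hf c).congr_left fun r => ?_
  rw [mul_sub, mul_sum]
  congr 1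
  exact sum_congr rfl fun l _ => by ring

theorem congr (hf : IsLogSum N f a b) (h : f =ᶠ[𝓝[>] 0] g) : IsLogSum N g a b :=
  IsBigO.congr' hf (h.mono fun r hr => by simp only [hr]) EventuallyEq.rfl

theorem zero : IsLogSum N (fun _ => 0) (fun _ => 0) (fun _ => 0) := by
  simp [IsLogSum, isBigO_zero]

theorem sum {ι : Type*} {s : Finset ι} {F : ι → ℝ → ℝ} {A B : ι → ℕ → ℝ}
    (h : ∀ i ∈ s, IsLogSum N (F i) (A i) (B i)) :
    IsLogSum N (fun r => ∑ i ∈ s, F i r) (fun l => ∑ i ∈ s, A i l) (fun l => ∑ i ∈ s, B i l) := by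
  classical
  induction s using Finset.induction_on with
  | empty => simpa using zero
  | insert i s hi ih =>
    simp only [sum_insert hi]
    exact (h i (mem_insert_self _ _)).add (ih fun k hk => h k (mem_insert_of_mem hk))

theorem sq_mul (hf : IsLogSum N f a b) :
    IsLogSum (N + 1) (fun r => r ^ 2 * f r) (fun l => if l = 0 then 0 else a (l - 1))
      (fun l => if l = 0 then 0 else b (l - 1)) := by
  refine ((isBigO_refl (fun r : ℝ => r ^ 2) _).mul hf).congr (fun r => ?_) fun r => by ring
  rw [sum_range_succ', mul_sub, mul_sum]
  simp only [Nat.add_sub_cancel, Nat.succ_ne_zero, if_false, if_true]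
  rw [zero_mul, zero_add, mul_zero, add_zero]
  congr 1
  exact sum_congr rfl fun l _ => by ring

theorem of_taylor {φ : ℝ → ℝ} {c : ℕ → ℝ} (h : HasTaylor φ c) :
    IsLogSum N (fun r => φ (r ^ 2)) (fun _ => 0) c := by
  have ht : Tendsto (fun r : ℝ => r ^ 2) (𝓝[>] 0) (𝓝 0) := by
    have : Tendsto (fun r : ℝ => r ^ 2) (𝓝 0) (𝓝 (0 ^ 2)) := (continuous_pow 2).tendsto 0
    exact (by simpa using this : Tendsto _ _ _).mono_left nhdsWithin_le_nhds
  have h1 := ((h N).comp_tendsto ht).mul one_isBigO_log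
  refine h1.congr (fun r => ?_) fun r => ?_
  · simp only [Function.comp, mul_one, zero_mul, zero_add, ← pow_mul]
    congr 1
    exact sum_congr rfl fun l _ => by ring
  · simp only [Function.comp, ← pow_mul]

theorem log : IsLogSum N (fun r => Real.log (1 / r)) (fun l => if l = 0 then 1 else 0)
    (fun _ => 0) := by
  rcases N with _ | N
  · simpa [IsLogSum] using isBigO_refl (fun r : ℝ => Real.log (1 / r)) (𝓝[>] 0)
  · refine IsBigO.congr_left (isBigO_zero _ _) fun r => ?_
    rw [sum_eq_single 0] <;> simp +contextual

/-- By induction only the last term survives; divided by `r^(2N)` it tends to `0`. Divergence of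
`ln(1/r)` forces `a N = 0`, and then `b N = 0`. -/
theorem eq_zero_of_zero (h : IsLogSum N (fun _ => 0) a b) : ∀ l < N, a l = 0 ∧ b l = 0 := by
  induction N with
  | zero => intro l hl; omega
  | succ N ih =>
    have ih := ih h.of_succ
    have h1 : (fun r : ℝ => r ^ (2 * N) * (a N * Real.log (1 / r) + b N))
        =O[𝓝[>] 0] fun r => r ^ (2 * (N + 1)) * Real.log (1 / r) := by
      refine (IsBigO.neg_left h).congr_left fun r => ?_
      rw [sum_range_succ, sum_eq_zero fun l hl => by
        rw [(ih l (mem_range.1 hl)).1, (ih l (mem_range.1 hl)).2]; ring]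
      ring
    have h2 : (fun r : ℝ => a N * Real.log (1 / r) + b N)
        =O[𝓝[>] 0] fun r => r ^ 2 * Real.log (1 / r) := by
      have := (isBigO_refl (fun r : ℝ => (r ^ (2 * N))⁻¹) (𝓝[>] 0)).mul h1
      refine this.congr' ?_ ?_
      · filter_upwards [eventually_small one_pos] with r hr
        have := hr.1
        field_simp
      · filter_upwards [eventually_small one_pos] with r hr
        have := hr.1
        rw [mul_add, pow_add]
        field_simp
    have ht : Tendsto (fun r : ℝ => r ^ 2 * Real.log (1 / r)) (𝓝[>] 0) (𝓝 0) := by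
      have := (tendsto_log_mul_rpow_nhdsGT_zero (r := 2) two_pos).neg
      rw [neg_zero] at this
      refine this.congr fun r => ?_
      simp [mul_comm]
    have h3 := h2.trans_tendsto ht
    have haN : a N = 0 := by
      by_contra hne
      have h4 : Tendsto (fun r : ℝ => a N * Real.log (1 / r)) (𝓝[>] 0) (𝓝 (0 - b N)) := by
        simpa using h3.sub_const (b N)
      have h5 := h4.const_mul (a N)⁻¹
      simp only [inv_mul_cancel_left₀ hne] at h5
      exact not_tendsto_nhds_of_tendsto_atTop tendsto_log_one_div _ h5
    have hbN : b N = 0 := by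
      simp only [haN, zero_mul, zero_add] at h3
      exact tendsto_nhds_unique tendsto_const_nhds h3
    intro l hl
    rcases Nat.lt_succ_iff_lt_or_eq.1 hl with h | rfl
    · exact ih l h
    · exact ⟨haN, hbN⟩

/-- This makes it possible to glue expansions obtained separately at each order into a single one.
-/
theorem unique (h : IsLogSum N f a b) (h' : IsLogSum N f a' b') :
    ∀ l < N, a l = a' l ∧ b l = b' l := by
  have := (h.add (h'.const_mul (-1))).congr (g := fun _ => 0)
    (Eventually.of_forall fun r => by ring)
  intro l hl
  have := this.eq_zero_of_zero l hl
  constructor <;> linarith [this.1, this.2]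

theorem congr_coeff (h : IsLogSum N f a b) (hab : ∀ l < N, a l = a' l ∧ b l = b' l) :
    IsLogSum N f a' b' := by
  refine IsBigO.congr_left h fun r => ?_
  congr 1
  exact sum_congr rfl fun l hl => by
    rw [(hab l (mem_range.1 hl)).1, (hab l (mem_range.1 hl)).2]

end IsLogSum

end SphericalPendulum

namespace SphericalPendulum

open Filter Asymptotics Topology Finset MeasureTheory

/-! ### Expansion of the kernel integral of a function with a Taylor expansion -/

theorem hasTaylor_sqrt_one_sub : ∃ c, HasTaylor (fun y => √(1 - y)) c ∧ c 0 = 1 := by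
  have h := hasTaylor_of_analyticAt (φ := fun y => √(1 - y)) (φ' := fun y => -1 / (2 * √(1 - y)))
    (d := -1 / 4) ?_ ?_ ?_
  · obtain ⟨c, h, h0, -, -⟩ := h
    exact ⟨c, h, by simpa using h0⟩
  · have h1 : ContDiffAt ℝ ⊤ (fun y : ℝ => √(1 - y)) 0 :=
      (Real.contDiffAt_sqrt (x := 1 - 0) (by simp)).comp (0 : ℝ) (by fun_prop)
    exact h1.analyticAt
  · filter_upwards [gt_mem_nhds (show (0 : ℝ) < 1 by norm_num)] with y hy
    exact hasDerivAt_sqrt_one_sub hy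
  · have := (((hasDerivAt_sqrt_one_sub (v := 0) one_pos).const_mul 2).inv (by simp)).const_mul (-1)
    exact hasDerivAt_congr this (fun y => by simp [neg_div]) (by norm_num)

theorem HasTaylor.of_analyticAt {φ : ℝ → ℝ} (h : AnalyticAt ℝ φ 0) :
    ∃ c, HasTaylor φ c ∧ c 0 = φ 0 := by
  refine ⟨fun n => iteratedDeriv n φ 0 / n.factorial, fun N => ?_, by simp⟩
  have := h.hasFPowerSeriesAt.isBigO_sub_partialSum_pow N
  simp only [zero_add] at this
  refine (this.congr_left fun y => ?_).trans (IsBigO.of_bound 1 (by simp))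
  simp [FormalMultilinearSeries.partialSum, FormalMultilinearSeries.ofScalars]

theorem isLogSum_kernelIntegral_one : ∃ b : ℕ → ℝ, b 0 = Real.log 2 ∧
    ∀ N, IsLogSum N (kernelIntegral fun v => v ^ 0) (fun l => if l = 0 then 1 else 0) b := by
  obtain ⟨c, hc, h0⟩ := HasTaylor.of_analyticAt (φ := fun y => Real.log (1 + √(1 - y))) (by
    have h1 : ContDiffAt ℝ ⊤ (fun y : ℝ => √(1 - y)) 0 :=
      (Real.contDiffAt_sqrt (x := 1 - 0) (by simp)).comp (0 : ℝ) (by fun_prop)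
    have h2 : AnalyticAt ℝ (fun y : ℝ => 1 + √(1 - y)) 0 := analyticAt_const.add h1.analyticAt
    exact h2.log (by simp))
  refine ⟨c, by rw [h0]; norm_num, fun N => ?_⟩
  have := (IsLogSum.log (N := N)).add (IsLogSum.of_taylor hc)
  simp only [add_zero, zero_add] at this
  refine this.congr ?_
  filter_upwards [eventually_small one_pos] with r hr
  simp only [kernelIntegral, pow_zero]
  rw [integral_one_div_sqrt_sq_sub hr.1 hr.2]

/-- Integrated over `(r, 1)`, this is the two-step recursion for the moments of the kernel. -/
theorem hasDerivAt_pow_mul_sqrt {r v : ℝ} (hr : 0 < r) (hv : r < v) (n : ℕ) :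
    HasDerivAt (fun v => v ^ (n + 1) * √(v ^ 2 - r ^ 2))
      ((n + 2) * (v ^ (n + 2) / √(v ^ 2 - r ^ 2))
        - (n + 1) * r ^ 2 * (v ^ n / √(v ^ 2 - r ^ 2))) v := by
  have h0 := sq_sub_sq_pos hr.le hv
  have hs := Real.sqrt_pos.2 h0
  refine ((hasDerivAt_pow (n + 1) v).mul (hasDerivAt_sqrt_sq_sub h0)).congr_deriv ?_
  have h2 := Real.sq_sqrt h0.le
  field_simp
  rw [h2]
  push_cast
  ring

theorem integrableOn_pow_kernel {r : ℝ} (hr : 0 < r) (n : ℕ) :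
    IntegrableOn (fun v => v ^ n / √(v ^ 2 - r ^ 2)) (Set.Ioo r 1) := by
  refine Integrable.mono' (integrableOn_one_div_sqrt_sq_sub hr) ?_ ?_
  · exact (Measurable.div (by fun_prop) (by fun_prop)).aestronglyMeasurable
  · refine (ae_restrict_iff' measurableSet_Ioo).2 (Eventually.of_forall fun v hv => ?_)
    have : 0 < v := hr.trans hv.1
    rw [Real.norm_of_nonneg (by positivity)]
    gcongr
    exact pow_le_one₀ this.le hv.2.le

theorem kernelIntegral_pow_add_two {r : ℝ} (hr : 0 < r) (hr1 : r ≤ 1) (n : ℕ) :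
    kernelIntegral (fun v => v ^ (n + 2)) r = 1 / (n + 2) * √(1 - r ^ 2)
      + (n + 1) / (n + 2) * (r ^ 2 * kernelIntegral (fun v => v ^ n) r) := by
  have h1 := (integrableOn_pow_kernel hr (n + 2)).const_mul ((n : ℝ) + 2)
  have h2 := (integrableOn_pow_kernel hr n).const_mul (((n : ℝ) + 1) * r ^ 2)
  have h := setIntegral_Ioo_of_hasDerivAt hr1 (by fun_prop)
    (fun v hv => hasDerivAt_pow_mul_sqrt hr hv.1 n) (Integrable.sub h1 h2)
  rw [integral_sub h1 h2, integral_const_mul, integral_const_mul] at h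
  simp only [one_pow, sub_self, Real.sqrt_zero, mul_zero, one_mul, sub_zero] at h
  unfold kernelIntegral
  field_simp
  linarith

theorem kernelIntegral_id {r : ℝ} (hr : 0 < r) (hr1 : r ≤ 1) :
    kernelIntegral (fun v => v ^ 1) r = √(1 - r ^ 2) := by
  have h := setIntegral_Ioo_of_hasDerivAt (F := fun v => √(v ^ 2 - r ^ 2)) hr1 (by fun_prop)
    (fun v hv => hasDerivAt_sqrt_sq_sub (sq_sub_sq_pos hr.le hv.1))
    (by simpa using integrableOn_pow_kernel hr 1)
  simpa [kernelIntegral] using h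

/-- Each step of the recursion multiplies by `r²` and adds a multiple of `√(1 - r²)`. The logarithm
of the case `n = 0` is thus pushed one order up every time, while odd `n` never produce one. -/
theorem isLogSum_kernelIntegral_pow (n : ℕ) : ∃ a b : ℕ → ℝ,
    (∀ N, IsLogSum N (kernelIntegral fun v => v ^ n) a b) ∧ a 0 = (if n = 0 then 1 else 0) ∧
    a 1 = (if n = 2 then 1 / 2 else 0) ∧ b 0 = if n = 0 then Real.log 2 else 1 / n := by
  obtain ⟨c, hc, hc0⟩ := hasTaylor_sqrt_one_sub
  induction n using Nat.strong_induction_on with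
  | _ n ih =>
    rcases n with _ | _ | n
    · obtain ⟨b, hb, h⟩ := isLogSum_kernelIntegral_one
      exact ⟨_, b, h, by simp, by simp, by simpa using hb⟩
    · refine ⟨fun _ => 0, c, fun N => (IsLogSum.of_taylor hc).congr ?_, by simp, by simp,
        by simpa using hc0⟩
      filter_upwards [eventually_small one_pos] with r hr
      exact (kernelIntegral_id hr.1 hr.2).symm
    · obtain ⟨a, b, h, h0, h1, h2⟩ := ih n (by omega)
      refine ⟨_, _, fun N => ((((IsLogSum.of_taylor (N := N + 1) hc).const_mul
        (1 / ((n : ℝ) + 2))).add (((h N).sq_mul).const_mul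
          (((n : ℝ) + 1) / (n + 2)))).mono N.le_succ).congr ?_, ?_, ?_, ?_⟩
      · filter_upwards [eventually_small one_pos] with r hr
        exact (kernelIntegral_pow_add_two hr.1 hr.2 n).symm
      · simp
      · simp only [h0]
        rcases eq_or_ne n 0 with rfl | hn
        · norm_num
        · simp [hn]
      · simp [hc0, add_assoc, one_add_one_eq_two]

/-- `g` has the Taylor coefficients `c` at `0`, with remainders bounded on all of `(0, 1)` by
multiples of `v^N / √(1 - v)`. -/
def HasTaylorOn (g : ℝ → ℝ) (c : ℕ → ℝ) : Prop :=
  Measurable g ∧ ∀ N : ℕ, ∃ C : ℝ, 0 ≤ C ∧ ∀ v ∈ Set.Ioo (0 : ℝ) 1,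
    |g v - ∑ n ∈ range N, c n * v ^ n| ≤ C * v ^ N / √(1 - v)

theorem HasTaylor.hasTaylorOn {g : ℝ → ℝ} {c : ℕ → ℝ} (h : HasTaylor g c) (hg : Measurable g)
    {C : ℝ} (hC : 0 ≤ C) (hgC : ∀ v ∈ Set.Ioo (0 : ℝ) 1, |g v| ≤ C / √(1 - v)) :
    HasTaylorOn g c := by
  refine ⟨hg, fun N => ?_⟩
  obtain ⟨C₁, hC₁, hb⟩ := (h N).exists_nonneg
  obtain ⟨ε, hε, hb⟩ := Metric.eventually_nhds_iff.1 hb.bound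
  set D := C + ∑ n ∈ range N, |c n| with hD
  have hD0 : 0 ≤ D := add_nonneg hC (sum_nonneg fun _ _ => abs_nonneg _)
  refine ⟨C₁ + D / ε ^ N, by positivity, fun v hv => ?_⟩
  have hs : 0 < √(1 - v) := Real.sqrt_pos.2 (by linarith [hv.2])
  have hs1 : √(1 - v) ≤ 1 := Real.sqrt_le_one.2 (by linarith [hv.1])
  have hv0 := hv.1
  have hone : 1 ≤ 1 / √(1 - v) := by rw [le_div_iff₀ hs]; linarith
  -- Close to `0` the local Taylor bound applies; elsewhere `v^N ≥ ε^N`, so a crude bound of `g` and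
  -- of its Taylor polynomial suffices.
  rcases lt_or_ge v ε with hvε | hvε
  · have h1 := hb (y := v) (by simpa [abs_of_pos hv0] using hvε)
    rw [Real.norm_eq_abs, Real.norm_of_nonneg (by positivity)] at h1
    calc _ ≤ C₁ * v ^ N * 1 := by simpa using h1
      _ ≤ (C₁ + D / ε ^ N) * v ^ N * (1 / √(1 - v)) := by
        gcongr
        exact le_add_of_nonneg_right (by positivity)
      _ = _ := by ring
  · have h1 : |g v - ∑ n ∈ range N, c n * v ^ n| ≤ D * (1 / √(1 - v)) := by
      refine (abs_sub _ _).trans ?_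
      rw [hD, add_mul]
      refine add_le_add (by simpa [div_eq_mul_inv] using hgC v hv) ?_
      refine (abs_sum_le_sum_abs _ _).trans ?_
      rw [sum_mul]
      refine sum_le_sum fun n _ => ?_
      rw [abs_mul, abs_of_nonneg (by positivity : 0 ≤ v ^ n)]
      refine mul_le_mul_of_nonneg_left ?_ (abs_nonneg _)
      exact (pow_le_one₀ hv0.le hv.2.le).trans hone
    refine h1.trans ?_
    calc D * (1 / √(1 - v)) = D / ε ^ N * ε ^ N * (1 / √(1 - v)) := by field_simp
      _ ≤ (C₁ + D / ε ^ N) * v ^ N * (1 / √(1 - v)) := by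
        gcongr
        exact le_add_of_nonneg_left hC₁
      _ = _ := by ring

theorem exists_hasTaylorOn_inv_sqrt : ∃ d, HasTaylorOn (fun z => 1 / √(1 - z)) d ∧ d 0 = 1 := by
  obtain ⟨d, hd, h0⟩ := HasTaylor.of_analyticAt (φ := fun y => 1 / √(1 - y)) (by
    have h1 : ContDiffAt ℝ ⊤ (fun y : ℝ => √(1 - y)) 0 :=
      (Real.contDiffAt_sqrt (x := 1 - 0) (by simp)).comp (0 : ℝ) (by fun_prop)
    exact analyticAt_const.div h1.analyticAt (by simp))
  refine ⟨d, hd.hasTaylorOn (by fun_prop) zero_le_one fun v _ => ?_, by simpa using h0⟩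
  rw [abs_of_nonneg (by positivity)]

/-- A numerator vanishing to order `2N` allows the expansion `1/√(v² - r²) = v⁻¹ ∑ d_l (r/v)^(2l)`
to be integrated term by term for `l < N`. The coefficients are moments of `h`, and no logarithm
arises before order `2N`. -/
theorem exists_isLogSum_tail {h : ℝ → ℝ} (hh : Measurable h) {N : ℕ} {C : ℝ} (hC : 0 ≤ C)
    (hhC : ∀ v ∈ Set.Ioo (0 : ℝ) 1, |h v| ≤ C * v ^ (2 * N) / √(1 - v)) :
    ∃ b : ℕ → ℝ, IsLogSum N (kernelIntegral h) (fun _ => 0) b ∧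
      b 0 = ∫ v in Set.Ioo (0 : ℝ) 1, h v / v := by
  obtain ⟨d, ⟨-, hd⟩, hd0⟩ := exists_hasTaylorOn_inv_sqrt
  obtain ⟨D, hD, hdN⟩ := hd N
  have hint : ∀ l < N, IntegrableOn (fun v => h v / v ^ (2 * l + 1)) (Set.Ioo 0 1) := by
    intro l hl
    refine Integrable.mono' ((integrableOn_one_div_sqrt_one_sub 0).const_mul C) ?_ ?_
    · exact (hh.div (by fun_prop)).aestronglyMeasurable
    · refine (ae_restrict_iff' measurableSet_Ioo).2 (Eventually.of_forall fun v hv => ?_)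
      have hv0 := hv.1
      have hs : 0 < √(1 - v) := Real.sqrt_pos.2 (by linarith [hv.2])
      rw [norm_div, Real.norm_eq_abs, Real.norm_of_nonneg (by positivity), div_le_iff₀
          (by positivity)]
      refine (hhC v hv).trans ?_
      rw [mul_assoc, one_div_mul_eq_div, mul_div_assoc]
      gcongr C * (?_ / _)
      exact pow_le_pow_of_le_one hv0.le hv.2.le (by omega)
  refine ⟨fun l => d l * ∫ v in Set.Ioo (0 : ℝ) 1, h v / v ^ (2 * l + 1), ?_, by simp [hd0]⟩
  have key : ∀ᶠ r in 𝓝[>] (0 : ℝ), |kernelIntegral h r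
      - ∑ l ∈ range N, r ^ (2 * l) * (d l * ∫ v in Set.Ioo (0 : ℝ) 1, h v / v ^ (2 * l + 1))|
      ≤ (12 * (D * C) + ∑ l ∈ range N, |d l| * (2 * C) * 2) * (r ^ (2 * N) * Real.log (1 / r)) := by
    filter_upwards [eventually_small (show (0 : ℝ) < 1 / 2 by norm_num)] with r hr
    obtain ⟨hr0, hr2⟩ := hr
    have hlog := log_two_le_log_one_div hr0 hr2
    have hl2 := Real.log_two_gt_d9
    -- The remainder of the kernel expansion, multiplied by `√(v² - r²)` to put it in the form of a
    -- kernel integral. In the bound the relation `√(1 - (r/v)²) = √(v² - r²)/v` cancels this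
    -- factor, and `v^(2N) (r/v)^(2N) = r^(2N)`.
    set E : ℝ → ℝ := fun v => h v * (√(v ^ 2 - r ^ 2) / v)
      * (1 / √(1 - (r / v) ^ 2) - ∑ l ∈ range N, d l * ((r / v) ^ 2) ^ l) with hE
    have hEm : Measurable E := by fun_prop
    have hEb : ∀ v ∈ Set.Ioo r 1, |E v| ≤ D * C * r ^ (2 * N) / √(1 - v) := by
      intro v hv
      have hv0 : 0 < v := hr0.trans hv.1
      have hs : 0 < √(1 - v) := Real.sqrt_pos.2 (by linarith [hv.2])
      have hs0 := Real.sqrt_pos.2 (sq_sub_sq_pos hr0.le hv.1)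
      have hrv : r / v < 1 := (div_lt_one hv0).2 hv.1
      have hrv0 : 0 < r / v := by positivity
      have h2 := hdN ((r / v) ^ 2) ⟨by positivity, by nlinarith⟩
      have hsq : √(1 - (r / v) ^ 2) = √(v ^ 2 - r ^ 2) / v := by
        rw [← Real.sqrt_sq hv0.le, ← Real.sqrt_div' _ (by positivity), Real.sqrt_sq hv0.le]
        congr 1
        field_simp
      rw [hE]
      simp only [abs_mul]
      rw [abs_of_pos (by positivity : 0 < √(v ^ 2 - r ^ 2) / v)]
      calc _ ≤ C * v ^ (2 * N) / √(1 - v) * (√(v ^ 2 - r ^ 2) / v)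
            * (D * ((r / v) ^ 2) ^ N / √(1 - (r / v) ^ 2)) := by
            gcongr
            exact hhC v ⟨hv0, hv.2⟩
        _ = _ := by
            rw [hsq, ← pow_mul, div_pow]
            field_simp
    have hEi := integrableOn_kernel hEm hr0 hr2 hEb
    have hsplit : ∀ v ∈ Set.Ioo r 1, h v / √(v ^ 2 - r ^ 2)
        = ∑ l ∈ range N, r ^ (2 * l) * d l * (h v / v ^ (2 * l + 1)) + E v / √(v ^ 2 - r ^ 2) := by
      intro v hv
      have hv0 : 0 < v := hr0.trans hv.1
      have hs0 := Real.sqrt_pos.2 (sq_sub_sq_pos hr0.le hv.1)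
      have hsq : √(1 - (r / v) ^ 2) = √(v ^ 2 - r ^ 2) / v := by
        rw [← Real.sqrt_sq hv0.le, ← Real.sqrt_div' _ (by positivity), Real.sqrt_sq hv0.le]
        congr 1
        field_simp
      have h3 : E v / √(v ^ 2 - r ^ 2) = h v / √(v ^ 2 - r ^ 2)
          - h v / v * ∑ l ∈ range N, d l * ((r / v) ^ 2) ^ l := by
        rw [hE]
        simp only [hsq]
        field_simp
      rw [h3, mul_sum]
      have h4 : ∀ l, h v / v * (d l * ((r / v) ^ 2) ^ l)
          = r ^ (2 * l) * d l * (h v / v ^ (2 * l + 1)) := by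
        intro l
        rw [← pow_mul, div_pow, pow_succ]
        field_simp
      simp only [h4]
      ring
    have hsub : Set.Ioo r 1 ⊆ Set.Ioo 0 1 := Set.Ioo_subset_Ioo_left hr0.le
    have hI : kernelIntegral h r = ∑ l ∈ range N, r ^ (2 * l) * d l
        * (∫ v in Set.Ioo r 1, h v / v ^ (2 * l + 1)) + kernelIntegral E r := by
      unfold kernelIntegral
      rw [setIntegral_congr_fun measurableSet_Ioo hsplit, integral_add, integral_finsetSum]
      · simp only [integral_const_mul]
      · intro l hl
        exact ((hint l (mem_range.1 hl)).mono_set hsub).const_mul _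
      · exact integrable_finsetSum _ fun l hl =>
          ((hint l (mem_range.1 hl)).mono_set hsub).const_mul _
      · exact hEi
    -- Extending the moments from `(r, 1)` to `(0, 1)` costs the integral over `(0, r]`, which has
    -- the order needed after multiplication by `r^(2l)`.
    have hdiff : ∀ l < N, |(∫ v in Set.Ioo r 1, h v / v ^ (2 * l + 1))
        - ∫ v in Set.Ioo (0 : ℝ) 1, h v / v ^ (2 * l + 1)| ≤ 2 * C * r ^ (2 * N - 2 * l) := by
      intro l hl
      have hu : Set.Ioo (0 : ℝ) 1 = Set.Ioc 0 r ∪ Set.Ioo r 1 :=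
        (Set.Ioc_union_Ioo_eq_Ioo hr0.le (by linarith)).symm
      rw [hu, setIntegral_union (Set.disjoint_left.2 fun v h1 h2 => absurd h1.2 (not_le.2 h2.1))
        measurableSet_Ioo ((hint l hl).mono_set fun v hv => ⟨hv.1, by linarith [hv.2]⟩)
        ((hint l hl).mono_set hsub), sub_add_cancel_right, abs_neg, ← Real.norm_eq_abs]
      have hb : ∀ v ∈ Set.Ioc (0 : ℝ) r, ‖h v / v ^ (2 * l + 1)‖ ≤ 2 * C * r ^ (2 * N - 2 * l - 1)
          := by
        intro v hv
        have hv0 := hv.1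
        have hs : 1 / 2 ≤ √(1 - v) := Real.le_sqrt_of_sq_le (by linarith [hv.2])
        rw [norm_div, Real.norm_eq_abs, Real.norm_of_nonneg (by positivity),
          div_le_iff₀ (by positivity)]
        refine (hhC v ⟨hv0, by linarith [hv.2]⟩).trans ?_
        rw [div_le_iff₀ (by linarith)]
        have h5 : v ^ (2 * N) = v ^ (2 * N - 2 * l - 1) * v ^ (2 * l + 1) := by
          rw [← pow_add]; congr 1; omega
        have h6 : v ^ (2 * N - 2 * l - 1) ≤ r ^ (2 * N - 2 * l - 1) :=
          pow_le_pow_left₀ hv0.le hv.2 _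
        calc C * v ^ (2 * N) = 2 * C * v ^ (2 * N - 2 * l - 1) * v ^ (2 * l + 1) * (1 / 2) := by
              rw [h5]; ring
          _ ≤ _ := by gcongr
      have h7 := norm_setIntegral_le_of_norm_le_const (μ := volume) (by simp) hb
      refine h7.trans (le_of_eq ?_)
      rw [Real.volume_real_Ioc_of_le hr0.le, sub_zero, mul_assoc, ← pow_succ]
      congr 2; omega
    have hE' := abs_kernelIntegral_le hEm hr0 hr2 (by positivity) hEb
    rw [hI, add_sub_right_comm, ← sum_sub_distrib]
    refine (abs_add_le _ _).trans ?_
    rw [add_mul, add_comm (12 * _ * _)]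
    refine add_le_add ((abs_sum_le_sum_abs _ _).trans ?_) (hE'.trans (le_of_eq (by ring)))
    rw [sum_mul]
    refine sum_le_sum fun l hl => ?_
    have hl' := mem_range.1 hl
    rw [mul_assoc, ← mul_sub, ← mul_sub, abs_mul, abs_mul, abs_of_nonneg (by positivity : 0 ≤ r ^
        (2 * l))]
    calc _ ≤ r ^ (2 * l) * (|d l| * (2 * C * r ^ (2 * N - 2 * l))) := by
          gcongr; exact hdiff l hl'
      _ = |d l| * (2 * C) * (r ^ (2 * l) * r ^ (2 * N - 2 * l)) * 1 := by ring
      _ ≤ |d l| * (2 * C) * (r ^ (2 * l) * r ^ (2 * N - 2 * l)) * (2 * Real.log (1 / r)) := by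
          gcongr; linarith
      _ = _ := by
          rw [← pow_add, show 2 * l + (2 * N - 2 * l) = 2 * N by omega]; ring
  refine IsBigO.of_bound (12 * (D * C) + ∑ l ∈ range N, |d l| * (2 * C) * 2) ?_
  filter_upwards [key, eventually_small (show (0 : ℝ) < 1 / 2 by norm_num)] with r h1 hr
  have hlog := log_two_le_log_one_div hr.1 hr.2
  have hl2 := Real.log_two_gt_d9
  have hr0 := hr.1
  rw [Real.norm_eq_abs, Real.norm_of_nonneg (mul_nonneg (by positivity) (by linarith))]
  simpa using h1

/-- The kernel integral of a function with Taylor coefficients `c` has an expansion to all orders.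
-/
theorem HasTaylorOn.exists_isLogSum {g : ℝ → ℝ} {c : ℕ → ℝ} (h : HasTaylorOn g c) :
    ∃ a b : ℕ → ℝ, (∀ N, IsLogSum N (kernelIntegral g) a b) ∧ a 0 = c 0 ∧ a 1 = c 2 / 2 ∧
      b 0 = c 0 * Real.log 2 + ∫ v in Set.Ioo (0 : ℝ) 1, (g v - c 0) / v := by
  obtain ⟨hg, hT⟩ := h
  choose a b hM ha0 ha1 hb0 using isLogSum_kernelIntegral_pow
  -- At fixed order, the Taylor polynomial of degree below `2N` is treated by the moments of the
  -- kernel and the rest by the tail lemma. The coefficients so obtained depend on `N`.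
  have hN : ∀ N, ∃ t : ℕ → ℝ, IsLogSum N (kernelIntegral g)
      (fun l => ∑ n ∈ range (2 * N), c n * a n l) (fun l => ∑ n ∈ range (2 * N), c n * b n l + t
          l) ∧
      t 0 = ∫ v in Set.Ioo (0 : ℝ) 1, (g v - ∑ n ∈ range (2 * N), c n * v ^ n) / v := by
    intro N
    obtain ⟨C, hC, hCN⟩ := hT (2 * N)
    have hm : Measurable fun v => g v - ∑ n ∈ range (2 * N), c n * v ^ n := by fun_prop
    obtain ⟨t, ht, ht0⟩ := exists_isLogSum_tail hm hC hCN
    refine ⟨t, ?_, ht0⟩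
    have h1 := (IsLogSum.sum (s := range (2 * N)) fun n _ => (hM n N).const_mul (c n)).add ht
    simp only [add_zero] at h1
    refine h1.congr ?_
    filter_upwards [eventually_small (show (0 : ℝ) < 1 / 2 by norm_num)] with r hr
    have hr0 := hr.1
    have hi : ∀ n, IntegrableOn (fun v => c n * (v ^ n / √(v ^ 2 - r ^ 2))) (Set.Ioo r 1) :=
      fun n => (integrableOn_pow_kernel hr0 n).const_mul _
    have hi2 := integrableOn_kernel hm hr0 hr.2 (C := C) fun v hv =>
      (hCN v ⟨hr0.trans hv.1, hv.2⟩).trans (by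
        have : v ^ (2 * N) ≤ 1 := pow_le_one₀ (hr0.trans hv.1).le hv.2.le
        gcongr
        exact mul_le_of_le_one_right hC this)
    unfold kernelIntegral
    simp only [← integral_const_mul]
    rw [← integral_finsetSum _ fun n _ => hi n, ← integral_add (integrable_finsetSum _ fun n _ =>
        hi n)
      hi2]
    refine integral_congr_ae (Eventually.of_forall fun v => ?_)
    simp only [sub_div, sum_div, mul_div_assoc]
    ring
  choose t ht ht0 using hN
  -- Uniqueness removes the dependence on `N`: the `l`-th coefficients may be read off at order `l +
  -- 1`.
  have hcons : ∀ N, ∀ l < N,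
      (∑ n ∈ range (2 * N), c n * a n l = ∑ n ∈ range (2 * (l + 1)), c n * a n l) ∧
      (∑ n ∈ range (2 * N), c n * b n l + t N l
        = ∑ n ∈ range (2 * (l + 1)), c n * b n l + t (l + 1) l) := fun N l hl =>
    ((ht N).mono (Nat.succ_le_of_lt hl)).unique (ht (l + 1)) l l.lt_succ_self
  refine ⟨fun l => ∑ n ∈ range (2 * (l + 1)), c n * a n l,
    fun l => ∑ n ∈ range (2 * (l + 1)), c n * b n l + t (l + 1) l,
    fun N => (ht N).congr_coeff fun l hl => hcons N l hl, ?_, ?_, ?_⟩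
  · simp [ha0]
  · simp [ha1, div_eq_mul_inv]
  · obtain ⟨C, hC, hCN⟩ := hT 2
    have hm : Measurable fun v => (g v - ∑ n ∈ range 2, c n * v ^ n) / v := by fun_prop
    have hi : IntegrableOn (fun v => (g v - ∑ n ∈ range 2, c n * v ^ n) / v) (Set.Ioo 0 1) := by
      refine Integrable.mono' ((integrableOn_one_div_sqrt_one_sub 0).const_mul C)
        hm.aestronglyMeasurable ?_
      refine (ae_restrict_iff' measurableSet_Ioo).2 (Eventually.of_forall fun v hv => ?_)
      have hv0 := hv.1
      rw [norm_div, Real.norm_eq_abs, Real.norm_of_nonneg hv0.le, div_le_iff₀ hv0]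
      refine (hCN v hv).trans ?_
      rw [mul_assoc, one_div_mul_eq_div, mul_div_assoc]
      gcongr C * (?_ / _)
      nlinarith [hv.2]
    -- The tail at order `1` has `c 0 + c 1 v` subtracted; the missing `c 1` is the contribution of
    -- the moment `n = 1`.
    have h1 : ∫ v in Set.Ioo (0 : ℝ) 1, (g v - c 0) / v
        = (∫ v in Set.Ioo (0 : ℝ) 1, (g v - ∑ n ∈ range 2, c n * v ^ n) / v) + c 1 := by
      have h2 : ∫ v in Set.Ioo (0 : ℝ) 1, c 1 = c 1 := by simp
      rw [← h2, ← integral_add hi (by simp)]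
      refine setIntegral_congr_fun measurableSet_Ioo fun v hv => ?_
      have := hv.1.ne'
      simp only [sum_range_succ, range_zero, sum_empty, zero_add, pow_zero, pow_one]
      field_simp
      ring
    rw [h1]
    simp [sum_range_succ, hb0, ht0]
    ring

end SphericalPendulum

namespace SphericalPendulum

open Filter Asymptotics Topology Finset MeasureTheory

/-! ### The regular part of the third-kind integrals -/

/-- The coefficients of the expansion of `1 / (√(1 - v) (s + √(1 - v)))` in powers of `s - 1`. -/
noncomputable def poleCoeff (k : ℕ) (v : ℝ) : ℝ := (-1) ^ k / (√(1 - v) * (1 + √(1 - v)) ^ (k + 1))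

theorem measurable_poleCoeff (k : ℕ) : Measurable (poleCoeff k) := by
  unfold poleCoeff; fun_prop

theorem analyticAt_poleCoeff (k : ℕ) : AnalyticAt ℝ (poleCoeff k) 0 := by
  have h1 : ContDiffAt ℝ ⊤ (fun y : ℝ => √(1 - y)) 0 :=
    (Real.contDiffAt_sqrt (x := 1 - 0) (by simp)).comp (0 : ℝ) (by fun_prop)
  have h2 := h1.analyticAt
  exact analyticAt_const.div (h2.mul ((analyticAt_const.add h2).pow _)) (by simp)

theorem abs_poleCoeff_le (k : ℕ) {v : ℝ} (hv : v < 1) : |poleCoeff k v| ≤ 1 / √(1 - v) := by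
  have hs : 0 < √(1 - v) := Real.sqrt_pos.2 (by linarith)
  rw [poleCoeff, abs_div, abs_pow, abs_neg, abs_one, one_pow, abs_of_pos (by positivity)]
  gcongr
  exact le_mul_of_one_le_right hs.le (one_le_pow₀ (by linarith))

theorem hasTaylor_poleCoeff_zero : ∃ c, HasTaylor (poleCoeff 0) c ∧ c 0 = 1 / 2 ∧ c 2 = 5 / 16 := by
  have h := hasTaylor_of_analyticAt (φ := poleCoeff 0)
    (φ' := fun y => (1 / (2 * √(1 - y)) + 1) / (√(1 - y) + (1 - y)) ^ 2)
    (d := 5 / 8) (analyticAt_poleCoeff 0) ?_ ?_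
  · obtain ⟨c, h, h0, -, h2⟩ := h
    exact ⟨c, h, by rw [h0]; norm_num [poleCoeff], by rw [h2]; norm_num⟩
  · filter_upwards [gt_mem_nhds (show (0 : ℝ) < 1 by norm_num)] with y hy
    have hs : 0 < √(1 - y) := Real.sqrt_pos.2 (by linarith)
    -- With `u = √(1 - y)` the denominator `u(1 + u)` equals `u + (1 - y)`, whose derivative is
    -- simpler.
    have := ((hasDerivAt_sqrt_one_sub hy).add ((hasDerivAt_id y).const_sub 1)).inv
      (by simp; nlinarith)
    have h2 := this.congr_of_eventuallyEq (f₁ := poleCoeff 0) (by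
      filter_upwards [gt_mem_nhds hy] with z hz
      have h3 := Real.sq_sqrt (show 0 ≤ 1 - z by linarith)
      have h4 : 0 < √(1 - z) := Real.sqrt_pos.2 (by linarith)
      simp only [poleCoeff, Pi.inv_apply, Pi.add_apply, id]
      rw [show √(1 - z) + (1 - z) = √(1 - z) * (1 + √(1 - z)) by nlinarith]
      simp)
    refine h2.congr_deriv ?_
    simp only [Pi.add_apply, id]
    ring
  · have h1 := hasDerivAt_sqrt_one_sub (v := 0) one_pos
    have h2 := ((h1.const_mul 2).inv (by simp)).add_const 1
    have h3 := (h1.add ((hasDerivAt_id (0 : ℝ)).const_sub 1)).pow 2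
    refine hasDerivAt_congr (h2.div h3 (by simp)) (fun y => by simp) ?_
    simp
    norm_num

/-- The substitution `u = √(1 - v)`, `v = (1 - u)(1 + u)`, makes the integrand rational in `u`. -/
theorem integral_poleCoeff_zero :
    ∫ v in Set.Ioo (0 : ℝ) 1, (poleCoeff 0 v - 1 / 2) / v = Real.log 2 + 1 / 2 := by
  have hd : ∀ v ∈ Set.Ioo (0 : ℝ) 1, HasDerivAt
      (fun v => -(Real.log (1 + √(1 - v)) - (1 + √(1 - v))⁻¹)) ((poleCoeff 0 v - 1 / 2) / v) v := by
    intro v hv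
    have hs : 0 < √(1 - v) := Real.sqrt_pos.2 (by linarith [hv.2])
    have h1 := (hasDerivAt_sqrt_one_sub hv.2).const_add 1
    have h2 := ((h1.log (by positivity)).sub (h1.inv (by positivity))).neg
    refine h2.congr_deriv ?_
    have h3 := Real.sq_sqrt (show 0 ≤ 1 - v by linarith [hv.2])
    have hv0 := hv.1.ne'
    simp only [poleCoeff]
    generalize √(1 - v) = u at hs h3
    obtain rfl : v = 1 - u ^ 2 := by linarith
    have h4 : 1 - u ≠ 0 := by
      intro h; apply hv0; rw [show u = 1 by linarith]; norm_num
    rw [show 1 - u ^ 2 = (1 - u) * (1 + u) by ring]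
    field_simp
    ring
  have hc : ContinuousOn (fun v => -(Real.log (1 + √(1 - v)) - (1 + √(1 - v))⁻¹))
      (Set.Icc (0 : ℝ) 1) := by
    have h0 : ∀ v ∈ Set.Icc (0 : ℝ) 1, 1 + √(1 - v) ≠ 0 := fun v _ => by positivity
    exact ((ContinuousOn.log (by fun_prop) h0).sub (ContinuousOn.inv₀ (by fun_prop) h0)).neg
  rw [setIntegral_Ioo_of_hasDerivAt zero_le_one hc hd
    (integrableOn_Ioo_of_hasDerivAt_of_nonneg hc hd fun v hv => ?_)]
  · norm_num
    ring
  · have hs : 0 < √(1 - v) := Real.sqrt_pos.2 (by linarith [hv.2])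
    have hs1 : √(1 - v) ≤ 1 := Real.sqrt_le_one.2 (by linarith [hv.1])
    refine div_nonneg (sub_nonneg.2 ?_) hv.1.le
    rw [poleCoeff, pow_zero, zero_add, pow_one]
    gcongr
    nlinarith

theorem integral_poleCoeff_one :
    ∫ v in Set.Ioo (0 : ℝ) 1, (poleCoeff 1 v - -1 / 4) / v = -Real.log 2 / 2 - 5 / 8 := by
  -- The integrand is nonpositive, so its negative is used to obtain integrability from the sign.
  have hd : ∀ v ∈ Set.Ioo (0 : ℝ) 1, HasDerivAt
      (fun v => -1 / 2 * (Real.log (1 + √(1 - v)) - (1 + √(1 - v))⁻¹ - ((1 + √(1 - v)) ^ 2)⁻¹))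
      (-((poleCoeff 1 v - -1 / 4) / v)) v := by
    intro v hv
    have hs : 0 < √(1 - v) := Real.sqrt_pos.2 (by linarith [hv.2])
    have h1 := (hasDerivAt_sqrt_one_sub hv.2).const_add 1
    have h2 := (((h1.log (by positivity)).sub (h1.inv (by positivity))).sub
      ((h1.pow 2).inv (by simp; positivity))).const_mul (-1 / 2)
    refine h2.congr_deriv ?_
    have h3 := Real.sq_sqrt (show 0 ≤ 1 - v by linarith [hv.2])
    have hv0 := hv.1.ne'
    simp only [poleCoeff, Pi.pow_apply]
    generalize √(1 - v) = u at hs h3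
    obtain rfl : v = 1 - u ^ 2 := by linarith
    have h4 : 1 - u ≠ 0 := by
      intro h; apply hv0; rw [show u = 1 by linarith]; norm_num
    rw [show 1 - u ^ 2 = (1 - u) * (1 + u) by ring]
    field_simp
    ring
  have hc : ContinuousOn
      (fun v => -1 / 2 * (Real.log (1 + √(1 - v)) - (1 + √(1 - v))⁻¹ - ((1 + √(1 - v)) ^ 2)⁻¹))
      (Set.Icc (0 : ℝ) 1) := by
    have h0 : ∀ v ∈ Set.Icc (0 : ℝ) 1, 1 + √(1 - v) ≠ 0 := fun v _ => by positivity
    have h1 : ∀ v ∈ Set.Icc (0 : ℝ) 1, (1 + √(1 - v)) ^ 2 ≠ 0 := fun v _ => by positivity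
    exact continuousOn_const.mul (((ContinuousOn.log (by fun_prop) h0).sub
      (ContinuousOn.inv₀ (by fun_prop) h0)).sub (ContinuousOn.inv₀ (by fun_prop) h1))
  have h := setIntegral_Ioo_of_hasDerivAt zero_le_one hc hd
    (integrableOn_Ioo_of_hasDerivAt_of_nonneg hc hd fun v hv => ?_)
  · rw [integral_neg] at h
    norm_num at h ⊢
    linarith
  · have hs : 0 < √(1 - v) := Real.sqrt_pos.2 (by linarith [hv.2])
    have hs1 : √(1 - v) ≤ 1 := Real.sqrt_le_one.2 (by linarith [hv.1])
    rw [neg_nonneg]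
    refine div_nonpos_of_nonpos_of_nonneg ?_ hv.1.le
    rw [poleCoeff, sub_nonpos, pow_one, one_add_one_eq_two, div_le_div_iff₀ (by positivity)
        (by norm_num)]
    nlinarith [mul_le_mul hs1 (show (1 + √(1 - v)) ^ 2 ≤ 4 by nlinarith) (by positivity)
        zero_le_one]

theorem exists_isLogSum_poleCoeff (k : ℕ) : ∃ a b : ℕ → ℝ,
    (∀ N, IsLogSum N (kernelIntegral (poleCoeff k)) a b) ∧ a 0 = (-1) ^ k / 2 ^ (k + 1) ∧
    (k = 0 → a 1 = 5 / 32 ∧ b 0 = 3 / 2 * Real.log 2 + 1 / 2) ∧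
    (k = 1 → b 0 = -(3 / 4) * Real.log 2 - 5 / 8) := by
  have hT : ∀ c, HasTaylor (poleCoeff k) c → HasTaylorOn (poleCoeff k) c := fun c hc =>
    hc.hasTaylorOn (measurable_poleCoeff k) zero_le_one fun v hv => abs_poleCoeff_le k hv.2
  rcases eq_or_ne k 0 with rfl | hk
  · obtain ⟨c, hc, h0, h2⟩ := hasTaylor_poleCoeff_zero
    obtain ⟨a, b, h, ha0, ha1, hb0⟩ := (hT c hc).exists_isLogSum
    refine ⟨a, b, h, by rw [ha0, h0]; norm_num, fun _ => ⟨by rw [ha1, h2]; norm_num, ?_⟩, by simp⟩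
    rw [hb0, h0, integral_poleCoeff_zero]
    ring
  · obtain ⟨c, hc, h0⟩ := HasTaylor.of_analyticAt (analyticAt_poleCoeff k)
    obtain ⟨a, b, h, ha0, ha1, hb0⟩ := (hT c hc).exists_isLogSum
    have h0' : c 0 = (-1) ^ k / 2 ^ (k + 1) := by
      rw [h0, poleCoeff]; norm_num
    refine ⟨a, b, h, by rw [ha0, h0'], by simp [hk], ?_⟩
    rintro rfl
    rw [hb0, h0', show ((-1 : ℝ) ^ 1 / 2 ^ (1 + 1)) = -1 / 4 by norm_num, integral_poleCoeff_one]
    ring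

/-- The regular part of the integral with a pole at `1 - s²`. -/
noncomputable def poleIntegral (s r : ℝ) : ℝ :=
  kernelIntegral (fun v => 1 / (√(1 - v) * (s + √(1 - v)))) r

theorem abs_poleIntegral_sub_le {s r : ℝ} (hs : 1 / 2 ≤ s) (hr : 0 < r) (hr2 : r ≤ 1 / 2) (N : ℕ) :
    |poleIntegral s r - ∑ k ∈ range N, (s - 1) ^ k * kernelIntegral (poleCoeff k) r|
      ≤ 24 * |s - 1| ^ N * Real.log (1 / r) := by
  -- The exact remainder of the geometric series in `(1 - s)/(1 + √(1 - v))`. For `s ≥ 1/2` it is at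
  -- most `2|s - 1|^N / √(1 - v)`, whence the constant `24 = 12 · 2`.
  set E : ℝ → ℝ := fun v => (1 - s) ^ N / (√(1 - v) * (1 + √(1 - v)) ^ N * (s + √(1 - v))) with hE
  have hEm : Measurable E := by fun_prop
  have hs0 : 0 < s := by linarith
  have hEb : ∀ v ∈ Set.Ioo r 1, |E v| ≤ 2 * |s - 1| ^ N / √(1 - v) := by
    intro v hv
    have hu : 0 < √(1 - v) := Real.sqrt_pos.2 (by linarith [hv.2])
    rw [hE]
    simp only
    rw [abs_div, abs_pow, abs_sub_comm,
      abs_of_pos (by positivity : 0 < √(1 - v) * (1 + √(1 - v)) ^ N * (s + √(1 - v)))]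
    rw [div_le_div_iff₀ (by positivity) hu]
    have h1 : 1 ≤ (1 + √(1 - v)) ^ N := one_le_pow₀ (by linarith)
    have h2 : 1 / 2 ≤ (1 + √(1 - v)) ^ N * (s + √(1 - v)) := by nlinarith
    calc |s - 1| ^ N * √(1 - v) = 2 * |s - 1| ^ N * (√(1 - v) * (1 / 2)) := by ring
      _ ≤ 2 * |s - 1| ^ N * (√(1 - v) * ((1 + √(1 - v)) ^ N * (s + √(1 - v)))) := by gcongr
      _ = _ := by ring
  have hsplit : ∀ v ∈ Set.Ioo r 1, 1 / (√(1 - v) * (s + √(1 - v))) / √(v ^ 2 - r ^ 2)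
      = ∑ k ∈ range N, (s - 1) ^ k * (poleCoeff k v / √(v ^ 2 - r ^ 2))
        + E v / √(v ^ 2 - r ^ 2) := by
    intro v hv
    have hu : 0 < √(1 - v) := Real.sqrt_pos.2 (by linarith [hv.2])
    have hsu : 0 < s + √(1 - v) := by linarith
    have h1 : 1 / (√(1 - v) * (s + √(1 - v)))
        = ∑ k ∈ range N, (s - 1) ^ k * poleCoeff k v + E v := by
      rw [hE]
      clear hEb hEm hE E
      induction N with
      | zero => simp
      | succ n ih =>
        rw [sum_range_succ, ih]
        simp only [poleCoeff]
        rw [add_assoc]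
        congr 1
        rw [← neg_sub s 1, neg_pow, neg_pow (s - 1) (n + 1)]
        field_simp
        ring
    rw [h1, add_div, sum_div]
    simp only [mul_div_assoc]
  have hi : ∀ k, IntegrableOn (fun v => poleCoeff k v / √(v ^ 2 - r ^ 2)) (Set.Ioo r 1) := fun k =>
    integrableOn_kernel (measurable_poleCoeff k) hr hr2 fun v hv => abs_poleCoeff_le k hv.2
  have hI : poleIntegral s r = ∑ k ∈ range N, (s - 1) ^ k * kernelIntegral (poleCoeff k) r
      + kernelIntegral E r := by
    unfold poleIntegral kernelIntegral
    rw [setIntegral_congr_fun measurableSet_Ioo hsplit, integral_add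
      (integrable_finsetSum _ fun k _ => (hi k).const_mul _) (integrableOn_kernel hEm hr hr2 hEb),
      integral_finsetSum _ fun k _ => (hi k).const_mul _]
    simp only [integral_const_mul]
  rw [hI, add_sub_cancel_left]
  exact (abs_kernelIntegral_le hEm hr hr2 (by positivity) hEb).trans (le_of_eq (by ring))

section

variable {r₂ q l₀ l₁ : PlaneFun}

theorem eventually_sqrt_small (hr : HasExp polyForms r₂ (fun _ => 0) (fun _ => 0) q) :
    ∀ᶠ x in nearZero, √(r₂ x) ≤ 1 / 2 := by
  filter_upwards [hr.tendsto.eventually (gt_mem_nhds (show (0 : ℝ) < 1 / 4 by norm_num))] with x hx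
  exact Real.sqrt_le_iff.2 ⟨by norm_num, by linarith⟩

/-- Substitution of `r = √r₂` in an expansion in powers of `r²` and `ln(1/r)`. -/
theorem HasLogExp.of_isLogSum (hr : HasExp polyForms r₂ (fun _ => 0) (fun _ => 0) q)
    (hpos : ∀ᶠ x in nearZero, 0 < r₂ x)
    (hl : HasLogExp (fun x => Real.log (1 / √(r₂ x))) (fun _ => 1) (fun _ => 0) (fun _ => 0) l₀ l₁)
    {f : ℝ → ℝ} {a b : ℕ → ℝ} (hf : ∀ N, IsLogSum N f a b) :
    HasLogExp (fun x => f √(r₂ x)) (fun _ => a 0) (fun _ => 0) (fun x => a 1 * q x)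
      (fun x => a 0 * l₀ x + b 0) (fun x => a 0 * l₁ x) := by
  have ht : Tendsto (fun x => √(r₂ x)) nearZero (𝓝[>] 0) := by
    refine tendsto_nhdsWithin_iff.2 ⟨?_, hpos.mono fun x hx => Real.sqrt_pos.2 hx⟩
    simpa [Function.comp_def] using (Real.continuous_sqrt.tendsto 0).comp hr.tendsto
  have hF : ∀ k, HasLogExp (fun x => a k * Real.log (1 / √(r₂ x)) + b k) (fun _ => a k)
      (fun _ => 0) (fun _ => 0) (fun x => a k * l₀ x + b k) (fun x => a k * l₁ x) := fun k =>
    ((hl.const_mul (a k)).add (HasExp.const (b k)).toLog).congr_coeff (fun x => by ring)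
      (fun x => by ring) (fun x => by ring) (fun x => by ring) (fun x => by ring)
  refine (HasLogExp.of_sum hr hF fun K => ?_).congr_coeff (fun x => rfl) (fun x => by ring)
    (fun x => by ring) (fun x => rfl) (fun x => by ring)
  have h1 := (hf K).comp_tendsto ht
  have h2 : (fun x => r₂ x ^ K * Real.log (1 / √(r₂ x)))
      =O[nearZero] fun x => rhoFun x ^ K * logFun x := by
    refine IsBigO.mul ?_ hl.isBigO
    refine (hr.isBigO_rho_sq.trans ?_).pow K
    simpa using rhoFun_pow_isBigO one_le_two
  refine IsBigO.trans (h1.congr' ?_ ?_) h2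
  · filter_upwards [hpos] with x hx
    simp only [Function.comp, pow_mul, Real.sq_sqrt hx.le]
  · filter_upwards [hpos] with x hx
    simp only [Function.comp, pow_mul, Real.sq_sqrt hx.le]

theorem HasLogExp.poleIntegral {y y₁ y₂ : PlaneFun} (hy : HasExp polyForms y (fun _ => 0) y₁ y₂)
    (hr : HasExp polyForms r₂ (fun _ => 0) (fun _ => 0) q) (hpos : ∀ᶠ x in nearZero, 0 < r₂ x)
    (hl : HasLogExp (fun x => Real.log (1 / √(r₂ x))) (fun _ => 1) (fun _ => 0) (fun _ => 0)
      (fun _ => -3 * Real.log 2) l₁) :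
    HasLogExp (fun x => poleIntegral (1 + y x) √(r₂ x)) (fun _ => 1 / 2) (fun x => -y₁ x / 4)
      (fun x => 5 / 32 * q x - y₂ x / 4 + y₁ x ^ 2 / 8) (fun _ => 1 / 2)
      (fun x => l₁ x / 2 - 5 / 8 * y₁ x) := by
  -- In both rational coefficients the `ln 2` of the integrals cancels the one in the hypothesis:
  -- `-(3/2) ln 2 + (3/2) ln 2` for `k = 0` and `(3/4) ln 2 - (3/4) ln 2` for `k = 1`. This is what
  -- singles out `32` in `ln(32/ϱ)`.
  choose a b hab ha0 h0 h1 using exists_isLogSum_poleCoeff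
  refine (HasLogExp.of_sum hy (fun k => HasLogExp.of_isLogSum hr hpos hl (hab k)) fun K =>
      ?_).congr_coeff
    (fun x => by rw [ha0]; norm_num) (fun x => by rw [ha0]; norm_num; ring)
    (fun x => by rw [(h0 0 rfl).1, ha0, ha0]; ring)
    (fun x => by rw [(h0 0 rfl).2, ha0]; ring)
    (fun x => by rw [h1 1 rfl, ha0, ha0]; ring)
  refine (IsBigO.of_bound 24 ?_).trans ((hy.isBigO_rho.pow K).mul hl.isBigO)
  filter_upwards [hpos, eventually_sqrt_small hr,
    hy.tendsto.eventually (lt_mem_nhds (show (-1 / 2 : ℝ) < 0 by norm_num))] with x hx1 hx2 hx3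
  have h := abs_poleIntegral_sub_le (s := 1 + y x) (by linarith) (Real.sqrt_pos.2 hx1) hx2 K
  rw [add_sub_cancel_left] at h
  rw [Real.norm_eq_abs, norm_mul, norm_pow, Real.norm_eq_abs, ← mul_assoc]
  exact h.trans (mul_le_mul_of_nonneg_left (le_abs_self _) (by positivity))

end

end SphericalPendulum

namespace SphericalPendulum

open Filter Asymptotics Topology Finset

/-! ### The outer root of the cubic -/

/-- Decomposing the first argument along the two basis vectors reduces the arity by one and extracts
a factor `h` or `j`. -/
theorem multilinear_diag_mem_polyForms (n : ℕ)
    (m : MultilinearMap ℝ (fun _ : Fin n => ℝ × ℝ) ℝ) :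
    (fun x : ℝ × ℝ => m fun _ => x) ∈ polyForms n := by
  induction n with
  | zero =>
    refine ⟨MvPolynomial.C (m 0), MvPolynomial.isHomogeneous_C _ _, fun x => ?_⟩
    simp only [evalHJ, MvPolynomial.eval_C]
    congr 1
    exact Subsingleton.elim _ _
  | succ n ih =>
    have h1 : (fun x : ℝ × ℝ => x.1) ∈ polyForms 1 :=
      ⟨MvPolynomial.X 0, MvPolynomial.isHomogeneous_X _ _, fun x => by simp [evalHJ]⟩
    have h2 : (fun x : ℝ × ℝ => x.2) ∈ polyForms 1 :=
      ⟨MvPolynomial.X 1, MvPolynomial.isHomogeneous_X _ _, fun x => by simp [evalHJ]⟩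
    have key : (fun x : ℝ × ℝ => m fun _ => x)
        = (fun x : ℝ × ℝ => m.curryLeft (1, 0) fun _ => x) * (fun x : ℝ × ℝ => x.1)
          + (fun x : ℝ × ℝ => m.curryLeft (0, 1) fun _ => x) * fun x : ℝ × ℝ => x.2 := by
      funext x
      have hx : x = x.1 • ((1, 0) : ℝ × ℝ) + x.2 • ((0, 1) : ℝ × ℝ) := by ext <;> simp
      have h3 : (m fun _ => x) = m.curryLeft x fun _ => x := by
        rw [MultilinearMap.curryLeft_apply]
        congr 1
        funext i
        refine Fin.cases ?_ (fun i => ?_) i <;> simp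
      rw [h3]
      conv_lhs => rw [hx, map_add, map_smul, map_smul]
      rw [← hx]
      simp [mul_comm]
    rw [key]
    exact Submodule.add_mem _ (SetLike.GradedMul.mul_mem (ih _) h1)
      (SetLike.GradedMul.mul_mem (ih _) h2)

/-- The norm on the product is the maximum norm, which is bounded by `ϱ`; so a convergent power
series is an expansion in this sense. -/
theorem HasExp.of_analyticAt {f : PlaneFun} (hf : AnalyticAt ℝ f 0) :
    ∃ f₁ f₂, HasExp polyForms f (fun _ => f 0) f₁ f₂ := by
  obtain ⟨p, hp⟩ := hf
  refine ⟨_, _, PowerSeries.mk fun n => fun x => p n fun _ => x, fun n => ?_, ?_, rfl, rfl,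
    fun N => ?_⟩
  · rw [PowerSeries.coeff_mk]
    exact multilinear_diag_mem_polyForms n (p n).toMultilinearMap
  · rw [PowerSeries.coeff_mk]
    funext x
    exact hp.coeff_zero _
  · have h1 := (hp.isBigO_sub_partialSum_pow N).mono (nhdsWithin_le_nhds (s := {x | x.2 ≠ 0}))
    simp only [zero_add] at h1
    refine (h1.congr_left fun x => ?_).trans ?_
    · simp [FormalMultilinearSeries.partialSum]
    · refine IsBigO.of_bound 1 (Eventually.of_forall fun x => ?_)
      rw [Real.norm_of_nonneg (by positivity), pow_zero, mul_one, one_mul,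
        Real.norm_of_nonneg (pow_nonneg (rhoFun_nonneg x) _)]
      refine pow_le_pow_left₀ (norm_nonneg _) ?_ _
      exact max_le (abs_fst_le_rhoFun x) (abs_snd_le_rhoFun x)

theorem exists_analytic_root : ∃ D : ℝ × ℝ → ℝ, AnalyticAt ℝ D 0 ∧ D 0 = 0 ∧
    ∀ᶠ x in 𝓝 (0 : ℝ × ℝ), 2 * (2 - D x) * D x * (2 + x.1 - D x) = x.2 ^ 2 := by
  set f : (ℝ × ℝ) × ℝ → ℝ := fun y => 2 * (2 - y.2) * y.2 * (2 + y.1.1 - y.2) - y.1.2 ^ 2 with hf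
  have hc : ContDiff ℝ ⊤ f := by fun_prop
  have hcd : ContDiffAt ℝ ⊤ f 0 := hc.contDiffAt
  -- At `(h, j) = 0` the equation reads `2δ(2 - δ)² = 0`, with derivative `8 ≠ 0` at `δ = 0`: the
  -- implicit function theorem applies.
  have hd : HasDerivAt (fun y : ℝ => f (0, y)) 8 0 := by
    have h1 := ((((hasDerivAt_id (0 : ℝ)).const_sub 2).const_mul 2).mul
      (hasDerivAt_id (0 : ℝ))).mul ((hasDerivAt_id (0 : ℝ)).const_sub 2)
    exact hasDerivAt_congr h1 (fun y => by simp [hf]) (by norm_num)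
  have hinv : (fderiv ℝ f 0 ∘L .inr ℝ (ℝ × ℝ) ℝ).IsInvertible := by
    refine ⟨ContinuousLinearEquiv.unitsEquivAut ℝ (Units.mk0 8 (by norm_num)), ?_⟩
    have h2 : HasFDerivAt (fun y : ℝ => f (0, y)) (fderiv ℝ f 0 ∘L .inr ℝ (ℝ × ℝ) ℝ) 0 := by
      have h3 : HasFDerivAt f (fderiv ℝ f 0) (ContinuousLinearMap.inr ℝ (ℝ × ℝ) ℝ 0) := by
        rw [map_zero]
        exact (hc.differentiable (by simp)).differentiableAt.hasFDerivAt
      exact h3.comp (0 : ℝ) (ContinuousLinearMap.inr ℝ (ℝ × ℝ) ℝ).hasFDerivAt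
    rw [h2.unique hd.hasFDerivAt]
    ext
    simp
  have h1 := hcd.contDiffAt_implicitFunction (by simp) hinv
  have h2 := hcd.implicitFunction_apply_self (by simp) hinv
  have h3 := hcd.eventually_apply_implicitFunction (by simp) hinv
  refine ⟨_, h1.analyticAt, h2, h3.mono fun x hx => ?_⟩
  simp only [hf, Prod.snd_zero, Prod.fst_zero] at hx
  linarith

/-- `2 - δ` is the root of the cubic near the stable equilibrium, and `δ = j² d`. -/
theorem exists_outer_root : ∃ d : PlaneFun,
    HasExp polyForms d (fun _ => 1 / 8) (fun x => -x.1 / 16)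
      (fun x => x.2 ^ 2 / 64 + x.1 ^ 2 / 32) ∧
    ∀ᶠ x in nearZero, 0 < d x ∧
      2 * (2 - x.2 ^ 2 * d x) * (2 + x.1 - x.2 ^ 2 * d x) * d x = 1 := by
  obtain ⟨D, hD, hD0, heq⟩ := exists_analytic_root
  have heq' := heq.filter_mono (nhdsWithin_le_nhds (s := {x : ℝ × ℝ | x.2 ≠ 0}))
  -- This is `1 / (2(2 - D)(2 + h - D))`, so that the root equation becomes `D = j² d`.
  set d : PlaneFun := fun x => 1 / 8 * ((1 + D x * (-1 / 2))⁻¹ * (1 + (x.1 - D x) * (1 / 2))⁻¹)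
    with hd
  have hsmall : ∀ᶠ x in nearZero, |D x| < 1 ∧ |x.1| < 1 := by
    have h1 : Tendsto D (𝓝 0) (𝓝 0) := by simpa [hD0] using hD.continuousAt.tendsto
    have h2 := h1.eventually (Metric.ball_mem_nhds 0 one_pos)
    have h3 := (continuous_fst.tendsto (0 : ℝ × ℝ)).eventually (Metric.ball_mem_nhds _ one_pos)
    filter_upwards [h2.filter_mono nhdsWithin_le_nhds, h3.filter_mono nhdsWithin_le_nhds] with x a b
    exact ⟨by simpa using a, by simpa using b⟩
  have hDd : ∀ᶠ x in nearZero, 0 < d x ∧ D x = x.2 ^ 2 * d x := by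
    filter_upwards [hsmall, heq'] with x hx h
    have h1 := abs_lt.1 hx.1
    have h2 := abs_lt.1 hx.2
    have h3 : 0 < 1 + D x * (-1 / 2) := by linarith
    have h4 : 0 < 1 + (x.1 - D x) * (1 / 2) := by linarith
    refine ⟨by rw [hd]; positivity, ?_⟩
    have h5 : 2 - D x ≠ 0 := by linarith
    have h6 : 2 + x.1 - D x ≠ 0 := by linarith
    rw [hd, ← h]
    simp only
    rw [show 1 + D x * (-1 / 2) = (2 - D x) / 2 by ring,
      show 1 + (x.1 - D x) * (1 / 2) = (2 + x.1 - D x) / 2 by ring]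
    field_simp
    norm_num
  obtain ⟨f₁, f₂, hDe⟩ := HasExp.of_analyticAt hD
  rw [hD0] at hDe
  have hexp : ∀ {D₁ D₂ : PlaneFun}, HasExp polyForms D (fun _ => 0) D₁ D₂ →
      HasExp polyForms d (fun _ => 1 / 8) (fun x => D₁ x / 8 - x.1 / 16)
        (fun x => 1 / 8 * ((-1 / 2 * D₁ x) ^ 2 + 1 / 2 * D₂ x + (1 / 2 * D₁ x)
          * -(1 / 2 * (x.1 - D₁ x)) + ((1 / 2 * (x.1 - D₁ x)) ^ 2 + 1 / 2 * D₂ x))) := by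
    intro D₁ D₂ h
    have ha := ((h.const_mul (-1 / 2)).congr_coeff (f₀' := fun _ => 0) (fun x => by ring)
      (fun x => rfl) (fun x => rfl)).inv_one_add
    have hb := (((HasExp.fst.sub h).const_mul (1 / 2)).congr_coeff (f₀' := fun _ => 0)
      (fun x => by ring) (fun x => rfl) (fun x => rfl)).inv_one_add
    refine ((ha.mul hb).const_mul (1 / 8)).congr (Eventually.of_forall fun x => ?_)
      (fun x => by ring) (fun x => by ring) (fun x => by ring)
    rw [hd]
    simp only
    ring_nf
  have hj2 := HasExp.snd.mul HasExp.snd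
  -- Bootstrap: with the unknown first coefficients of `D`, the relation `D = j² d` already
  -- determines them as `0` and `j²/8`. Feeding these back into `hexp` gives the coefficients of
  -- `d`.
  have h1 := (hj2.mul (hexp hDe)).congr (f' := D) (f₀' := fun _ => 0) (f₁' := fun _ => 0)
    (f₂' := fun x => x.2 ^ 2 / 8)
    (hDd.mono fun x hx => by simp only [hx.2]; ring) (fun x => by ring) (fun x => by ring)
    (fun x => by ring)
  refine ⟨d, (hexp h1).congr_coeff (fun x => rfl) (fun x => by ring) (fun x => by ring), ?_⟩
  filter_upwards [hDd, heq', eventually_snd_ne] with x hx h hj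
  refine ⟨hx.1, ?_⟩
  rw [hx.2] at h
  have : x.2 ^ 2 * (2 * (2 - x.2 ^ 2 * d x) * (2 + x.1 - x.2 ^ 2 * d x) * d x) = x.2 ^ 2 * 1 := by
    linarith
  exact mul_left_cancel₀ (by positivity) this

end SphericalPendulum

namespace SphericalPendulum

open Filter Topology Finset MeasureTheory

/-! ### The rotation number as a sum of two integrals of the third kind -/

/-- The argument is the imaginary part of the logarithm, and `k² = r² - p²` makes the squared
modulus of the path a perfect square, `r²(v - p)²`. -/
theorem hasDerivAt_arg_path {r p k v : ℝ} (hk : 0 < k) (hk2 : k ^ 2 = r ^ 2 - p ^ 2)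
    (hr : 0 < r) (hv : r < v) :
    HasDerivAt (fun v : ℝ => Complex.arg (⟨r ^ 2 - p * v, k * √(v ^ 2 - r ^ 2)⟩ : ℂ))
      (k / ((v - p) * √(v ^ 2 - r ^ 2))) v := by
  have h0 := sq_sub_sq_pos hr.le hv
  have hs := Real.sqrt_pos.2 h0
  have hs2 := Real.sq_sqrt h0.le
  have hpr : |p| < r := abs_lt_of_sq_lt_sq (by nlinarith) hr.le
  have hvp : 0 < v - p := by have := (abs_lt.1 hpr).2; linarith
  have h1 : HasDerivAt (fun v : ℝ => r ^ 2 - p * v) (-p) v := by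
    simpa using ((hasDerivAt_id v).const_mul p).const_sub (r ^ 2)
  have h2 := (hasDerivAt_sqrt_sq_sub h0).const_mul k
  have h3 := (h1.ofReal_comp.add ((h2.ofReal_comp).mul_const Complex.I)).clog_real
    (Or.inr (by
      simp only [Pi.add_apply, Complex.add_im, Complex.ofReal_re, Complex.ofReal_im,
        Complex.mul_im, Complex.I_re, Complex.I_im, mul_zero, mul_one, add_zero, zero_add]
      positivity))
  have h4 := Complex.imCLM.hasFDerivAt.comp_hasDerivAt v h3
  refine (h4.congr_of_eventuallyEq (Eventually.of_forall fun y => ?_)).congr_deriv ?_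
  · simp only [Function.comp, Complex.imCLM_apply, Complex.log_im, Pi.add_apply]
    rw [Complex.mk_eq_add_mul_I]
  · rw [Complex.imCLM_apply, Complex.div_im]
    simp only [Complex.normSq_apply, Pi.add_apply, Complex.add_re, Complex.add_im,
        Complex.ofReal_re, Complex.ofReal_im,
      Complex.mul_re, Complex.mul_im, Complex.I_re, Complex.I_im, mul_zero, mul_one,
      sub_zero, add_zero, zero_add]
    generalize √(v ^ 2 - r ^ 2) = w at hs hs2
    have h5 : (r ^ 2 - p * v) * (r ^ 2 - p * v) + k * w * (k * w) = r ^ 2 * (v - p) ^ 2 := by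
      linear_combination w ^ 2 * hk2 + (r ^ 2 - p ^ 2) * hs2
    rw [h5]
    field_simp
    linear_combination p * hs2

theorem continuousOn_arg_path {r p k : ℝ} (hk : 0 < k) (hr : 0 < r) (hpr : p < r) :
    ContinuousOn (fun v : ℝ => Complex.arg (⟨r ^ 2 - p * v, k * √(v ^ 2 - r ^ 2)⟩ : ℂ))
      (Set.Icc r 1) := by
  have hc : Continuous fun v : ℝ => (⟨r ^ 2 - p * v, k * √(v ^ 2 - r ^ 2)⟩ : ℂ) := by
    have : (fun v : ℝ => (⟨r ^ 2 - p * v, k * √(v ^ 2 - r ^ 2)⟩ : ℂ))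
        = fun v : ℝ => ((r ^ 2 - p * v : ℝ) : ℂ) + ((k * √(v ^ 2 - r ^ 2) : ℝ) : ℂ) * Complex.I :=
            by
      funext v; rw [Complex.mk_eq_add_mul_I]
    rw [this]
    fun_prop
  intro v hv
  refine (ContinuousAt.comp (f := fun v : ℝ => (⟨r ^ 2 - p * v, k * √(v ^ 2 - r ^ 2)⟩ : ℂ))
    (Complex.continuousAt_arg ?_) hc.continuousAt).continuousWithinAt
  rcases hv.1.eq_or_lt with rfl | h
  · left; simp only; nlinarith
  · right
    exact (mul_pos hk (Real.sqrt_pos.2 (sq_sub_sq_pos hr.le h))).ne'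

/-- The integrand of the integral of the third kind with pole at `p`. -/
noncomputable def thirdKind (p r v : ℝ) : ℝ :=
  √(r ^ 2 - p ^ 2) * √(1 - p) / ((v - p) * (√(1 - v) * √(v ^ 2 - r ^ 2)))

theorem thirdKind_integral {p r : ℝ} (hr : 0 < r) (hr2 : r ≤ 1 / 2) (hp : p ^ 2 < r ^ 2) :
    IntegrableOn (thirdKind p r) (Set.Ioo r 1) ∧
    ∫ v in Set.Ioo r 1, thirdKind p r v
      = Complex.arg (⟨r ^ 2 - p, √(r ^ 2 - p ^ 2) * √(1 - r ^ 2)⟩ : ℂ)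
        + √(r ^ 2 - p ^ 2) * poleIntegral √(1 - p) r := by
  have hpr := abs_lt.1 (abs_lt_of_sq_lt_sq hp hr.le)
  have hk : 0 < √(r ^ 2 - p ^ 2) := Real.sqrt_pos.2 (by linarith)
  have hk2 := Real.sq_sqrt (show 0 ≤ r ^ 2 - p ^ 2 by linarith)
  have hs0 : 0 < √(1 - p) := Real.sqrt_pos.2 (by linarith)
  have hs2 := Real.sq_sqrt (show 0 ≤ 1 - p by linarith)
  set k := √(r ^ 2 - p ^ 2) with hkdef
  set s := √(1 - p) with hsdef
  have hd := fun v (hv : v ∈ Set.Ioo r 1) => hasDerivAt_arg_path hk hk2 hr hv.1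
  have hc := continuousOn_arg_path hk hr hpr.2
  have hi1 := integrableOn_Ioo_of_hasDerivAt_of_nonneg hc hd fun v hv => by
    have : 0 < v - p := by linarith [hv.1]
    positivity
  have hI1 := setIntegral_Ioo_of_hasDerivAt (by linarith) hc hd hi1
  have hi2 : IntegrableOn (fun v => 1 / (√(1 - v) * (s + √(1 - v))) / √(v ^ 2 - r ^ 2))
      (Set.Ioo r 1) := by
    refine integrableOn_kernel (C := 1 / s) (by fun_prop) hr hr2 fun v hv => ?_
    have hu : 0 < √(1 - v) := Real.sqrt_pos.2 (by linarith [hv.2])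
    rw [abs_of_pos (by positivity), div_div]
    gcongr 1 / ?_
    nlinarith
  -- With `u = √(1 - v)` one has `s² - u² = v - p`, so `s/(u(v - p)) - 1/(v - p) = 1/(u(s + u))` has
  -- no pole at `v = p`.
  have hsplit : ∀ v ∈ Set.Ioo r 1, k / ((v - p) * √(v ^ 2 - r ^ 2))
      + k * (1 / (√(1 - v) * (s + √(1 - v))) / √(v ^ 2 - r ^ 2)) = thirdKind p r v := by
    intro v hv
    have hu : 0 < √(1 - v) := Real.sqrt_pos.2 (by linarith [hv.2])
    have hu2 := Real.sq_sqrt (show 0 ≤ 1 - v by linarith [hv.2])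
    have hw : 0 < √(v ^ 2 - r ^ 2) := Real.sqrt_pos.2 (sq_sub_sq_pos hr.le hv.1)
    have hvp : 0 < v - p := by linarith [hv.1]
    rw [thirdKind, ← hkdef, ← hsdef]
    field_simp
    linear_combination -hs2 + hu2
  have hi2' := hi2.const_mul k
  refine ⟨(Integrable.add hi1 hi2').congr ((ae_restrict_iff' measurableSet_Ioo).2
    (Eventually.of_forall hsplit)), ?_⟩
  rw [← setIntegral_congr_fun measurableSet_Ioo hsplit, integral_add hi1 hi2', hI1,
    integral_const_mul]
  have harg : Complex.arg (⟨r ^ 2 - p * r, 0⟩ : ℂ) = 0 := by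
    have h1 : (⟨r ^ 2 - p * r, 0⟩ : ℂ) = ((r ^ 2 - p * r : ℝ) : ℂ) := rfl
    rw [h1, Complex.arg_ofReal_of_nonneg (by nlinarith)]
  simp only [sub_self, Real.sqrt_zero, mul_zero, mul_one, one_pow, harg, sub_zero]
  rfl

/-- The value of the integral of the third kind with pole at `p`. -/
noncomputable def thirdKindValue (p r : ℝ) : ℝ :=
  Complex.arg (⟨r ^ 2 - p, √(r ^ 2 - p ^ 2) * √(1 - r ^ 2)⟩ : ℂ)
    + √(r ^ 2 - p ^ 2) * poleIntegral √(1 - p) r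

/-- If the cubic `P` factors as `2m³(1-v)(v²-r²)` in the variable `v` with `1-ζ = m(v-p₁)` and
`1-ζ+h = m(v-p₂)`, the rotation number is a sum of two integrals of the third kind. -/
theorem two_pi_mul_rotationNumber {h j m r p₁ p₂ : ℝ} (hj : 0 < j) (hm : 0 < m) (hr : 0 < r)
    (hr2 : r ≤ 1 / 2) (hp₁ : p₁ ^ 2 < r ^ 2) (hp₂ : p₂ ^ 2 < r ^ 2)
    (hh : m * (p₁ - p₂) = h) (hb : m * (1 - p₁) < 2)
    (hP : ∀ v, curvePoly h j (1 - m * (v - p₁)) = 2 * m ^ 3 * ((1 - v) * (v ^ 2 - r ^ 2))) :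
    2 * Real.pi * rotationNumber h j = 2 * thirdKindValue p₁ r + thirdKindValue p₂ r := by
  have hpr₁ := abs_lt.1 (abs_lt_of_sq_lt_sq hp₁ hr.le)
  have hpr₂ := abs_lt.1 (abs_lt_of_sq_lt_sq hp₂ hr.le)
  have hprod : ∀ v, 2 * m ^ 3 * ((1 - v) * (v ^ 2 - r ^ 2)) + j ^ 2
      = 2 * (m * (v - p₁)) * (2 - m * (v - p₁)) * (m * (v - p₂)) := by
    intro v
    rw [← hP v, curvePoly, ← hh]; ring
  set c := √(2 * m ^ 3) with hc
  have hc0 : 0 < c := Real.sqrt_pos.2 (by positivity)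
  have hc2 : c ^ 2 = 2 * m ^ 3 := Real.sq_sqrt (by positivity)
  have hsqrtP : ∀ v, √(2 * m ^ 3 * ((1 - v) * (v ^ 2 - r ^ 2)))
      = c * √((1 - v) * (v ^ 2 - r ^ 2)) := fun v => Real.sqrt_mul (by positivity) _
  have hsplitP : ∀ v ∈ Set.Ioo r 1, √((1 - v) * (v ^ 2 - r ^ 2)) = √(1 - v) * √(v ^ 2 - r ^ 2) :=
    fun v hv => Real.sqrt_mul (by linarith [hv.2]) _
  -- At `p₁` and `p₂` the product `2(1-ζ)(1+ζ)(h+1-ζ)` vanishes, so the cubic equals `-j²` there.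
  -- This identifies `j` with the normalising factor of `thirdKind`.
  have hj₀ : ∀ p, (p - p₁) * (p - p₂) = 0 → p ^ 2 < r ^ 2 → p < 1 →
      j = c * (√(r ^ 2 - p ^ 2) * √(1 - p)) := by
    intro p hp hpr hp1
    have h1 := hprod p
    have h2 : j ^ 2 = (c * (√(r ^ 2 - p ^ 2) * √(1 - p))) ^ 2 := by
      rw [mul_pow, mul_pow, hc2, Real.sq_sqrt (by linarith), Real.sq_sqrt (by linarith)]
      linear_combination h1 + 2 * m ^ 2 * (2 - m * (p - p₁)) * hp
    exact (pow_left_inj₀ hj.le (by positivity) two_ne_zero).1 h2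
  have hthird : ∀ p, (p - p₁) * (p - p₂) = 0 → p ^ 2 < r ^ 2 → p < r → ∀ v ∈ Set.Ioo r 1,
      m * j / (√(2 * m ^ 3 * ((1 - v) * (v ^ 2 - r ^ 2))) * (m * (v - p))) = thirdKind p r v := by
    intro p hp hpr hp1 v hv
    have hu : 0 < √(1 - v) := Real.sqrt_pos.2 (by linarith [hv.2])
    have hw : 0 < √(v ^ 2 - r ^ 2) := Real.sqrt_pos.2 (sq_sub_sq_pos hr.le hv.1)
    have hvp : 0 < v - p := by linarith [hv.1]
    rw [hsqrtP, hsplitP v hv, thirdKind, hj₀ p hp hpr (by linarith)]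
    field_simp
  obtain ⟨hi₁, hI₁⟩ := thirdKind_integral hr hr2 hp₁
  obtain ⟨hi₂, hI₂⟩ := thirdKind_integral hr hr2 hp₂
  have hI₁' : ∫ v in Set.Ioo r 1, thirdKind p₁ r v = thirdKindValue p₁ r := hI₁
  have hI₂' : ∫ v in Set.Ioo r 1, thirdKind p₂ r v = thirdKindValue p₂ r := hI₂
  set f₃ : ℝ → ℝ := fun v => m * j / (√(2 * m ^ 3 * ((1 - v) * (v ^ 2 - r ^ 2)))
    * (2 - m * (v - p₁))) with hf₃
  have hδ : 0 < 2 - m * (1 - p₁) := by linarith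
  have hout : ∀ v ∈ Set.Ioo r 1, 2 - m * (1 - p₁) ≤ 2 - m * (v - p₁) := by
    intro v hv
    nlinarith [hv.2]
  have hi₃ : IntegrableOn f₃ (Set.Ioo r 1) := by
    have h1 := integrableOn_kernel (g := fun v => m * j / (c * √(1 - v) * (2 - m * (v - p₁))))
      (C := m * j / (c * (2 - m * (1 - p₁)))) (by fun_prop) hr hr2 fun v hv => by
        have hu : 0 < √(1 - v) := Real.sqrt_pos.2 (by linarith [hv.2])
        have h2 := hout v hv
        have h3 : 0 < 2 - m * (v - p₁) := by linarith
        rw [abs_of_pos (by positivity), div_div]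
        rw [show c * (2 - m * (1 - p₁)) * √(1 - v) = c * √(1 - v) * (2 - m * (1 - p₁)) by ring]
        gcongr
    refine h1.congr_fun (fun v hv => ?_) measurableSet_Ioo
    simp only [hf₃]
    rw [hsqrtP, hsplitP v hv, div_div]
    congr 1
    ring
  -- The integrand is the derivative of `2 arctan(w/j)`, and `w` vanishes at both ends. Thus the
  -- integral `f₃` with pole at `ζ = -1` is the sum of those with poles at `p₁` (`ζ = 1`) and `p₂`
  -- (`ζ = 1 + h`).
  have habel : ∫ v in Set.Ioo r 1, (thirdKind p₁ r v + thirdKind p₂ r v - f₃ v) = 0 := by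
    have hc' : ContinuousOn
        (fun v => 2 * Real.arctan (√(2 * m ^ 3 * ((1 - v) * (v ^ 2 - r ^ 2))) / j))
        (Set.Icc r 1) := by fun_prop
    have hi : IntegrableOn (fun v => thirdKind p₁ r v + thirdKind p₂ r v - f₃ v) (Set.Ioo r 1) :=
      (Integrable.add hi₁ hi₂).sub hi₃
    rw [setIntegral_Ioo_of_hasDerivAt (by linarith) hc' (fun v hv => ?_) hi]
    · simp
    have hq : 0 < (1 - v) * (v ^ 2 - r ^ 2) :=
      mul_pos (by linarith [hv.2]) (sq_sub_sq_pos hr.le hv.1)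
    have hw2 := Real.sq_sqrt (show 0 ≤ 2 * m ^ 3 * ((1 - v) * (v ^ 2 - r ^ 2)) by positivity)
    have hw : 0 < √(2 * m ^ 3 * ((1 - v) * (v ^ 2 - r ^ 2))) := Real.sqrt_pos.2 (by positivity)
    have hder : HasDerivAt (fun v => 2 * m ^ 3 * ((1 - v) * (v ^ 2 - r ^ 2)))
        (2 * m ^ 3 * (-(v ^ 2 - r ^ 2) + (1 - v) * (2 * v))) v := by
      have := ((((hasDerivAt_id v).const_sub 1).mul
        (((hasDerivAt_id v).pow 2).sub_const (r ^ 2))).const_mul (2 * m ^ 3))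
      exact hasDerivAt_congr this (fun y => by simp) (by simp)
    have hG := ((((hder.sqrt (by positivity)).div_const j).arctan).const_mul 2)
    refine hG.congr_deriv ?_
    rw [← hthird p₁ (by simp) hp₁ hpr₁.2 v hv, ← hthird p₂ (by simp) hp₂ hpr₂.2 v hv, hf₃]
    have hpr := hprod v
    -- The two factorisations of the cubic up to `j²` are the same function, so their derivatives
    -- agree.
    have hder2 : 2 * m ^ 3 * (-(v ^ 2 - r ^ 2) + (1 - v) * (2 * v))
        = 2 * m * ((2 - m * (v - p₁)) * (m * (v - p₂)) - (m * (v - p₁)) * (m * (v - p₂))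
          + (m * (v - p₁)) * (2 - m * (v - p₁))) := by
      have h1 : HasDerivAt (fun v => 2 * m ^ 3 * ((1 - v) * (v ^ 2 - r ^ 2)))
          (2 * m * ((2 - m * (v - p₁)) * (m * (v - p₂)) - (m * (v - p₁)) * (m * (v - p₂))
          + (m * (v - p₁)) * (2 - m * (v - p₁)))) v := by
        have hx₁ := (((hasDerivAt_id v).sub_const p₁).const_mul m)
        have hx₂ := (((hasDerivAt_id v).sub_const p₂).const_mul m)
        have h2 := (((hx₁.const_mul 2).mul (hx₁.const_sub 2)).mul hx₂).sub_const (j ^ 2)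
        exact hasDerivAt_congr h2 (fun y => by simp; linear_combination -hprod y)
          (by simp; ring)
      exact hder.unique h1
    rw [hder2]
    have hx₁ : 0 < m * (v - p₁) := mul_pos hm (by linarith [hv.1])
    have hx₂ : 0 < m * (v - p₂) := mul_pos hm (by linarith [hv.1])
    have hx₃ : 0 < 2 - m * (v - p₁) := by linarith [hout v hv]
    simp only
    generalize √(2 * m ^ 3 * ((1 - v) * (v ^ 2 - r ^ 2))) = w at hw hw2
    rw [← hw2] at hpr
    generalize m * (v - p₁) = x at *
    generalize m * (v - p₂) = y at *
    have h1 : 1 + (w / j) ^ 2 = 2 * x * (2 - x) * y / j ^ 2 := by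
      rw [← hpr]; field_simp; ring
    rw [h1]
    field_simp
    ring
  have hi₁₂ : IntegrableOn (fun v => thirdKind p₁ r v + thirdKind p₂ r v) (Set.Ioo r 1) :=
    Integrable.add hi₁ hi₂
  rw [integral_sub hi₁₂ hi₃, integral_add hi₁ hi₂, hI₁', hI₂'] at habel
  have hset : allowedHeights h j = (fun v => 1 - m * (v - p₁)) '' Set.Ioo r 1 := by
    ext ζ
    constructor
    · rintro ⟨⟨hζ1, hζ2⟩, hpos⟩
      refine ⟨p₁ + (1 - ζ) / m, ?_, by field_simp; ring⟩
      set v := p₁ + (1 - ζ) / m with hv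
      have hζ : ζ = 1 - m * (v - p₁) := by rw [hv]; field_simp; ring
      rw [hζ, hP] at hpos
      have hpos' : 0 < (1 - v) * (v ^ 2 - r ^ 2) := pos_of_mul_pos_right hpos (by positivity)
      have hvp : p₁ ≤ v := by
        have : 0 ≤ (1 - ζ) / m := div_nonneg (by linarith) hm.le
        linarith
      -- The cubic is also positive for `v < -r`, but those values correspond to `ζ > 1`.
      have hvr : -r < v := by linarith
      have hr1 : r < v := by
        by_contra hcon
        have h1 : v ^ 2 - r ^ 2 ≤ 0 := by nlinarith
        have h2 : 0 < 1 - v := by linarith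
        nlinarith
      refine ⟨hr1, ?_⟩
      have := sq_sub_sq_pos hr.le hr1
      have := pos_of_mul_pos_left hpos' this.le
      linarith
    · rintro ⟨v, hv, rfl⟩
      have h1 : 0 < m * (v - p₁) := mul_pos hm (by linarith [hv.1])
      have h2 := hout v hv
      refine ⟨⟨by linarith, by linarith⟩, ?_⟩
      rw [hP]
      have : 0 < (1 - v) * (v ^ 2 - r ^ 2) :=
        mul_pos (by linarith [hv.2]) (sq_sub_sq_pos hr.le hv.1)
      positivity
  have himg : ∫ ζ in allowedHeights h j, j / ((1 - ζ ^ 2) * √(curvePoly h j ζ))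
      = ∫ v in Set.Ioo r 1, 1 / 2 * (thirdKind p₁ r v + f₃ v) := by
    have hder : ∀ v ∈ Set.Ioo r 1,
        HasDerivWithinAt (fun v => 1 - m * (v - p₁)) (-m) (Set.Ioo r 1) v := fun v _ => by
      have := (((hasDerivAt_id v).sub_const p₁).const_mul m).const_sub 1
      exact (hasDerivAt_congr this (fun y => rfl) (by simp)).hasDerivWithinAt
    have hinj : Set.InjOn (fun v => 1 - m * (v - p₁)) (Set.Ioo r 1) := by
      intro a _ b _ hab
      have h1 : m * (a - p₁) = m * (b - p₁) := by simpa using hab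
      have := mul_left_cancel₀ hm.ne' h1
      linarith
    rw [hset, integral_image_eq_integral_abs_deriv_smul measurableSet_Ioo hder hinj]
    refine setIntegral_congr_fun measurableSet_Ioo fun v hv => ?_
    rw [hP, ← hthird p₁ (by simp) hp₁ hpr₁.2 v hv, hf₃, abs_neg, abs_of_pos hm, smul_eq_mul]
    have hx₁ : 0 < m * (v - p₁) := mul_pos hm (by linarith [hv.1])
    have hx₃ : 0 < 2 - m * (v - p₁) := by linarith [hout v hv]
    have hw : 0 < √(2 * m ^ 3 * ((1 - v) * (v ^ 2 - r ^ 2))) := by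
      have : 0 < (1 - v) * (v ^ 2 - r ^ 2) :=
        mul_pos (by linarith [hv.2]) (sq_sub_sq_pos hr.le hv.1)
      exact Real.sqrt_pos.2 (by positivity)
    simp only
    generalize √(2 * m ^ 3 * ((1 - v) * (v ^ 2 - r ^ 2))) = w at hw
    generalize m * (v - p₁) = x at *
    rw [show 1 - (1 - x) ^ 2 = x * (2 - x) by ring]
    field_simp
    ring
  rw [rotationNumber, himg, integral_const_mul, integral_add hi₁ hi₃]
  have hpi := Real.pi_pos.ne'
  field_simp
  rw [hI₁']
  linarith

end SphericalPendulum

/-! ### Explicit parameters and the extraction of `Arg(h + ij)` -/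

namespace SphericalPendulum

open Filter Asymptotics Topology Finset

/-- If `Z = X + ijY` and `z = h + ij` lie in the upper half plane and `Z z̄` in the right one, then
the arguments of `Z` and `z` differ by an arctangent. -/
theorem arg_eq_arg_add_arctan {h j X Y : ℝ} (hj : 0 < j) (hY : 0 < Y)
    (hre : 0 < X * h + j ^ 2 * Y) :
    Complex.arg ⟨X, j * Y⟩
      = Complex.arg ⟨h, j⟩ + Real.arctan (j * (Y * h - X) / (X * h + j ^ 2 * Y)) := by
  have hz : (⟨h, j⟩ : ℂ) ≠ 0 := fun hh => hj.ne' (congrArg Complex.im hh)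
  have hjY := mul_pos hj hY
  set w : ℂ := ⟨X * h + j ^ 2 * Y, j * (Y * h - X)⟩ with hw
  have hw0 : w ≠ 0 := fun hh => hre.ne' (congrArg Complex.re hh)
  have harg : Complex.arg w = Real.arctan (j * (Y * h - X) / (X * h + j ^ 2 * Y)) := by
    rw [show j * (Y * h - X) / (X * h + j ^ 2 * Y) = w.im / w.re from rfl, ← Complex.tan_arg,
      Real.arctan_tan]
    all_goals
      have := Complex.abs_arg_lt_pi_div_two_iff.2 (Or.inl hre : 0 < w.re ∨ w = 0)
      rw [abs_lt] at this
    · exact this.1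
    · exact this.2
  have hn : 0 < h ^ 2 + j ^ 2 := by positivity
  have hprod : w * ⟨h, j⟩ = ((h ^ 2 + j ^ 2 : ℝ) : ℂ) * ⟨X, j * Y⟩ := by
    apply Complex.ext
    · simp only [hw, Complex.mul_re, Complex.ofReal_re, Complex.ofReal_im]; ring
    · simp only [hw, Complex.mul_im, Complex.ofReal_re, Complex.ofReal_im]; ring
  have hang := Complex.arg_mul_coe_angle hw0 hz
  rw [hprod, Complex.arg_real_mul _ hn, ← Real.Angle.coe_add,
      Real.Angle.angle_eq_iff_two_pi_dvd_sub]
    at hang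
  obtain ⟨k, hk⟩ := hang
  have hZ := Complex.arg_lt_pi_iff.2 (Or.inr hjY.ne' : 0 ≤ (⟨X, j * Y⟩ : ℂ).re ∨ (⟨X, j * Y⟩ :
      ℂ).im ≠ 0)
  have hZ0 : 0 ≤ Complex.arg ⟨X, j * Y⟩ := Complex.arg_nonneg_iff.2 hjY.le
  have hz1 := Complex.arg_le_pi ⟨h, j⟩
  have hz0 : 0 ≤ Complex.arg ⟨h, j⟩ := Complex.arg_nonneg_iff.2 hj.le
  have h1 := Real.arctan_lt_pi_div_two (j * (Y * h - X) / (X * h + j ^ 2 * Y))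
  have h2 := Real.neg_pi_div_two_lt_arctan (j * (Y * h - X) / (X * h + j ^ 2 * Y))
  rw [← harg] at h1 h2 ⊢
  have hpi := Real.pi_pos
  -- The arguments of `Z` and `z` lie in `[0, π]` and that of `w` in `(-π/2, π/2)`, so the
  -- discrepancy is below `2π` in absolute value.
  have hk1 : (k : ℝ) < 1 := by
    by_contra hc
    nlinarith [not_lt.1 hc]
  have hk2 : (-1 : ℝ) < k := by
    by_contra hc
    nlinarith [not_lt.1 hc]
  have hk0 : k = 0 := by
    have a : k < 1 := by exact_mod_cast hk1
    have b : -1 < k := by exact_mod_cast hk2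
    omega
  rw [hk0] at hk
  simp at hk
  linarith

section Parameters

variable (h j d : ℝ)

/-- Twice the factor `m` of the substitution `1 - ζ = m(v - p)` which normalises the curve. -/
noncomputable def scale : ℝ := 4 + h - 3 * (j ^ 2 * d)

/-- The parameter `r²` of the normalised curve `w² = (1-v)(v²-r²)`. -/
noncomputable def modulusSq : ℝ :=
  (h ^ 2 + 8 * (j ^ 2 * d) + 2 * h * (j ^ 2 * d) - 3 * (j ^ 2 * d) ^ 2) * (scale h j d)⁻¹ ^ 2

/-- The position of the pole `ζ = 1` on the normalised curve. -/
noncomputable def upperPole : ℝ := (h - j ^ 2 * d) * (scale h j d)⁻¹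

/-- The position of the pole `ζ = -1` on the normalised curve. -/
noncomputable def lowerPole : ℝ := -(h + j ^ 2 * d) * (scale h j d)⁻¹

/-- The residue at the pole `p`, divided by `j`. -/
noncomputable def residue (p : ℝ) : ℝ :=
  2 * (scale h j d)⁻¹ * √(scale h j d)⁻¹ * √(1 - p)⁻¹

/-- The factor by which the imaginary part of `h + ij` is multiplied at the pole `p`. -/
noncomputable def imFactor (p : ℝ) : ℝ :=
  scale h j d * residue h j d p * √(1 - modulusSq h j d)

/-- The amount by which the real part of `h + ij` is changed at the poles. -/
noncomputable def reShift : ℝ :=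
  j ^ 2 * d + (h ^ 2 + 8 * (j ^ 2 * d) + 2 * h * (j ^ 2 * d) - 3 * (j ^ 2 * d) ^ 2)
    * (scale h j d)⁻¹

/-- The relative argument of `h + σ reShift + i j imFactor` with respect to `h + ij`. -/
noncomputable def argShift (σ p : ℝ) : ℝ :=
  Real.arctan ((h * j * (imFactor h j d p - 1) - σ * (reShift h j d * j)) / (h ^ 2 + j ^ 2)
    * (1 + (j ^ 2 * (imFactor h j d p - 1) + σ * (reShift h j d * h)) / (h ^ 2 + j ^ 2))⁻¹)

/-- The part of `2πW/j` which stems from the third kind integrals. -/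
noncomputable def poleSum : ℝ :=
  2 * (residue h j d (upperPole h j d)
      * poleIntegral √(1 - upperPole h j d) √(modulusSq h j d))
    + residue h j d (lowerPole h j d)
      * poleIntegral √(1 - lowerPole h j d) √(modulusSq h j d)

end Parameters

variable {h j d : ℝ}

theorem argShift_eq {σ p : ℝ} (hj : 0 < j) (hY : 0 < imFactor h j d p)
    (hE : -1 < (j ^ 2 * (imFactor h j d p - 1) + σ * (reShift h j d * h)) / (h ^ 2 + j ^ 2)) :
    Complex.arg ⟨h + σ * reShift h j d, j * imFactor h j d p⟩
      = Complex.arg ⟨h, j⟩ + argShift h j d σ p := by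
  have hn : 0 < h ^ 2 + j ^ 2 := by positivity
  have hE' := hE
  rw [lt_div_iff₀ hn] at hE
  have hre : 0 < (h + σ * reShift h j d) * h + j ^ 2 * imFactor h j d p := by linarith
  rw [arg_eq_arg_add_arctan hj hY hre, argShift]
  congr 2
  have h1 : 1 + (j ^ 2 * (imFactor h j d p - 1) + σ * (reShift h j d * h)) / (h ^ 2 + j ^ 2)
      = ((h + σ * reShift h j d) * h + j ^ 2 * imFactor h j d p) / (h ^ 2 + j ^ 2) := by
    field_simp; ring
  rw [h1]
  field_simp
  ring

theorem two_pi_mul_rotationNumber_of_pos (hj : 0 < j) (hd : 0 < d)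
    (hroot : 2 * (2 - j ^ 2 * d) * (2 + h - j ^ 2 * d) * d = 1) (hδ : j ^ 2 * d < 2)
    (hδ' : j ^ 2 * d < 2 + h) (hM : 0 < scale h j d) (hr : √(modulusSq h j d) ≤ 1 / 2)
    (hE₁ : -1 < (j ^ 2 * (imFactor h j d (upperPole h j d) - 1) + (-1) * (reShift h j d * h))
      / (h ^ 2 + j ^ 2))
    (hE₂ : -1 < (j ^ 2 * (imFactor h j d (lowerPole h j d) - 1) + 1 * (reShift h j d * h))
      / (h ^ 2 + j ^ 2)) :
    2 * Real.pi * rotationNumber h j = 2 * Real.pi - Complex.arg ⟨h, j⟩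
      - 2 * argShift h j d (-1) (upperPole h j d) + argShift h j d 1 (lowerPole h j d)
      + j * poleSum h j d := by
  set M := scale h j d with hMd
  set δ := j ^ 2 * d with hδd
  have hδ0 : 0 < δ := by positivity
  -- All parameters are rational in `h` and `δ`; eliminating `j²` by the root equation turns `r² -
  -- p²` and `1 - p` into products.
  have hj2 : j ^ 2 = 2 * (2 - δ) * (2 + h - δ) * δ := by
    rw [hδd, ← hδd]; linear_combination (-j ^ 2) * hroot
  have hMe : M = 4 + h - 3 * δ := rfl
  have hr2e : modulusSq h j d = (h ^ 2 + 8 * δ + 2 * h * δ - 3 * δ ^ 2) * M⁻¹ ^ 2 := rfl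
  have hp1e : upperPole h j d = (h - δ) * M⁻¹ := rfl
  have hp2e : lowerPole h j d = -(h + δ) * M⁻¹ := rfl
  have hQe : reShift h j d = δ + (h ^ 2 + 8 * δ + 2 * h * δ - 3 * δ ^ 2) * M⁻¹ := rfl
  have hs1 : 1 - upperPole h j d = 2 * (2 - δ) * M⁻¹ := by
    rw [hp1e]; field_simp; rw [hMe]; ring
  -- The value `v = lowerPole` is where `1 - ζ + h` vanishes, that is `ζ = 1 + h`.
  have hs2 : 1 - lowerPole h j d = 2 * (2 + h - δ) * M⁻¹ := by
    rw [hp2e]; field_simp; rw [hMe]; ring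
  have hk1 : modulusSq h j d - upperPole h j d ^ 2 = 4 * δ * (2 + h - δ) * M⁻¹ ^ 2 := by
    rw [hr2e, hp1e]; ring
  have hk2 : modulusSq h j d - lowerPole h j d ^ 2 = 4 * δ * (2 - δ) * M⁻¹ ^ 2 := by
    rw [hr2e, hp2e]; ring
  have hA : 0 < 2 - δ := by linarith
  have hB : 0 < 2 + h - δ := by linarith
  have hk1p : 0 < modulusSq h j d - upperPole h j d ^ 2 := by rw [hk1]; positivity
  have hk2p : 0 < modulusSq h j d - lowerPole h j d ^ 2 := by rw [hk2]; positivity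
  have hr2p : 0 < modulusSq h j d := by nlinarith [sq_nonneg (upperPole h j d)]
  have hres : ∀ p, 0 < 1 - p → 0 < residue h j d p := fun p hp => by
    unfold residue; rw [← hMd]; positivity
  have hsq : ∀ p, 0 < 1 - p → (j * residue h j d p) ^ 2 = j ^ 2 * (4 * M⁻¹ ^ 3 * (1 - p)⁻¹) := by
    intro p hp
    unfold residue
    rw [← hMd, mul_pow, mul_pow, mul_pow, Real.sq_sqrt (by positivity), Real.sq_sqrt
        (by positivity)]
    ring
  have hs1p : 0 < 1 - upperPole h j d := by rw [hs1]; positivity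
  have hs2p : 0 < 1 - lowerPole h j d := by rw [hs2]; positivity
  -- Here the factor `j` in front of the regular parts appears: the square root is `j` times a
  -- function depending on `j` only through `j²`.
  have hκ1 : √(modulusSq h j d - upperPole h j d ^ 2) = j * residue h j d (upperPole h j d) := by
    rw [← Real.sqrt_sq (mul_pos hj (hres _ hs1p)).le, hsq _ hs1p, hk1, hs1, hj2]
    congr 1
    field_simp
  have hκ2 : √(modulusSq h j d - lowerPole h j d ^ 2) = j * residue h j d (lowerPole h j d) := by
    rw [← Real.sqrt_sq (mul_pos hj (hres _ hs2p)).le, hsq _ hs2p, hk2, hs2, hj2]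
    congr 1
    field_simp
  have hrp : 0 < √(modulusSq h j d) := Real.sqrt_pos.2 hr2p
  have hrr : √(modulusSq h j d) ^ 2 = modulusSq h j d := Real.sq_sqrt hr2p.le
  have hr14 : modulusSq h j d ≤ 1 / 4 := by rw [← hrr]; nlinarith
  have hmain := two_pi_mul_rotationNumber (h := h) (j := j) (m := M / 2) (r := √(modulusSq h j d))
    (p₁ := upperPole h j d) (p₂ := lowerPole h j d) hj (by positivity) hrp hr
    (by rw [hrr]; linarith) (by rw [hrr]; linarith)
    (by rw [hp1e, hp2e]; field_simp; ring)
    (by rw [hs1]; field_simp; linarith)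
    (fun v => by
      rw [hrr, curvePoly, hj2, hp1e, hr2e]
      field_simp
      rw [hMe]
      ring)
  have hsqrt : 0 < √(1 - modulusSq h j d) := Real.sqrt_pos.2 (by linarith)
  have hY : ∀ p, 0 < 1 - p → 0 < imFactor h j d p := fun p hp => by
    unfold imFactor; rw [← hMd]; have := hres p hp; positivity
  have harg2 : Complex.arg ⟨modulusSq h j d - lowerPole h j d,
        √(modulusSq h j d - lowerPole h j d ^ 2) * √(1 - modulusSq h j d)⟩
      = Complex.arg ⟨h, j⟩ + argShift h j d 1 (lowerPole h j d) := by
    rw [← argShift_eq hj (hY _ hs2p) hE₂, ← Complex.arg_real_mul _ hM]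
    congr 1
    apply Complex.ext
    · simp only [Complex.mul_re, Complex.ofReal_re, Complex.ofReal_im, hr2e, hp2e, hQe]
      field_simp; ring
    · simp only [Complex.mul_im, Complex.ofReal_re, Complex.ofReal_im, hκ2, imFactor]
      ring
  -- At the upper pole the complex number is, up to the positive factor `M`, minus the conjugate of
  -- a perturbation of `h + ij`; reflection in the imaginary axis turns the argument into `π` minus
  -- it.
  have harg1 : Complex.arg ⟨modulusSq h j d - upperPole h j d,
        √(modulusSq h j d - upperPole h j d ^ 2) * √(1 - modulusSq h j d)⟩
      = Real.pi - (Complex.arg ⟨h, j⟩ + argShift h j d (-1) (upperPole h j d)) := by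
    rw [← argShift_eq hj (hY _ hs1p) hE₁, ← Complex.arg_real_mul _ hM]
    have hne : 0 < j * imFactor h j d (upperPole h j d) := mul_pos hj (hY _ hs1p)
    set Z : ℂ := ⟨h + -1 * reShift h j d, j * imFactor h j d (upperPole h j d)⟩ with hZ
    have hZi : 0 < Z.im := hne
    have : (M : ℂ) * ⟨modulusSq h j d - upperPole h j d,
        √(modulusSq h j d - upperPole h j d ^ 2) * √(1 - modulusSq h j d)⟩
        = -(starRingEnd ℂ) Z := by
      apply Complex.ext
      · simp only [Complex.mul_re, Complex.ofReal_re, Complex.ofReal_im, Complex.neg_re,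
          Complex.conj_re, hZ, hr2e, hp1e, hQe]
        field_simp; ring
      · simp only [Complex.mul_im, Complex.ofReal_re, Complex.ofReal_im, Complex.neg_im,
          Complex.conj_im, hZ, hκ1, imFactor]
        ring
    rw [this, Complex.arg_neg_eq_arg_add_pi_of_im_neg (by simpa using hZi), Complex.arg_conj,
      if_neg]
    · ring
    · exact (Complex.arg_lt_pi_iff.2 (Or.inr hZi.ne')).ne
  rw [thirdKindValue, thirdKindValue, hrr, hκ1, hκ2, ← hκ1, harg1, hκ1, ← hκ2, harg2, hκ2] at hmain
  rw [hmain, poleSum]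
  ring

theorem rotationNumber_neg (h j : ℝ) : rotationNumber h (-j) = -rotationNumber h j := by
  simp [rotationNumber, allowedHeights, curvePoly, neg_div, MeasureTheory.integral_neg]

/-- The rotation number, the sign, the argument and `argShift` are odd in `j`, all other parameters
even. -/
theorem two_pi_mul_rotationNumber_of_ne (hj : j ≠ 0) (hd : 0 < d)
    (hroot : 2 * (2 - j ^ 2 * d) * (2 + h - j ^ 2 * d) * d = 1) (hδ : j ^ 2 * d < 2)
    (hδ' : j ^ 2 * d < 2 + h) (hM : 0 < scale h j d) (hr : √(modulusSq h j d) ≤ 1 / 2)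
    (hE₁ : -1 < (j ^ 2 * (imFactor h j d (upperPole h j d) - 1) + (-1) * (reShift h j d * h))
      / (h ^ 2 + j ^ 2))
    (hE₂ : -1 < (j ^ 2 * (imFactor h j d (lowerPole h j d) - 1) + 1 * (reShift h j d * h))
      / (h ^ 2 + j ^ 2)) :
    2 * Real.pi * rotationNumber h j = 2 * Real.pi * Real.sign j
      - Complex.arg ((h : ℂ) + Complex.I * (j : ℂ))
      - 2 * argShift h j d (-1) (upperPole h j d) + argShift h j d 1 (lowerPole h j d)
      + j * poleSum h j d := by
  have hz : (h : ℂ) + Complex.I * (j : ℂ) = ⟨h, j⟩ := by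
    apply Complex.ext <;> simp
  rw [hz]
  rcases lt_or_gt_of_ne hj with hj | hj
  · have hsc : scale h (-j) d = scale h j d := by simp [scale]
    have hmod : modulusSq h (-j) d = modulusSq h j d := by simp [modulusSq, hsc]
    have hup : upperPole h (-j) d = upperPole h j d := by simp [upperPole, hsc]
    have hlo : lowerPole h (-j) d = lowerPole h j d := by simp [lowerPole, hsc]
    have hre : residue h (-j) d = residue h j d := by funext p; simp [residue, hsc]
    have him : imFactor h (-j) d = imFactor h j d := by funext p; simp [imFactor, hsc, hre, hmod]
    have hsh : reShift h (-j) d = reShift h j d := by simp [reShift, hsc]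
    have hps : poleSum h (-j) d = poleSum h j d := by simp [poleSum, hup, hlo, hre, hmod]
    have has : ∀ σ p, argShift h (-j) d σ p = -argShift h j d σ p := fun σ p => by
      rw [argShift, argShift, him, hsh, ← Real.arctan_neg, neg_sq, ← neg_mul, ← neg_div]
      congr 3
      ring
    have hmain := two_pi_mul_rotationNumber_of_pos (h := h) (j := -j) (d := d) (by linarith) hd
      (by rw [neg_sq]; exact hroot) (by rw [neg_sq]; exact hδ) (by rw [neg_sq]; exact hδ')
      (by rw [hsc]; exact hM) (by rw [hmod]; exact hr) (by rw [neg_sq, him, hsh, hup]; exact hE₁)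
      (by rw [neg_sq, him, hsh, hlo]; exact hE₂)
    rw [rotationNumber_neg, has, has, hps, hup, hlo] at hmain
    have hconj : Complex.arg ⟨h, -j⟩ = -Complex.arg ⟨h, j⟩ := by
      have : (⟨h, -j⟩ : ℂ) = (starRingEnd ℂ) ⟨h, j⟩ := rfl
      rw [this, Complex.arg_conj, if_neg]
      exact (Complex.arg_lt_pi_iff.2 (Or.inr hj.ne)).ne
    rw [hconj] at hmain
    rw [Real.sign_of_neg hj]
    linarith
  · rw [Real.sign_of_pos hj, mul_one]
    exact two_pi_mul_rotationNumber_of_pos hj hd hroot hδ hδ' hM hr hE₁ hE₂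

end SphericalPendulum

/-! ### Expansions of the parameters and of the two parts of `2πW` -/

namespace SphericalPendulum

open Filter Asymptotics Topology Finset

variable {d : PlaneFun}

namespace HasExp

/-- The expansion of the outer root. -/
def OuterRoot (d : PlaneFun) : Prop :=
  HasExp polyForms d (fun _ => 1 / 8) (fun x => -x.1 / 16)
    (fun x => x.2 ^ 2 / 64 + x.1 ^ 2 / 32)

theorem scale (hd : OuterRoot d) : HasExp polyForms (fun x => scale x.1 x.2 (d x))
    (fun _ => 4) (fun x => x.1) (fun x => -3 / 8 * x.2 ^ 2) := by
  refine ((const 4).add (fst.sub (((snd.mul snd).mul hd).const_mul 3))).congr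
    (Eventually.of_forall fun x => ?_) (fun x => ?_) (fun x => ?_) fun x => ?_
  · simp only [SphericalPendulum.scale]; ring
  all_goals ring

theorem scale_sub (hd : OuterRoot d) :
    HasExp polyForms (fun x => (1 / 4) * SphericalPendulum.scale x.1 x.2 (d x) - 1)
    (fun _ => 0) (fun x => x.1 / 4) (fun x => -3 / 32 * x.2 ^ 2) :=
  (((scale hd).const_mul (1 / 4)).sub (const 1)).congr_coeff
    (fun x => by ring) (fun x => by ring) fun x => by ring

theorem inv_scale (hd : OuterRoot d) :
    HasExp polyForms (fun x => (SphericalPendulum.scale x.1 x.2 (d x))⁻¹)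
    (fun _ => 1 / 4) (fun x => -x.1 / 16) (fun x => 3 / 128 * x.2 ^ 2 + x.1 ^ 2 / 64) := by
  refine ((scale_sub hd).inv_one_add.const_mul (1 / 4)).congr
    (Eventually.of_forall fun x => ?_) (fun x => ?_) (fun x => ?_) fun x => ?_
  · simp only [add_sub_cancel, mul_inv, ← mul_assoc]
    norm_num
  all_goals ring

/-- The expansion of the cofactor of `j²` in the numerator `h² + j²(…)` of `modulusSq`. -/
theorem numerator (hd : OuterRoot d) :
    HasExp polyForms (fun x => 8 * d x + 2 * x.1 * d x - 3 * x.2 ^ 2 * d x ^ 2)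
    (fun _ => 1) (fun x => -x.1 / 4) (fun x => 5 / 64 * x.2 ^ 2 + x.1 ^ 2 / 8) := by
  refine (((hd.const_mul 8).add ((fst.mul hd).const_mul 2)).sub
    (((snd.mul hd).mul (snd.mul hd)).const_mul 3)).congr
    (Eventually.of_forall fun x => ?_) (fun x => ?_) (fun x => ?_) fun x => ?_
  all_goals ring

theorem modulusSq (hd : OuterRoot d) :
    HasExp polyForms (fun x => modulusSq x.1 x.2 (d x))
    (fun _ => 0) (fun _ => 0) (fun x => (x.1 ^ 2 + x.2 ^ 2) / 16) := by
  have hi := inv_scale hd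
  refine (((fst.mul fst).add ((snd.mul snd).mul (numerator hd))).mul (hi.mul hi)).congr
    (Eventually.of_forall fun x => ?_) (fun x => ?_) (fun x => ?_) fun x => ?_
  · simp only [SphericalPendulum.modulusSq]; ring
  all_goals ring

theorem upperPole (hd : OuterRoot d) : HasExp polyForms (fun x => upperPole x.1 x.2 (d x))
    (fun _ => 0) (fun x => x.1 / 4) (fun x => -x.2 ^ 2 / 32 - x.1 ^ 2 / 16) := by
  refine ((fst.sub ((snd.mul snd).mul hd)).mul (inv_scale hd)).congr
    (Eventually.of_forall fun x => ?_) (fun x => ?_) (fun x => ?_) fun x => ?_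
  · simp only [SphericalPendulum.upperPole]; ring
  all_goals ring

theorem lowerPole (hd : OuterRoot d) : HasExp polyForms (fun x => lowerPole x.1 x.2 (d x))
    (fun _ => 0) (fun x => -x.1 / 4) (fun x => -x.2 ^ 2 / 32 + x.1 ^ 2 / 16) := by
  refine (((fst.add ((snd.mul snd).mul hd)).mul (inv_scale hd)).const_mul (-1)).congr
    (Eventually.of_forall fun x => ?_) (fun x => ?_) (fun x => ?_) fun x => ?_
  · simp only [SphericalPendulum.lowerPole]; ring
  all_goals ring

variable {p p₁ p₂ : PlaneFun}

theorem residue (hd : OuterRoot d) (hp : HasExp polyForms p (fun _ => 0) p₁ p₂) :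
    HasExp polyForms (fun x => residue x.1 x.2 (d x) (p x))
    (fun _ => 1 / 4) (fun x => -3 / 32 * x.1 + p₁ x / 8)
    (fun x => 9 / 256 * x.2 ^ 2 + 15 / 512 * x.1 ^ 2 - 3 / 64 * x.1 * p₁ x
      + p₂ x / 8 + 3 / 32 * p₁ x ^ 2) := by
  have hi := inv_scale hd
  have h1 : HasExp polyForms (fun x => √((SphericalPendulum.scale x.1 x.2 (d x))⁻¹))
      (fun _ => 1 / 2) (fun x => -x.1 / 16) (fun x => 3 / 128 * x.2 ^ 2 + 3 / 256 * x.1 ^ 2) := by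
    have h2 : HasExp polyForms (fun x => 4 * (SphericalPendulum.scale x.1 x.2 (d x))⁻¹ - 1)
        (fun _ => 0) (fun x => -x.1 / 4) (fun x => 3 / 32 * x.2 ^ 2 + x.1 ^ 2 / 16) :=
      ((hi.const_mul 4).sub (const 1)).congr_coeff
        (fun x => by ring) (fun x => by ring) fun x => by ring
    refine (h2.sqrt_one_add.const_mul (1 / 2)).congr
      (Eventually.of_forall fun x => ?_) (fun x => ?_) (fun x => ?_) fun x => ?_
    · beta_reduce
      rw [show (1 : ℝ) + (4 * (SphericalPendulum.scale x.1 x.2 (d x))⁻¹ - 1)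
        = 2 ^ 2 * (SphericalPendulum.scale x.1 x.2 (d x))⁻¹ by ring, Real.sqrt_mul (by positivity),
        Real.sqrt_sq (by norm_num)]
      ring
    all_goals ring
  have h3 : HasExp polyForms (fun x => √((1 - p x)⁻¹))
      (fun _ => 1) (fun x => p₁ x / 2) (fun x => p₂ x / 2 + 3 / 8 * p₁ x ^ 2) := by
    have hn : HasExp polyForms (fun x => (-1) * p x) (fun _ => 0) (fun x => -p₁ x)
        (fun x => -p₂ x) :=
      (hp.const_mul (-1)).congr_coeff (fun x => by ring) (fun x => by ring) fun x => by ring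
    have h4 : HasExp polyForms (fun x => (1 + (-1) * p x)⁻¹ - 1) (fun _ => 0) p₁
        (fun x => p₂ x + p₁ x ^ 2) :=
      (hn.inv_one_add.sub (const 1)).congr_coeff
        (fun x => by ring) (fun x => by ring) fun x => by ring
    refine h4.sqrt_one_add.congr
      (Eventually.of_forall fun x => ?_) (fun x => ?_) (fun x => ?_) fun x => ?_
    · simp only []
      congr 1
      rw [show 1 + (-1) * p x = 1 - p x by ring]
      ring
    all_goals ring
  refine (((hi.mul h1).mul h3).const_mul 2).congr
    (Eventually.of_forall fun x => ?_) (fun x => ?_) (fun x => ?_) fun x => ?_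
  · simp only [SphericalPendulum.residue]; ring
  all_goals ring

theorem imFactor_sub_one (hd : OuterRoot d) (hp : HasExp polyForms p (fun _ => 0) p₁ p₂) :
    HasExp polyForms (fun x => imFactor x.1 x.2 (d x) (p x) - 1)
    (fun _ => 0) (fun x => -x.1 / 8 + p₁ x / 2)
    (fun x => x.2 ^ 2 / 64 - x.1 ^ 2 / 128 - x.1 * p₁ x / 16 + p₂ x / 2 + 3 / 8 * p₁ x ^ 2) := by
  have hm : HasExp polyForms (fun x => (-1) * SphericalPendulum.modulusSq x.1 x.2 (d x))
      (fun _ => 0) (fun _ => 0) (fun x => -(x.1 ^ 2 + x.2 ^ 2) / 16) :=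
    ((modulusSq hd).const_mul (-1)).congr_coeff (fun x => by ring) (fun x => by ring)
      fun x => by ring
  refine ((((scale hd).mul (residue hd hp)).mul hm.sqrt_one_add).sub (const 1)).congr
    (Eventually.of_forall fun x => ?_) (fun x => ?_) (fun x => ?_) fun x => ?_
  · simp only [imFactor, neg_mul, one_mul, sub_eq_add_neg]
  all_goals ring

theorem sqrt_one_sub_sub_one (hp : HasExp polyForms p (fun _ => 0) p₁ p₂) :
    HasExp polyForms (fun x => √(1 - p x) - 1) (fun _ => 0) (fun x => -p₁ x / 2)
      (fun x => -p₂ x / 2 - p₁ x ^ 2 / 8) := by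
  have hn : HasExp polyForms (fun x => (-1) * p x) (fun _ => 0) (fun x => -p₁ x)
      (fun x => -p₂ x) :=
    (hp.const_mul (-1)).congr_coeff (fun x => by ring) (fun x => by ring) fun x => by ring
  refine (hn.sqrt_one_add.sub (const 1)).congr
    (Eventually.of_forall fun x => ?_) (fun x => ?_) (fun x => ?_) fun x => ?_
  · simp only [neg_mul, one_mul, sub_eq_add_neg]
  all_goals ring

theorem fst_sq_mem : (fun x : ℝ × ℝ => x.1 ^ 2) ∈ polyForms 2 :=
  ⟨MvPolynomial.X 0 ^ 2, (MvPolynomial.isHomogeneous_X _ _).pow 2, fun x => by simp [evalHJ]⟩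

theorem snd_sq_mem : (fun x : ℝ × ℝ => x.2 ^ 2) ∈ polyForms 2 :=
  ⟨MvPolynomial.X 1 ^ 2, (MvPolynomial.isHomogeneous_X _ _).pow 2, fun x => by simp [evalHJ]⟩

theorem fst_mul_snd_mem : (fun x : ℝ × ℝ => x.1 * x.2) ∈ polyForms 2 :=
  ⟨MvPolynomial.X 0 * MvPolynomial.X 1,
    (MvPolynomial.isHomogeneous_X _ _).mul (MvPolynomial.isHomogeneous_X _ _),
    fun x => by simp [evalHJ]⟩

/-- `reShift` is `j²` times a power series plus `h²/M`. The division by `ϱ²` is thus applied to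
quadratic forms, and the extra factor `t` without constant term provides the degree that
`div_rhoFun_sq_mul` needs. -/
theorem reShift_mul (hd : OuterRoot d) {t t₁ : PlaneFun}
    (ht : HasExp polyForms t (fun _ => 0) t₁ (fun _ => 0)) :
    HasExp ratForms (fun x => reShift x.1 x.2 (d x) * t x / rhoFun x ^ 2) (fun _ => 0)
    (fun x => (3 / 8 * x.2 ^ 2 + x.1 ^ 2 / 4) / rhoFun x ^ 2 * t₁ x)
    (fun x => -(3 * x.2 ^ 2 + x.1 ^ 2) / 16 / rhoFun x ^ 2 * (x.1 * t₁ x)) := by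
  have hi := inv_scale hd
  have h1 : HasExp polyForms (fun x => t x * (d x + (8 * d x + 2 * x.1 * d x
      - 3 * x.2 ^ 2 * d x ^ 2) * (SphericalPendulum.scale x.1 x.2 (d x))⁻¹)) (fun _ => 0)
      (fun x => 3 / 8 * t₁ x) (fun x => -3 / 16 * (x.1 * t₁ x)) :=
    (ht.mul (add hd ((numerator hd).mul hi))).congr_coeff
      (fun x => by ring) (fun x => by ring) fun x => by ring
  have h2 : HasExp polyForms (fun x => t x * (SphericalPendulum.scale x.1 x.2 (d x))⁻¹)
      (fun _ => 0) (fun x => t₁ x / 4) (fun x => -(x.1 * t₁ x) / 16) :=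
    (ht.mul hi).congr_coeff (fun x => by ring) (fun x => by ring) fun x => by ring
  refine ((div_rhoFun_sq_mul snd_sq_mem h1).add (div_rhoFun_sq_mul fst_sq_mem h2)).congr
    (Eventually.of_forall fun x => ?_) (fun x => ?_) (fun x => ?_) fun x => ?_
  · simp only [reShift]; ring
  all_goals ring

/-- The expansion of `Re (Z z̄) / ϱ² - 1`, where `z = h + ij` and `Z` is its perturbation at a
pole. -/
theorem reFactor (hd : OuterRoot d) (σ : ℝ) {y₁ y₂ : PlaneFun}
    (hy : HasExp polyForms (fun x => imFactor x.1 x.2 (d x) (p x) - 1) (fun _ => 0) y₁ y₂) :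
    HasExp ratForms (fun x => (x.2 ^ 2 * (imFactor x.1 x.2 (d x) (p x) - 1)
      + σ * (reShift x.1 x.2 (d x) * x.1)) / (x.1 ^ 2 + x.2 ^ 2)) (fun _ => 0)
    (fun x => (x.2 ^ 2 * y₁ x + σ * ((3 / 8 * x.2 ^ 2 + x.1 ^ 2 / 4) * x.1)) / rhoFun x ^ 2)
    (fun x => (x.2 ^ 2 * y₂ x - σ * ((3 * x.2 ^ 2 + x.1 ^ 2) / 16 * (x.1 * x.1)))
      / rhoFun x ^ 2) := by
  refine ((div_rhoFun_sq_mul snd_sq_mem hy).add ((reShift_mul hd fst).const_mul σ)).congr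
    (Eventually.of_forall fun x => ?_) (fun x => ?_) (fun x => ?_) fun x => ?_
  · simp only [← rhoFun_sq]; ring
  all_goals ring

theorem argShift (hd : OuterRoot d) (σ : ℝ) {y₁ y₂ : PlaneFun}
    (hy : HasExp polyForms (fun x => imFactor x.1 x.2 (d x) (p x) - 1) (fun _ => 0) y₁ y₂) :
    HasExp ratForms (fun x => argShift x.1 x.2 (d x) σ (p x)) (fun _ => 0)
    (fun x => (x.1 * x.2 * y₁ x - σ * ((3 / 8 * x.2 ^ 2 + x.1 ^ 2 / 4) * x.2)) / rhoFun x ^ 2)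
    (fun x => (x.1 * x.2 * y₂ x + σ * ((3 * x.2 ^ 2 + x.1 ^ 2) / 16 * (x.1 * x.2))) / rhoFun x ^ 2
      - (x.1 * x.2 * y₁ x - σ * ((3 / 8 * x.2 ^ 2 + x.1 ^ 2 / 4) * x.2)) / rhoFun x ^ 2
        * ((x.2 ^ 2 * y₁ x + σ * ((3 / 8 * x.2 ^ 2 + x.1 ^ 2 / 4) * x.1)) / rhoFun x ^ 2)) := by
  have h1 := ((div_rhoFun_sq_mul fst_mul_snd_mem hy).sub ((reShift_mul hd snd).const_mul σ)).mul
    (reFactor hd σ hy).inv_one_add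
  have h2 := (h1.congr_coeff (f₀' := fun _ => 0) (fun x => by ring) (fun x => rfl)
    fun x => rfl).arctan
  refine h2.congr (Eventually.of_forall fun x => ?_) (fun x => ?_) (fun x => ?_) fun x => ?_
  · simp only [SphericalPendulum.argShift, ← rhoFun_sq]
    congr 2
    ring
  all_goals ring

end HasExp

theorem modulusSq_eventually_pos (hd : HasExp.OuterRoot d)
    (hd' : ∀ᶠ x in nearZero, 0 < d x ∧
      2 * (2 - x.2 ^ 2 * d x) * (2 + x.1 - x.2 ^ 2 * d x) * d x = 1) :
    ∀ᶠ x in nearZero, 0 < d x ∧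
      2 * (2 - x.2 ^ 2 * d x) * (2 + x.1 - x.2 ^ 2 * d x) * d x = 1 ∧ x.2 ^ 2 * d x < 2 ∧
      x.2 ^ 2 * d x < 2 + x.1 ∧ 0 < scale x.1 x.2 (d x) ∧ 0 < modulusSq x.1 x.2 (d x) := by
  have h1 := ((HasExp.snd.mul HasExp.snd).mul hd).congr_coeff (f₀' := fun _ => 0)
    (fun x => by ring) (fun x => rfl) fun x => rfl
  filter_upwards [hd', eventually_snd_ne, h1.tendsto.eventually (gt_mem_nhds one_pos),
    HasExp.fst.tendsto.eventually (lt_mem_nhds (show (-1 : ℝ) < 0 by norm_num)),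
    HasExp.fst.tendsto.eventually (gt_mem_nhds (show (0 : ℝ) < 1 by norm_num))]
    with x hx hj hδ hh hh'
  have hδ' : x.2 ^ 2 * d x < 1 := by linarith
  have hδ0 : 0 < x.2 ^ 2 * d x := mul_pos (by positivity) hx.1
  have hs : 0 < scale x.1 x.2 (d x) := by unfold scale; linarith
  refine ⟨hx.1, hx.2, by linarith, by linarith, hs, ?_⟩
  unfold modulusSq
  have : 0 < x.1 ^ 2 + 8 * (x.2 ^ 2 * d x) + 2 * x.1 * (x.2 ^ 2 * d x)
      - 3 * (x.2 ^ 2 * d x) ^ 2 := by nlinarith [sq_nonneg x.1]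
  positivity

/-- With `n` the series of `HasExp.numerator`, `r² M² = h² + j² n = ϱ² (1 + (j²/ϱ²)(n - 1))`. Hence
`ln(1/r) = ln(32/ϱ) - 3 ln 2 + ln(M/4) - ½ ln(1 + (j²/ϱ²)(n - 1))`, and only the last term has
denominators. -/
theorem HasLogExp.log_inv_modulus (hd : HasExp.OuterRoot d)
    (hpos : ∀ᶠ x in nearZero, 0 < scale x.1 x.2 (d x) ∧ 0 < modulusSq x.1 x.2 (d x)) :
    HasLogExp (fun x => Real.log (1 / √(modulusSq x.1 x.2 (d x)))) (fun _ => 1) (fun _ => 0)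
      (fun _ => 0) (fun _ => -3 * Real.log 2)
      (fun x => x.1 / 4 + x.1 * x.2 ^ 2 / 8 / rhoFun x ^ 2) := by
  have h1 : HasExp polyForms (fun x => 8 * d x + 2 * x.1 * d x - 3 * x.2 ^ 2 * d x ^ 2 - 1)
      (fun _ => 0) (fun x => -x.1 / 4) (fun x => 5 / 64 * x.2 ^ 2 + x.1 ^ 2 / 8) :=
    ((HasExp.numerator hd).sub (HasExp.const 1)).congr_coeff
      (fun x => by ring) (fun x => by ring) fun x => by ring
  have h2 := (HasExp.div_rhoFun_sq_mul HasExp.snd_sq_mem h1).log_one_add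
  have h3 := (HasExp.scale_sub hd).log_one_add.toRat
  refine (HasLogExp.log.add (((HasExp.const (-3 * Real.log 2)).add h3).sub
    (h2.const_mul (1 / 2))).toLog).congr ?_ (fun x => ?_) (fun x => ?_) (fun x => ?_) (fun x => ?_)
    fun x => ?_
  · filter_upwards [hpos, eventually_snd_ne] with x hx hj
    have hρ := rhoFun_pos hj
    have hρ2 := rhoFun_sq x
    have hm : modulusSq x.1 x.2 (d x) = rhoFun x ^ 2 * (1 + x.2 ^ 2 / rhoFun x ^ 2
        * (8 * d x + 2 * x.1 * d x - 3 * x.2 ^ 2 * d x ^ 2 - 1))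
        / scale x.1 x.2 (d x) ^ 2 := by
      unfold modulusSq
      field_simp
      rw [hρ2]
      ring
    have hb : 0 < 1 + x.2 ^ 2 / rhoFun x ^ 2
        * (8 * d x + 2 * x.1 * d x - 3 * x.2 ^ 2 * d x ^ 2 - 1) := by
      by_contra hc
      have := hx.2
      rw [hm] at this
      refine absurd this (not_lt.2 (div_nonpos_of_nonpos_of_nonneg
        (mul_nonpos_of_nonneg_of_nonpos (by positivity) (not_lt.1 hc)) (by positivity)))
    have hs := hx.1
    rw [one_div √_, Real.log_inv, Real.log_sqrt hx.2.le, hm, Real.log_div (by positivity)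
      (by positivity), Real.log_mul (by positivity) hb.ne', Real.log_pow, Real.log_pow,
      show 1 + ((1 / 4) * scale x.1 x.2 (d x) - 1) = scale x.1 x.2 (d x) / 2 ^ 2 by ring,
      Real.log_div hs.ne' (by norm_num), Real.log_pow, logFun,
      show rho x.1 x.2 = rhoFun x from rfl, Real.log_div (by norm_num) hρ.ne',
      show (32 : ℝ) = 2 ^ 5 by norm_num, Real.log_pow]
    push_cast
    ring
  all_goals ring

/-- The leading `3/8` is `(2 + 1) · ¼ · ½`: three copies of the residue `1/4` times the logarithmic
coefficient `1/2` of `poleIntegral`. -/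
theorem HasLogExp.poleSum (hd : HasExp.OuterRoot d)
    (hpos : ∀ᶠ x in nearZero, 0 < scale x.1 x.2 (d x) ∧ 0 < modulusSq x.1 x.2 (d x)) :
    HasLogExp (fun x => poleSum x.1 x.2 (d x)) (fun _ => 3 / 8) (fun x => -15 / 128 * x.1)
      (fun x => 105 / 2048 * (x.1 ^ 2 + x.2 ^ 2)) (fun _ => 3 / 8)
      (fun x => -3 / 256 * x.1 + 3 / 64 * (x.1 * x.2 ^ 2) / rhoFun x ^ 2) := by
  have hl := HasLogExp.log_inv_modulus hd hpos
  have hu := HasExp.upperPole hd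
  have hw := HasExp.lowerPole hd
  have h1 := HasLogExp.mul (HasExp.residue hd hu) (HasLogExp.poleIntegral
    (HasExp.sqrt_one_sub_sub_one hu) (HasExp.modulusSq hd) (hpos.mono fun x hx => hx.2) hl)
  have h2 := HasLogExp.mul (HasExp.residue hd hw) (HasLogExp.poleIntegral
    (HasExp.sqrt_one_sub_sub_one hw) (HasExp.modulusSq hd) (hpos.mono fun x hx => hx.2) hl)
  refine ((h1.const_mul 2).add h2).congr (Eventually.of_forall fun x => ?_)
    (fun x => ?_) (fun x => ?_) (fun x => ?_) (fun x => ?_) fun x => ?_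
  · simp only [SphericalPendulum.poleSum, add_sub_cancel]
  all_goals ring

end SphericalPendulum

/-! ### Assembly of the expansion -/

namespace SphericalPendulum

open Filter Asymptotics Topology Finset

theorem exists_argShift_poleSum : ∃ T G : PlaneFun,
    (∀ᶠ x in nearZero, 2 * Real.pi * rotationNumber x.1 x.2 = 2 * Real.pi * Real.sign x.2
      - Complex.arg ((x.1 : ℂ) + Complex.I * (x.2 : ℂ)) + T x + x.2 * G x) ∧
    HasExp ratForms T (fun _ => 0)
      (fun x => -(x.2 * (x.1 ^ 2 + 9 / 8 * x.2 ^ 2)) / rhoFun x ^ 2)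
      (fun x => x.1 * x.2 * (20 * x.1 ^ 4 + 42 * x.1 ^ 2 * x.2 ^ 2 + 21 * x.2 ^ 4) / 64
        / rhoFun x ^ 4) ∧
    HasLogExp G (fun _ => 3 / 8) (fun x => -15 / 128 * x.1)
      (fun x => 105 / 2048 * (x.1 ^ 2 + x.2 ^ 2)) (fun _ => 3 / 8)
      (fun x => -3 / 256 * x.1 + 3 / 64 * (x.1 * x.2 ^ 2) / rhoFun x ^ 2) := by
  obtain ⟨d, hd, hd'⟩ := exists_outer_root
  have hpos := modulusSq_eventually_pos hd hd'
  have hu := HasExp.imFactor_sub_one hd (HasExp.upperPole hd)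
  have hw := HasExp.imFactor_sub_one hd (HasExp.lowerPole hd)
  -- `T` collects the corrections to the arguments, which carry no logarithm; `G` collects the pole
  -- integrals, to be multiplied by `j`.
  refine ⟨fun x => -2 * argShift x.1 x.2 (d x) (-1) (upperPole x.1 x.2 (d x))
      + argShift x.1 x.2 (d x) 1 (lowerPole x.1 x.2 (d x)),
    fun x => poleSum x.1 x.2 (d x), ?_, ?_,
    HasLogExp.poleSum hd (hpos.mono fun x hx => hx.2.2.2.2)⟩
  · filter_upwards [hpos, eventually_snd_ne, eventually_sqrt_small (HasExp.modulusSq hd),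
      (HasExp.reFactor hd (-1) hu).tendsto.eventually
        (lt_mem_nhds (show (-1 : ℝ) < 0 by norm_num)),
      (HasExp.reFactor hd 1 hw).tendsto.eventually
        (lt_mem_nhds (show (-1 : ℝ) < 0 by norm_num))]
      with x hx hj hr hE₁ hE₂
    obtain ⟨h0, h1, h2, h3, h4, -⟩ := hx
    rw [two_pi_mul_rotationNumber_of_ne hj h0 h1 h2 h3 h4 hr hE₁ hE₂]
    ring
  · refine (((HasExp.argShift hd (-1) hu).const_mul (-2)).add (HasExp.argShift hd 1 hw)).congr
      EventuallyEq.rfl (fun x => ?_) (fun x => ?_) fun x => ?_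
    · ring
    · ring
    · rcases eq_or_ne (rhoFun x) 0 with h0 | h0
      · simp [h0]
      · field_simp
        rw [rhoFun_sq]
        ring

/-- A numerator is recovered by clearing the denominator off the origin; at the origin it vanishes
by homogeneity. -/
theorem evalHJ_eq_of_div_eq {q : MvPolynomial (Fin 2) ℝ} {n : ℕ} (hn : n ≠ 0)
    (hq : q.IsHomogeneous (3 * n)) {f g : PlaneFun}
    (hf : ∀ x, f x = evalHJ q x.1 x.2 / rhoFun x ^ (2 * n))
    (hfg : ∀ x, rhoFun x ≠ 0 → f x * rhoFun x ^ (2 * n) = g x) (hg : g 0 = 0) (x : ℝ × ℝ) :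
    evalHJ q x.1 x.2 = g x := by
  rcases eq_or_ne (rhoFun x) 0 with h0 | h0
  · rw [rhoFun_eq_zero] at h0
    rw [h0, hg]
    exact evalHJ_zero_of_pos hq (by omega)
  · rw [← hfg x h0, hf]
    field_simp

end SphericalPendulum

open SphericalPendulum in
theorem mainTheorem6 :
    ∃ c p : ℕ → MvPolynomial (Fin 2) ℝ,
      (∀ n, (c n).IsHomogeneous n) ∧
      (∀ n, (p n).IsHomogeneous (3 * n)) ∧
      (∀ h j : ℝ, evalHJ (c 0) h j = 1) ∧
      (∀ h j : ℝ, evalHJ (c 1) h j = -(5 / 16) * h) ∧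
      (∀ h j : ℝ, evalHJ (c 2) h j = 35 / 256 * (h ^ 2 + j ^ 2)) ∧
      (∀ h j : ℝ, evalHJ (p 1) h j = -(j / 8) * (5 * h ^ 2 + 6 * j ^ 2)) ∧
      (∀ h j : ℝ, evalHJ (p 2) h j =
        j * h / 256 * (77 * h ^ 4 + 174 * j ^ 2 * h ^ 2 + 93 * j ^ 4)) ∧
      ∀ N : ℕ,
        (fun x : ℝ × ℝ =>
            2 * Real.pi * rotationNumber x.1 x.2 - partialExpansion c p N x.1 x.2)
          =O[nhdsWithin (0 : ℝ × ℝ) {x | x.2 ≠ 0}]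
        (fun x : ℝ × ℝ => rho x.1 x.2 ^ (N + 1) * Real.log (32 / rho x.1 x.2)) := by
  obtain ⟨T, G, heq, ⟨t, ht, t0, t1, t2, hT⟩, A, B, hA, hB, a0, a1, a2, b0, b1, hG⟩ :=
    exists_argShift_poleSum
  have hsnd : (fun x : ℝ × ℝ => x.2) ∈ polyForms 1 :=
    ⟨MvPolynomial.X 1, MvPolynomial.isHomogeneous_X _ _, fun x => by simp [evalHJ]⟩
  -- The factor `j` raises degrees by one, so the rational term of degree `n + 1` combines the
  -- coefficient `n + 1` of `T` with the coefficient `n` of the rational part of `G`.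
  have hR : ∀ n, PowerSeries.coeff (n + 1) t + (fun x => x.2) * PowerSeries.coeff n B
      ∈ ratForms (n + 1) := fun n => by
    refine Submodule.add_mem _ (ht _) ?_
    rw [add_comm n]
    exact SetLike.GradedMul.mul_mem (polyForms_le_ratForms 1 hsnd) (hB n)
  choose c hc hcA using fun n => Submodule.smul_mem _ (8 / 3 : ℝ) (hA n)
  choose q hq hqR using hR
  let p : ℕ → MvPolynomial (Fin 2) ℝ := fun n => Nat.casesOn n 0 q
  have hcA' : ∀ n x, PowerSeries.coeff n A x = 3 / 8 * evalHJ (c n) x.1 x.2 := fun n x => by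
    rw [← hcA, Pi.smul_apply, smul_eq_mul]; ring
  have hqR' : ∀ n x, PowerSeries.coeff (n + 1) t x + x.2 * PowerSeries.coeff n B x
      = evalHJ (q n) x.1 x.2 / rhoFun x ^ (2 * (n + 1)) := fun n x => hqR n x
  refine ⟨c, p, hc, ?_, fun h j => ?_, fun h j => ?_, fun h j => ?_, fun h j => ?_, fun h j => ?_,
    fun N => ?_⟩
  · rintro (_ | n)
    · exact MvPolynomial.isHomogeneous_zero _ _ _
    · exact hq n
  · have := hcA' 0 (h, j); rw [a0] at this; linarith
  · have := hcA' 1 (h, j); rw [a1] at this; linarith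
  · have := hcA' 2 (h, j); rw [a2] at this; linarith
  · refine evalHJ_eq_of_div_eq (g := fun x => -(x.2 / 8) * (5 * x.1 ^ 2 + 6 * x.2 ^ 2)) one_ne_zero
      (hq 0) (hqR 0) (fun x hx => ?_) (by simp) (h, j)
    simp only [zero_add, mul_one, Pi.add_apply, Pi.mul_apply, t1, b0]
    field_simp
    rw [rhoFun_sq]
    ring
  · refine evalHJ_eq_of_div_eq (g := fun x => x.2 * x.1 / 256
        * (77 * x.1 ^ 4 + 174 * x.2 ^ 2 * x.1 ^ 2 + 93 * x.2 ^ 4)) two_ne_zero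
      (hq 1) (hqR 1) (fun x hx => ?_) (by simp) (h, j)
    simp only [Nat.reduceAdd, Pi.add_apply, Pi.mul_apply, t2, b1]
    field_simp
    rw [show rhoFun x ^ 4 = (rhoFun x ^ 2) ^ 2 by ring, rhoFun_sq]
    ring
  -- `T` is truncated at `N + 1` and `G` at `N`, since the factor `j` supplies the missing power of
  -- `ϱ`.
  · have h1 : (fun x => T x - ∑ n ∈ Finset.range (N + 1), PowerSeries.coeff n t x)
        =O[nearZero] fun x => rhoFun x ^ (N + 1) * logFun x := by
      simpa using (hT.weaken zero_le_one) (N + 1)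
    have h2 : (fun x => x.2 * (G x - ∑ n ∈ Finset.range N, (PowerSeries.coeff n A x * logFun x
        + PowerSeries.coeff n B x))) =O[nearZero] fun x => rhoFun x ^ (N + 1) * logFun x := by
      have := (isBigO_of_mem_polyForms hsnd).mul (hG N)
      refine this.congr (fun x => ?_) fun x => by ring
      simp [PowerSeries.coeff_mul_C]
    refine (h1.add h2).congr' ?_ (Filter.Eventually.of_forall fun x => rfl)
    filter_upwards [heq] with x hx
    have hp : ∑ n ∈ Finset.Icc 1 N, evalHJ (p n) x.1 x.2 / rho x.1 x.2 ^ (2 * n)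
        = ∑ n ∈ Finset.range N, (PowerSeries.coeff (n + 1) t x
          + x.2 * PowerSeries.coeff n B x) := by
      simp only [hqR']
      rw [Finset.range_eq_Ico]
      exact (Finset.sum_Ico_add' (fun n => evalHJ (p n) x.1 x.2 / rho x.1 x.2 ^ (2 * n))
        0 N 1).symm
    rw [hx, partialExpansion, hp, Finset.sum_range_succ', t0, Finset.sum_add_distrib,
      Finset.sum_add_distrib, ← Finset.mul_sum, ← Finset.sum_mul]
    simp only [hcA', ← Finset.mul_sum, logFun]
    ring
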